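/- **Conventions.** A digraph $G$ is a set $V(G)$ of vertices with a set of arrows $E(G)\subseteq V(G)\times V(G)$ containing all degenerate arrows $(v,v)$; digraph maps preserve arrows. In the box product $G\otimes H$ (vertices $V(G)\times V(H)$) there is an arrow $(g,h)\to(g',h')$ iff $g\to g'$ and $h=h'$, or $g=g'$ and $h\to h'$. An interval $J$ is a digraph with vertices $0,\dots,k$ and, for each $i<k$, exactly one of the arrows $i\to i+1$, $i+1\to i$ (and no other nondegenerate arrows); $\partial J=\{0,k\}$. $\mathsf{Shr}$ is the category of intervals and shrinkings, i.e. digraph maps that are surjective and monotone on vertices. $I_m$ is the interval $0\to1\leftarrow2\to\cdots$ with vertices $0,\dots,m$, and $I_m^{\mathrm{op}}$ its opposite. For a pointed digraph $(G,g)$ and $n\ge 0$, the $n$-th cubical homotopy group is the set, depending functorially on $(G,g)$, $$A_n(G,g)=\operatorname*{colim}_{(J_1,\dots,J_n)\in(\mathsf{Shr}^{\mathrm{op}})^n}\Big[\bigotimes_{i=1}^n (J_i,\partial J_i),(G,g)\Big],$$ where $[-,-]$ is the set of maps of pairs modulo the equivalence relation generated by: $f\sim f'$ if $f(x)\to f'(x)$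 is an arrow for every vertex $x$ and $f=f'$ on the subdigraph. A digraph map $\varphi:G\to G'$ is a cubical weak equivalence if $A_n(G,g)\to A_n(G',\varphi(g))$ is bijective for all $n\ge0$ and all vertices $g$ of $G$. Cubical sets are presheaves on the box category $\Box$ with both connections. A Kan complex is a cubical set in which all open boxes have fillers. $[A,X]$ and $[A,X]_*$ denote maps, resp. pointed maps, modulo the equivalence relation generated by homotopies $A\otimes\Box^1\to X$ (constant on the base point in the pointed case). For a pointed Kan complex, $\pi_n(X)=[\Box^n/\partial\Box^n,X]_*$. Weak equivalences are those of the Grothendieck model structure (cofibrations are the monomorphisms, fibrations are the maps with the right lifting property against the open box inclusions), i.e. the maps $A\to B$ for which $[B,K]\to[A,K]$ is bijective for every Kan complex $K$. For an interval $J$ the $J$-nerve is $(N_JG)_n=\mathrm{Hom}(J^{\otimes n},G)$; $N_1=N_{I_1}$, and $N_\infty G$ is the colimit of $$N_{I_1}G\xrightarrow{r^*}N_{I_2}G\xrightarrow{l^*}N_{I_3^{\mathrm{op}}}G\xrightarrow{r^*}N_{I_4^{\mathrm{op}}}G\xrightarrow{l^*}N_{I_5}G\to\cdots,$$ where $r$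 collapses the last arrow of an interval and $l$ the first one. **Proposition.** 1. For every digraph $G$ the cubical set $N_\infty G$ is a Kan complex, and for every $n\ge0$ there is an isomorphism $$A_n(G,g)\cong\pi_n(N_\infty G,g)$$ natural in the pointed digraph $(G,g)$. 2. Let $\varphi:G\to G'$ be a digraph map. Then $N_\infty\varphi$ is a weak equivalence of cubical sets if and only if $N_1\varphi$ is a weak equivalence of cubical sets. If moreover $G$ is nonempty or $G'$ is empty, these conditions hold if and only if $\varphi$ is a cubical weak equivalence. -/

import Mathlib

open CategoryTheory Limits Opposite

universe u v w

noncomputable section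

namespace CubDG

/-! ### Digraphs -/

/-- A digraph: a set of vertices and a set of arrows `E ⊆ V × V` containing the degenerate
arrows `(v, v)`. -/
structure DGra : Type (u + 1) where
  V : Type u
  Arrow : V → V → Prop
  refl : ∀ v, Arrow v v

/-- A digraph map. Nondegenerate arrows may be sent to degenerate ones. -/
@[ext]
structure DGra.Hom (G : DGra.{u}) (H : DGra.{v}) where
  toFun : G.V → H.V
  map_arrow : ∀ {x y : G.V}, G.Arrow x y → H.Arrow (toFun x) (toFun y)

namespace DGra

def Hom.id (G : DGra.{u}) : Hom G G := ⟨fun x => x, fun h => h⟩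

def Hom.comp {G : DGra.{u}} {H : DGra.{v}} {K : DGra.{w}} (f : Hom G H) (g : Hom H K) :
    Hom G K :=
  ⟨fun x => g.toFun (f.toFun x), fun h => g.map_arrow (f.map_arrow h)⟩

instance : Category DGra.{u} where
  Hom G H := Hom G H
  id G := Hom.id G
  comp f g := Hom.comp f g

/-- The box product `G₀ ⊗ ⋯ ⊗ Gₙ₋₁` on tuples of vertices: an arrow moves along an arrow in at
most one coordinate. The empty product is the one-point digraph. -/
abbrev boxProd {n : ℕ} (G : Fin n → DGra.{u}) : DGra.{u} where
  V := ∀ i, (G i).V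
  Arrow x y := x = y ∨ ∃ i, (G i).Arrow (x i) (y i) ∧ ∀ j, j ≠ i → x j = y j
  refl _ := Or.inl rfl

def boxProdMap {n : ℕ} {G : Fin n → DGra.{u}} {H : Fin n → DGra.{v}}
    (f : ∀ i, Hom (G i) (H i)) : Hom (boxProd G) (boxProd H) where
  toFun x i := (f i).toFun (x i)
  map_arrow := by
    rintro x y (h | ⟨i, hi, hj⟩)
    · exact Or.inl (by rw [h])
    · exact Or.inr ⟨i, (f i).map_arrow hi, fun j hji => congrArg (f j).toFun (hj j hji)⟩

end DGra

/-! ### Pairs of digraphs and relative homotopy classes -/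

/-- A pair of digraphs: a digraph and an induced subdigraph, given by its set of vertices. -/
structure DPair : Type (u + 1) where
  G : DGra.{u}
  sub : Set G.V

namespace DPair

@[ext]
structure Hom (P : DPair.{u}) (Q : DPair.{v}) where
  hom : DGra.Hom P.G Q.G
  map_sub : ∀ x ∈ P.sub, hom.toFun x ∈ Q.sub

def Hom.comp {P : DPair.{u}} {Q : DPair.{v}} {R : DPair.{w}} (f : Hom P Q) (g : Hom Q R) :
    Hom P R :=
  ⟨f.hom.comp g.hom, fun x hx => g.map_sub _ (f.map_sub x hx)⟩

/-- The arrows `f → f'` of the digraph `Hom^⊗(P, Q)` of maps of pairs. -/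
def HomArrow {P : DPair.{u}} {Q : DPair.{v}} (f f' : Hom P Q) : Prop :=
  (∀ x, Q.G.Arrow (f.hom.toFun x) (f'.hom.toFun x)) ∧
    ∀ x ∈ P.sub, f.hom.toFun x = f'.hom.toFun x

/-- The set `[P, Q]` of relative homotopy classes: connected components of `Hom^⊗(P, Q)`
(`Quot` divides by the equivalence relation generated by the arrows). -/
def Classes (P : DPair.{u}) (Q : DPair.{v}) : Type (max u v) :=
  Quot (HomArrow (P := P) (Q := Q))

def Classes.precomp {P : DPair.{u}} {Q : DPair.{v}} {R : DPair.{w}} (f : Hom P Q) :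
    Classes Q R → Classes P R :=
  Quot.map (fun g => f.comp g) fun _ _ h =>
    ⟨fun x => h.1 (f.hom.toFun x), fun x hx => h.2 _ (f.map_sub x hx)⟩

def Classes.postcomp {P : DPair.{u}} {Q : DPair.{v}} {R : DPair.{w}} (g : Hom Q R) :
    Classes P Q → Classes P R :=
  Quot.map (fun f => f.comp g) fun _ _ h =>
    ⟨fun x => g.hom.map_arrow (h.1 x), fun x hx => congrArg g.hom.toFun (h.2 x hx)⟩

/-- The box product of pairs: the subdigraph consists of the tuples for which at least one
coordinate lies in the given subdigraph. The empty product is `(*, ∅)`. -/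
abbrev boxProd {n : ℕ} (P : Fin n → DPair.{u}) : DPair.{u} where
  G := DGra.boxProd fun i => (P i).G
  sub := {x | ∃ i, x i ∈ (P i).sub}

def boxProdMap {n : ℕ} {P : Fin n → DPair.{u}} {Q : Fin n → DPair.{v}}
    (f : ∀ i, Hom (P i) (Q i)) : Hom (boxProd P) (boxProd Q) where
  hom := DGra.boxProdMap fun i => (f i).hom
  map_sub := fun _ ⟨i, hi⟩ => ⟨i, (f i).map_sub _ hi⟩

end DPair

/-- A pointed digraph. -/
structure PDGra : Type (u + 1) where
  G : DGra.{u}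
  pt : G.V

namespace PDGra

@[ext]
structure Hom (G H : PDGra.{u}) where
  hom : G.G ⟶ H.G
  map_pt : hom.toFun G.pt = H.pt

instance : Category PDGra.{u} where
  Hom G H := Hom G H
  id G := ⟨𝟙 G.G, rfl⟩
  comp f g := ⟨f.hom ≫ g.hom,
    (congrArg g.hom.toFun f.map_pt).trans g.map_pt⟩

abbrev toPair (G : PDGra.{u}) : DPair.{u} := ⟨G.G, {G.pt}⟩

def toPairMap {G H : PDGra.{u}} (f : G ⟶ H) : DPair.Hom G.toPair H.toPair :=
  ⟨f.hom, by rintro x rfl; exact f.map_pt⟩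

end PDGra

/-! ### Intervals, shrinkings and cubical homotopy groups -/

/-- An interval `J` with vertices `0, …, len`: for each `i < len` the arrow is `i → i + 1` if
`fwd i = true` and `i + 1 → i` if `fwd i = false`. -/
structure Interval : Type where
  len : ℕ
  fwd : Fin len → Bool

namespace Interval

abbrev toDGra (J : Interval) : DGra.{0} where
  V := Fin (J.len + 1)
  Arrow x y := x = y ∨ ∃ i : Fin J.len,
    (J.fwd i = true ∧ x = i.castSucc ∧ y = i.succ) ∨
    (J.fwd i = false ∧ x = i.succ ∧ y = i.castSucc)
  refl _ := Or.inl rfl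

/-- A shrinking: a digraph map of intervals that is surjective and monotone on vertices. -/
@[ext]
structure Shrinking (J J' : Interval) where
  hom : DGra.Hom J.toDGra J'.toDGra
  surj : Function.Surjective (hom.toFun : Fin (J.len + 1) → Fin (J'.len + 1))
  mono : Monotone (hom.toFun : Fin (J.len + 1) → Fin (J'.len + 1))

/-- The category `Shr` of intervals and shrinkings. -/
instance : Category Interval where
  Hom J J' := Shrinking J J'
  id J := ⟨DGra.Hom.id _, fun x => ⟨x, rfl⟩, fun _ _ h => h⟩
  comp f g := ⟨f.hom.comp g.hom, g.surj.comp f.surj, g.mono.comp f.mono⟩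

/-- The pair `(J, ∂J)`, where `∂J` consists of the two end-points. -/
abbrev toPair (J : Interval) : DPair.{0} where
  G := J.toDGra
  sub := {x | x = (0 : Fin (J.len + 1)) ∨ x = Fin.last J.len}

theorem Shrinking.map_zero {J J' : Interval} (f : Shrinking J J') :
    f.hom.toFun (0 : Fin (J.len + 1)) = (0 : Fin (J'.len + 1)) := by
  obtain ⟨x, hx⟩ := f.surj 0
  exact le_antisymm ((f.mono (Fin.zero_le x)).trans hx.le) (Fin.zero_le _)

theorem Shrinking.map_last {J J' : Interval} (f : Shrinking J J') :
    f.hom.toFun (Fin.last J.len) = Fin.last J'.len := by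
  obtain ⟨x, hx⟩ := f.surj (Fin.last J'.len)
  exact le_antisymm (Fin.le_last _) (hx.ge.trans (f.mono (Fin.le_last x)))

def toPairMap {J J' : Interval} (f : J ⟶ J') : DPair.Hom J.toPair J'.toPair where
  hom := f.hom
  map_sub := by
    rintro x (rfl | rfl)
    · exact Or.inl f.map_zero
    · exact Or.inr f.map_last

end Interval

/-- The functor `(J₁, …, Jₙ) ↦ [⨂ (Jᵢ, ∂Jᵢ), (G, g)]` on the `n`-fold product of `Shrᵒᵖ`. -/
def loopClasses (n : ℕ) (G : PDGra.{u}) : (Fin n → Intervalᵒᵖ) ⥤ Type u where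
  obj J := DPair.Classes (DPair.boxProd fun i => (J i).unop.toPair) G.toPair
  map f := ↾(DPair.Classes.precomp (DPair.boxProdMap fun i => Interval.toPairMap (f i).unop))
  map_id J := by
    ext ⟨x⟩
    rfl
  map_comp f g := by
    ext ⟨x⟩
    rfl

def loopClassesMap (n : ℕ) {G H : PDGra.{u}} (φ : G ⟶ H) :
    loopClasses n G ⟶ loopClasses n H where
  app J := ↾(DPair.Classes.postcomp (PDGra.toPairMap φ))
  naturality J J' f := by
    ext ⟨x⟩
    rfl

/-- The cubical homotopy groups `Aₙ(G, g) = colim [⨂ (Jᵢ, ∂Jᵢ), (G, g)]` (as sets), the colimit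
being taken over the `n`-fold product of `Shrᵒᵖ`, as a functor of the pointed digraph. -/
def A (n : ℕ) : PDGra.{u} ⥤ Type u where
  obj G := colimit (loopClasses n G)
  map φ := colimMap (loopClassesMap n φ)
  map_id G := by
    apply colimit.hom_ext
    intro J
    rw [ι_colimMap, Category.comp_id]
    ext ⟨x⟩
    rfl
  map_comp f g := by
    apply colimit.hom_ext
    intro J
    rw [ι_colimMap, ι_colimMap_assoc, ι_colimMap]
    ext ⟨x⟩
    rfl

/-- A digraph map is a cubical weak equivalence if it induces bijections on `Aₙ` for every
`n ≥ 0` and every base vertex. -/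
def IsCubicalWeakEquiv {G H : DGra.{u}} (φ : G ⟶ H) : Prop :=
  ∀ (n : ℕ) (g : G.V),
    IsIso ((A n).map (⟨φ, rfl⟩ : (⟨G, g⟩ : PDGra.{u}) ⟶ ⟨H, φ.toFun g⟩))

/-! ### The box category with both connections -/

/-- Words in the generating cofaces, codegeneracies and coconnections. -/
inductive BoxWord : ℕ → ℕ → Type
  | id (n : ℕ) : BoxWord n n
  | comp {m n k : ℕ} : BoxWord m n → BoxWord n k → BoxWord m k
  | face {n : ℕ} (i : Fin (n + 1)) (ε : Bool) : BoxWord n (n + 1)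
  | degen {n : ℕ} (i : Fin (n + 1)) : BoxWord (n + 1) n
  | conn {n : ℕ} (i : Fin (n + 1)) (ε : Bool) : BoxWord (n + 2) (n + 1)

/-- The action of a word on the powers of a bounded lattice: `face i ε` inserts `⊥`
(`ε = false`) or `⊤` (`ε = true`) as `i`-th coordinate, `degen i` forgets the `i`-th coordinate,
`conn i ε` replaces the coordinates `i`, `i + 1` by their maximum (`ε = false`) or
minimum (`ε = true`). -/
def BoxWord.eval (L : Type*) [Lattice L] [BoundedOrder L] :
    ∀ {m n : ℕ}, BoxWord m n → (Fin m → L) → (Fin n → L)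
  | _, _, .id _, x => x
  | _, _, .comp a b, x => b.eval L (a.eval L x)
  | _, _, .face i ε, x => i.insertNth (if ε then ⊤ else ⊥) x
  | _, _, .degen i, x => fun j => x (i.succAbove j)
  | _, _, .conn i ε, x => fun j =>
      if j < i then x j.castSucc
      else if j = i then
        (if ε then x i.castSucc ⊓ x i.succ else x i.castSucc ⊔ x i.succ)
      else x j.succ

/-- The box category `□`: its objects are the posets `[1]ⁿ`. -/
structure Box : Type where
  dim : ℕ

namespace Box

/-- A morphism `[1]ᵐ → [1]ⁿ`: a composite of cofaces, codegeneracies and coconnections, regarded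
as a map `{0, 1}ᵐ → {0, 1}ⁿ`. -/
@[ext]
structure Hom (a b : Box) where
  toFun : (Fin a.dim → Bool) → (Fin b.dim → Bool)
  isWord : ∃ s : BoxWord a.dim b.dim, s.eval Bool = toFun

instance : Category Box where
  Hom a b := Hom a b
  id a := ⟨fun x => x, BoxWord.id _, rfl⟩
  comp f g := ⟨fun x => g.toFun (f.toFun x), by
    obtain ⟨s, hs⟩ := f.isWord
    obtain ⟨t, ht⟩ := g.isWord
    exact ⟨s.comp t, by rw [← hs, ← ht]; rfl⟩⟩

def ofWord {m n : ℕ} (s : BoxWord m n) : (⟨m⟩ : Box) ⟶ ⟨n⟩ := Hom.mk (s.eval Bool) ⟨s, rfl⟩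

abbrev face {n : ℕ} (i : Fin (n + 1)) (ε : Bool) : (⟨n⟩ : Box) ⟶ ⟨n + 1⟩ := ofWord (.face i ε)

abbrev degen {n : ℕ} (i : Fin (n + 1)) : (⟨n + 1⟩ : Box) ⟶ ⟨n⟩ := ofWord (.degen i)

end Box

theorem BoxWord.eval_hom {L M : Type*} [Lattice L] [BoundedOrder L] [Lattice M] [BoundedOrder M]
    (χ : BoundedLatticeHom L M) {m n : ℕ} (s : BoxWord m n) (x : Fin m → L) (j : Fin n) :
    χ (s.eval L x j) = s.eval M (fun i => χ (x i)) j := by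
  induction s with
  | id n => rfl
  | comp a b iha ihb =>
    simp only [BoxWord.eval]
    rw [ihb]
    congr 1
    funext i
    exact iha x i
  | face i ε =>
    simp only [BoxWord.eval]
    refine Fin.succAboveCases i ?_ (fun k => ?_) j
    · cases ε <;> simp
    · simp
  | degen i => rfl
  | conn i ε =>
    simp only [BoxWord.eval]
    cases ε <;> (split_ifs <;> simp)

/-- The lattice homomorphism `x ↦ [t ≤ x]` on a finite chain. -/
def thresholdHom {k : ℕ} (t : Fin (k + 1)) (ht : 0 < t) :
    BoundedLatticeHom (Fin (k + 1)) Bool where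
  toFun x := decide (t ≤ x)
  map_sup' a b := by simp
  map_inf' a b := by simp
  map_top' := by simp
  map_bot' := by
    change decide (t ≤ 0) = false
    simpa using ht.ne'

/-- The action of a word on the powers of a finite chain depends only on its action on the
powers of `{0, 1}`. -/
theorem BoxWord.eval_eq {m n : ℕ} {s t : BoxWord m n} (h : s.eval Bool = t.eval Bool) (k : ℕ) :
    s.eval (Fin (k + 1)) = t.eval (Fin (k + 1)) := by
  have key : ∀ (a b : Fin (k + 1)),
      (∀ (c : Fin (k + 1)) (hc : 0 < c), thresholdHom c hc a = thresholdHom c hc b) →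
        a ≤ b := by
    intro a b hab
    rcases Nat.eq_zero_or_pos a.val with h0 | h0
    · exact Fin.le_def.2 (by omega)
    · have := hab a (Fin.lt_def.2 h0)
      have h1 : decide (a ≤ a) = decide (a ≤ b) := this
      simpa using h1
  funext x j
  refine le_antisymm (key _ _ fun c hc => ?_) (key _ _ fun c hc => ?_) <;>
    rw [BoxWord.eval_hom, BoxWord.eval_hom, h]

namespace Interval

theorem arrow_congr {J : Interval} {f : Fin (J.len + 1) → Fin (J.len + 1)}
    (hf : ∀ i : Fin J.len, f i.castSucc = f i.succ ∨
      (f i.castSucc = i.castSucc ∧ f i.succ = i.succ))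
    {x y : J.toDGra.V} (h : J.toDGra.Arrow x y) : J.toDGra.Arrow (f x) (f y) := by
  rcases h with rfl | ⟨i, ⟨h, rfl, rfl⟩ | ⟨h, rfl, rfl⟩⟩
  · exact Or.inl rfl
  · rcases hf i with e | ⟨e, e'⟩
    · exact Or.inl e
    · exact Or.inr ⟨i, Or.inl ⟨h, e, e'⟩⟩
  · rcases hf i with e | ⟨e, e'⟩
    · exact Or.inl e.symm
    · exact Or.inr ⟨i, Or.inr ⟨h, e', e⟩⟩

theorem arrow_sup {J : Interval} (c : Fin (J.len + 1)) {x y : Fin (J.len + 1)}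
    (h : J.toDGra.Arrow x y) : J.toDGra.Arrow (x ⊔ c) (y ⊔ c) :=
  arrow_congr (f := fun x => x ⊔ c) (fun i => by
    rcases le_or_gt c i.castSucc with hc | hc
    · exact Or.inr ⟨sup_eq_left.2 hc, sup_eq_left.2 (hc.trans (Fin.castSucc_lt_succ (i := i)).le)⟩
    · have hc' : i.succ ≤ c := Fin.castSucc_lt_iff_succ_le.1 hc
      exact Or.inl ((sup_eq_right.2 hc.le).trans (sup_eq_right.2 hc').symm)) h

theorem arrow_inf {J : Interval} (c : Fin (J.len + 1)) {x y : Fin (J.len + 1)}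
    (h : J.toDGra.Arrow x y) : J.toDGra.Arrow (x ⊓ c) (y ⊓ c) :=
  arrow_congr (f := fun x => x ⊓ c) (fun i => by
    rcases le_or_gt c i.castSucc with hc | hc
    · have hc' := hc.trans (Fin.castSucc_lt_succ (i := i)).le
      exact Or.inl ((inf_eq_right.2 hc).trans (inf_eq_right.2 hc').symm)
    · have hc' : i.succ ≤ c := Fin.castSucc_lt_iff_succ_le.1 hc
      exact Or.inr ⟨inf_eq_left.2 hc.le, inf_eq_left.2 hc'⟩) h

/-- The digraph `J^{⊗ n}`. -/
abbrev cube (J : Interval) (n : ℕ) : DGra.{0} := DGra.boxProd fun _ : Fin n => J.toDGra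

theorem cube_arrow {J : Interval} {n : ℕ} {x y : (J.cube n).V} (i : Fin n)
    (h : J.toDGra.Arrow (x i) (y i)) (h' : ∀ j, j ≠ i → x j = y j) : (J.cube n).Arrow x y :=
  Or.inr ⟨i, h, h'⟩

theorem eval_arrow (J : Interval) {m n : ℕ} (s : BoxWord m n) {x y : (J.cube m).V}
    (h : (J.cube m).Arrow x y) :
    (J.cube n).Arrow (s.eval (Fin (J.len + 1)) x) (s.eval (Fin (J.len + 1)) y) := by
  induction s with
  | id n => exact h
  | comp a b iha ihb => exact ihb (iha h)
  | face i ε =>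
    rcases h with rfl | ⟨k, hk, hne⟩
    · exact Or.inl rfl
    · refine cube_arrow (i.succAbove k) ?_ fun j => ?_
      · simpa [BoxWord.eval] using hk
      · refine Fin.succAboveCases i ?_ (fun l => ?_) j
        · intro _; simp [BoxWord.eval]
        · intro hl
          simpa [BoxWord.eval] using hne l fun e => hl (by rw [e])
  | degen i =>
    rcases h with rfl | ⟨k, hk, hne⟩
    · exact Or.inl rfl
    · rcases Fin.eq_self_or_eq_succAbove i k with rfl | ⟨l, rfl⟩
      · left
        funext j
        exact hne _ (Fin.succAbove_ne _ _)
      · exact cube_arrow l hk fun j hj => hne _ fun e => hj (Fin.succAbove_right_injective e)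
  | conn i ε =>
    rcases h with rfl | ⟨k, hk, hne⟩
    · exact Or.inl rfl
    · have main : ∀ l, (∀ j, j ≠ l → j < i → j.castSucc ≠ k) →
          (∀ j, j ≠ l → i < j → j.succ ≠ k) →
          (i ≠ l → i.castSucc ≠ k ∧ i.succ ≠ k) →
          J.toDGra.Arrow ((BoxWord.conn i ε).eval (Fin (J.len + 1)) x l)
            ((BoxWord.conn i ε).eval (Fin (J.len + 1)) y l) →
          (J.cube _).Arrow ((BoxWord.conn i ε).eval (Fin (J.len + 1)) x)
            ((BoxWord.conn i ε).eval (Fin (J.len + 1)) y) := by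
        intro l h1 h2 h3 h4
        refine cube_arrow l h4 fun j hj => ?_
        simp only [BoxWord.eval]
        rcases lt_trichotomy j i with hji | rfl | hji
        · rw [if_pos hji, if_pos hji, hne _ (h1 j hj hji)]
        · rw [hne _ (h3 hj).1, hne _ (h3 hj).2]
        · rw [if_neg hji.not_gt, if_neg hji.not_gt, if_neg hji.ne', if_neg hji.ne',
            hne _ (h2 j hj hji)]
      rcases lt_trichotomy k i.castSucc with hki | rfl | hki
      · -- the moving coordinate comes before `i`
        obtain ⟨l, rfl⟩ : ∃ l : Fin (_ + 1), l.castSucc = k :=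
          ⟨⟨k, by have := Fin.lt_def.1 hki; simp at this; omega⟩, rfl⟩
        have hli : l < i := hki
        refine main l ?_ ?_ ?_ ?_
        · intro j hj _ e; exact hj (Fin.castSucc_injective _ e)
        · intro j _ hj e
          have := congrArg Fin.val e; have := Fin.lt_def.1 hj; have := Fin.lt_def.1 hli
          simp at *; omega
        · intro _
          have := Fin.lt_def.1 hli
          constructor <;> (intro e; have := congrArg Fin.val e; simp at *; try omega)
        · simpa [BoxWord.eval, hli] using hk
      · refine main i ?_ ?_ (fun h => absurd rfl h) ?_
        · intro j hj _ e; exact hj (Fin.castSucc_injective _ e)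
        · intro j _ hj e
          have := congrArg Fin.val e; have := Fin.lt_def.1 hj
          simp at *; omega
        · have h' : y i.succ = x i.succ := (hne _ (Fin.castSucc_lt_succ (i := i)).ne').symm
          simp only [BoxWord.eval, lt_irrefl, if_false, if_true]
          rw [h']
          cases ε
          · exact arrow_sup _ hk
          · exact arrow_inf _ hk
      · obtain ⟨l, rfl⟩ := Fin.eq_succ_of_ne_zero (Fin.ne_zero_of_lt hki)
        have hil : i ≤ l := by
          have := Fin.lt_def.1 hki
          rw [Fin.le_def]; simp at this; omega
        rcases hil.eq_or_lt with rfl | hil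
        · refine main i ?_ ?_ (fun h => absurd rfl h) ?_
          · intro j _ hj e
            have := congrArg Fin.val e; have := Fin.lt_def.1 hj
            simp at *; omega
          · intro j hj _ e; exact hj (Fin.succ_injective _ e)
          · have h' : y i.castSucc = x i.castSucc :=
              (hne _ (Fin.castSucc_lt_succ (i := i)).ne).symm
            simp only [BoxWord.eval, lt_irrefl, if_false, if_true]
            rw [h']
            cases ε
            · simp only [Bool.false_eq_true, if_false]
              rw [sup_comm, sup_comm (x i.castSucc)]
              exact arrow_sup _ hk
            · simp only [if_true]
              rw [inf_comm, inf_comm (x i.castSucc)]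
              exact arrow_inf _ hk
        · refine main l ?_ ?_ ?_ ?_
          · intro j _ hj e
            have := congrArg Fin.val e; have := Fin.lt_def.1 hj; have := Fin.lt_def.1 hil
            simp at *; omega
          · intro j hj _ e; exact hj (Fin.succ_injective _ e)
          · intro _
            have := Fin.lt_def.1 hil
            constructor <;> (intro e; have := congrArg Fin.val e; simp at *; try omega)
          · simpa [BoxWord.eval, hil.not_gt, hil.ne'] using hk

/-- The cocubical digraph `[1]ⁿ ↦ J^{⊗ n}` on morphisms: a composite of cofaces, codegeneracies
and coconnections acts by the same composite, formed in the chain `{0, …, len}`. -/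
def cubeMap (J : Interval) {a b : Box} (f : a ⟶ b) :
    DGra.Hom (J.cube a.dim) (J.cube b.dim) where
  toFun := f.isWord.choose.eval (Fin (J.len + 1))
  map_arrow h := J.eval_arrow f.isWord.choose h

theorem cubeMap_eq (J : Interval) {a b : Box} (f : a ⟶ b) (s : BoxWord a.dim b.dim)
    (hs : s.eval Bool = f.toFun) : (J.cubeMap f).toFun = s.eval (Fin (J.len + 1)) :=
  BoxWord.eval_eq (f.isWord.choose_spec.trans hs.symm) _

theorem cubeMap_id (J : Interval) (a : Box) : J.cubeMap (𝟙 a) = DGra.Hom.id _ :=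
  DGra.Hom.ext (J.cubeMap_eq (𝟙 a) (.id _) rfl)

theorem cubeMap_comp (J : Interval) {a b c : Box} (f : a ⟶ b) (g : b ⟶ c) :
    J.cubeMap (f ≫ g) = (J.cubeMap f).comp (J.cubeMap g) := by
  apply DGra.Hom.ext
  obtain ⟨s, hs⟩ := f.isWord
  obtain ⟨t, ht⟩ := g.isWord
  rw [J.cubeMap_eq (f ≫ g) (s.comp t) (by
    funext x
    change t.eval Bool (s.eval Bool x) = g.toFun (f.toFun x)
    rw [hs, ht])]
  simp only [DGra.Hom.comp]
  rw [J.cubeMap_eq f s hs, J.cubeMap_eq g t ht]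
  rfl

/-- A shrinking is a homomorphism of bounded lattices. -/
def Shrinking.toLatticeHom {J J' : Interval} (f : Shrinking J J') :
    BoundedLatticeHom (Fin (J.len + 1)) (Fin (J'.len + 1)) where
  toFun := f.hom.toFun
  map_sup' := f.mono.map_sup
  map_inf' := f.mono.map_inf
  map_top' := f.map_last
  map_bot' := f.map_zero

/-- The map `J^{⊗ n} → J'^{⊗ n}` induced by a shrinking. -/
def shrinkCube {J J' : Interval} (r : J ⟶ J') (n : ℕ) : DGra.Hom (J.cube n) (J'.cube n) :=
  DGra.boxProdMap fun _ => r.hom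

theorem cubeMap_shrinkCube {J J' : Interval} (r : J ⟶ J') {a b : Box} (f : a ⟶ b) :
    (J.cubeMap f).comp (shrinkCube r b.dim) = (shrinkCube r a.dim).comp (J'.cubeMap f) := by
  apply DGra.Hom.ext
  funext x
  funext j
  exact BoxWord.eval_hom (Shrinking.toLatticeHom r) f.isWord.choose x j |>.trans rfl

end Interval

/-! ### Cubical sets and cubical nerves -/

/-- Cubical sets (with both connections). -/
abbrev cSet : Type (u + 1) := Boxᵒᵖ ⥤ Type u

/-- The cubical `J`-nerve `(N_J G)ₙ = Hom(J^{⊗ n}, G)`. -/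
def nerveObj (J : Interval) (G : DGra.{u}) : cSet.{u} where
  obj a := DGra.Hom (J.cube a.unop.dim) G
  map f := ↾fun h => (J.cubeMap f.unop).comp h
  map_id a := by
    apply ConcreteCategory.hom_ext
    intro h
    change (J.cubeMap (𝟙 a.unop)).comp h = h
    rw [J.cubeMap_id]
    rfl
  map_comp f g := by
    apply ConcreteCategory.hom_ext
    intro h
    change (J.cubeMap (g.unop ≫ f.unop)).comp h = _
    rw [J.cubeMap_comp]
    rfl

/-- The `J`-nerve as a functor of the digraph. -/
def nerve (J : Interval) : DGra.{u} ⥤ cSet.{u} where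
  obj G := nerveObj J G
  map φ := { app a := ↾fun h => DGra.Hom.comp h φ }

/-- The map `r^* : N_{J'} → N_J` induced by a shrinking `r : J → J'`, so that the nerves form a
functor on `Shrᵒᵖ`. -/
def nerveFunctor : Intervalᵒᵖ ⥤ DGra.{u} ⥤ cSet.{u} where
  obj J := nerve J.unop
  map r :=
    { app G :=
        { app a := ↾fun h => (Interval.shrinkCube r.unop a.unop.dim).comp h
          naturality a b f := by
            ext h
            change (Interval.shrinkCube r.unop _).comp ((Interval.cubeMap _ f.unop).comp h) =
              (Interval.cubeMap _ f.unop).comp ((Interval.shrinkCube r.unop _).comp h)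
            change ((Interval.shrinkCube r.unop _).comp (Interval.cubeMap _ f.unop)).comp h =
              ((Interval.cubeMap _ f.unop).comp (Interval.shrinkCube r.unop _)).comp h
            rw [Interval.cubeMap_shrinkCube] } }

/-- The standard interval `I_m` (`op = false`), in which the arrow between `i` and `i + 1` is
`i → i + 1` for even `i` and `i + 1 → i` for odd `i`, and its opposite `I_mᵒᵖ` (`op = true`). -/
abbrev stdInterval (m : ℕ) (op : Bool) : Interval where
  len := m
  fwd i := if op then decide (Odd i.val) else decide (Even i.val)

/-- The `k`-th term of the sequence `I₁, I₂, I₃ᵒᵖ, I₄ᵒᵖ, I₅, I₆, I₇ᵒᵖ, …`. -/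
abbrev stInterval (k : ℕ) : Interval := stdInterval (k + 1) (decide (Odd (k / 2)))

theorem stInterval_fwd (k : ℕ) (i : Fin (k + 1)) :
    (stInterval k).fwd i = decide (Even (i.val + k / 2)) := by
  rcases Nat.even_or_odd (k / 2) with h | h <;>
    simp [h, Nat.even_add, Nat.not_odd_iff_even.2, Nat.not_even_iff_odd.2]

/-- The maps of the sequence `⋯ → I₄ᵒᵖ → I₃ᵒᵖ → I₂ → I₁`: the right truncation `r`
(`x ↦ min x len`) from term `k + 1` to term `k` for even `k`, and the left truncation `l`
(`0 ↦ 0`, `x + 1 ↦ x`) for odd `k`. -/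
def stShrinking (k : ℕ) : stInterval (k + 1) ⟶ stInterval k where
  hom :=
    { toFun := fun x : Fin (k + 3) =>
        (⟨if Even k then min x.val (k + 1) else x.val - 1, by split_ifs <;> omega⟩ : Fin (k + 2))
      map_arrow := by
        intro x y h
        rcases h with rfl | ⟨⟨i, hi⟩, h⟩
        · exact Or.inl rfl
        · change i < k + 2 at hi
          rw [stInterval_fwd] at h
          by_cases hk : Even k
          · have e : (k + 1) / 2 = k / 2 := by obtain ⟨c, rfl⟩ := hk; omega
            rcases Nat.lt_or_ge i (k + 1) with hi' | hi'
            · right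
              refine ⟨⟨i, hi'⟩, ?_⟩
              rw [stInterval_fwd]
              rw [e] at h
              rcases h with ⟨h, rfl, rfl⟩ | ⟨h, rfl, rfl⟩
              · exact Or.inl ⟨h, Fin.ext (by simp [hk]; omega), Fin.ext (by simp [hk]; omega)⟩
              · exact Or.inr ⟨h, Fin.ext (by simp [hk]; omega), Fin.ext (by simp [hk]; omega)⟩
            · left
              obtain rfl : i = k + 1 := by omega
              rcases h with ⟨h, rfl, rfl⟩ | ⟨h, rfl, rfl⟩ <;> exact Fin.ext (by simp [hk])
          · have e : (k + 1) / 2 = k / 2 + 1 := by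
              obtain ⟨c, rfl⟩ := Nat.not_even_iff_odd.1 hk; omega
            rcases Nat.eq_zero_or_pos i with rfl | hi'
            · left
              rcases h with ⟨h, rfl, rfl⟩ | ⟨h, rfl, rfl⟩ <;> exact Fin.ext (by simp [hk])
            · right
              obtain ⟨i, rfl⟩ : ∃ c, i = c + 1 := ⟨i - 1, by omega⟩
              have e' : Even (i + 1 + (k + 1) / 2) ↔ Even (i + k / 2) := by
                have : i + 1 + (k / 2 + 1) = (i + k / 2) + 2 := by omega
                rw [e, this]
                simp [Nat.even_add]
              refine ⟨⟨i, Nat.lt_of_succ_lt_succ hi⟩, ?_⟩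
              rw [stInterval_fwd]
              simp only [e'] at h
              rcases h with ⟨h, rfl, rfl⟩ | ⟨h, rfl, rfl⟩
              · exact Or.inl ⟨h, Fin.ext (by simp [hk]), Fin.ext (by simp [hk])⟩
              · exact Or.inr ⟨h, Fin.ext (by simp [hk]), Fin.ext (by simp [hk])⟩ }
  surj := by
    intro y
    have hy : y.val < k + 2 := y.isLt
    by_cases hk : Even k
    · exact ⟨(⟨y.val, by omega⟩ : Fin (k + 3)), Fin.ext (by simp [hk]; omega)⟩
    · exact ⟨(⟨y.val + 1, by omega⟩ : Fin (k + 3)), Fin.ext (by simp [hk])⟩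
  mono := by
    intro x y hxy
    have hxy' : x.val ≤ y.val := hxy
    rw [Fin.le_def]
    by_cases hk : Even k
    · simp [hk]; omega
    · simp [hk]; omega

/-- The sequence `N₁ → N₂ → N₃ᵒᵖ → N₄ᵒᵖ → ⋯` of nerve functors. -/
def nerveSequence : ℕ ⥤ DGra.{u} ⥤ cSet.{u} :=
  Functor.ofSequence (fun k => (stShrinking k).op) ⋙ nerveFunctor

/-- The infinite cubical nerve `N_∞ G`, the colimit of `N₁ G → N₂ G → N₃ᵒᵖ G → N₄ᵒᵖ G → ⋯`. -/
def nerveInf : DGra.{u} ⥤ cSet.{u} := nerveSequence.flip ⋙ colim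

/-! ### Homotopy theory of cubical sets -/

/-- The standard cube `□ⁿ`. -/
abbrev stdCube (n : ℕ) : cSet.{u} := uliftYoneda.{u}.obj (⟨n⟩ : Box)

/-- The face `∂^{i,ε}(□ⁿ)` of `□ⁿ⁺¹`. -/
def faceSub {n : ℕ} (i : Fin (n + 1)) (ε : Bool) : Subfunctor (stdCube.{u} (n + 1)) :=
  Subfunctor.range (uliftYoneda.{u}.map (Box.face i ε))

/-- The boundary `∂□ⁿ`, the union of all faces. -/
def boundary : ∀ n : ℕ, Subfunctor (stdCube.{u} n)
  | 0 => ⊥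
  | _ + 1 => ⨆ (i) (ε), faceSub i ε

/-- The open box in `□ⁿ⁺¹`: the union of all faces except `∂^{i,ε}`. -/
def openBox {n : ℕ} (i : Fin (n + 1)) (ε : Bool) : Subfunctor (stdCube.{u} (n + 1)) :=
  ⨆ (j) (δ) (_ : (j, δ) ≠ (i, ε)), faceSub j δ

/-- Kan complexes: every open box has a filler. -/
def IsKan (X : cSet.{u}) : Prop :=
  ∀ (n : ℕ) (i : Fin (n + 1)) (ε : Bool) (f : (openBox i ε).toFunctor ⟶ X),
    ∃ g : stdCube (n + 1) ⟶ X, (openBox i ε).ι ≫ g = f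

/-- A word acting on the first `m` of `m + 1` coordinates. -/
def BoxWord.cyl : ∀ {m n : ℕ}, BoxWord m n → BoxWord (m + 1) (n + 1)
  | _, _, .id n => .id (n + 1)
  | _, _, .comp a b => .comp a.cyl b.cyl
  | _, _, .face i ε => .face i.castSucc ε
  | _, _, .degen i => .degen i.castSucc
  | _, _, .conn i ε => .conn i.castSucc ε

theorem BoxWord.eval_cyl (L : Type*) [Lattice L] [BoundedOrder L] {m n : ℕ} (s : BoxWord m n)
    (x : Fin (m + 1) → L) :
    s.cyl.eval L x = Fin.snoc (α := fun _ => L) (s.eval L (Fin.init x)) (x (Fin.last m)) := by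
  induction s with
  | id n => exact (Fin.snoc_init_self x).symm
  | comp a b iha ihb =>
    change b.cyl.eval L (a.cyl.eval L x) = _
    rw [ihb, iha]
    simp [BoxWord.eval]
  | face i ε =>
    change Fin.insertNth (α := fun _ => L) i.castSucc _ x = _
    rw [Fin.insertNth_eq_iff]
    refine ⟨by simp [BoxWord.eval], ?_⟩
    funext j
    refine Fin.lastCases ?_ (fun j => ?_) j
    · simp [Fin.removeNth, Fin.succAbove_castSucc_of_le _ _ (Fin.le_last _)]
    · simp [Fin.removeNth, BoxWord.eval, Fin.init, Fin.castSucc_succAbove_castSucc]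
  | degen i =>
    funext j
    refine Fin.lastCases ?_ (fun j => ?_) j
    · simp [BoxWord.cyl, BoxWord.eval, Fin.succAbove_castSucc_of_le _ _ (Fin.le_last _)]
    · simp [BoxWord.cyl, BoxWord.eval, Fin.init, Fin.castSucc_succAbove_castSucc]
  | conn i ε =>
    funext j
    refine Fin.lastCases ?_ (fun j => ?_) j
    · have h1 : ¬ Fin.last _ < i.castSucc := (Fin.le_last _).not_gt
      have h2 : Fin.last _ ≠ i.castSucc := (Fin.castSucc_lt_last i).ne'
      simp [BoxWord.cyl, BoxWord.eval, h1, h2]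
    · simp [BoxWord.cyl, BoxWord.eval, Fin.init]

/-- The functor `- ⊗ [1] : □ → □`, `[1]ⁿ ↦ [1]ⁿ⁺¹`. -/
def Box.cyl : Box ⥤ Box where
  obj a := ⟨a.dim + 1⟩
  map f := Box.Hom.mk
    (fun x => Fin.snoc (α := fun _ => Bool) (f.toFun (Fin.init x)) (x (Fin.last _))) (by
      obtain ⟨s, hs⟩ := f.isWord
      exact ⟨s.cyl, by funext x; rw [BoxWord.eval_cyl, hs]⟩)
  map_id a := Box.Hom.ext (by
    funext x
    exact Fin.snoc_init_self x)
  map_comp f g := Box.Hom.ext (by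
    funext x
    change Fin.snoc (α := fun _ => Bool) (g.toFun (f.toFun (Fin.init x))) (x (Fin.last _)) =
      Fin.snoc (α := fun _ => Bool) (g.toFun (Fin.init (Fin.snoc (α := fun _ => Bool) _ _)))
        (Fin.snoc (α := fun _ => Bool) _ _ (Fin.last _))
    rw [Fin.init_snoc, Fin.snoc_last])

/-- The end inclusions `[1]ⁿ → [1]ⁿ ⊗ [1]`. -/
def Box.cylEnd (ε : Bool) : 𝟭 Box ⟶ Box.cyl where
  app a := Box.face (Fin.last a.dim) ε
  naturality a b f := Box.Hom.ext (by
    funext x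
    change Fin.insertNth (α := fun _ => Bool) (Fin.last b.dim) _ (f.toFun x) =
      Fin.snoc (α := fun _ => Bool) (f.toFun (Fin.init (Fin.insertNth (α := fun _ => Bool) (Fin.last a.dim) _ x)))
        (Fin.insertNth (α := fun _ => Bool) (Fin.last a.dim) _ x (Fin.last a.dim))
    simp [Fin.insertNth_last'])

/-- The path object `Hom_L(□¹, X) = X(- ⊗ [1])`, right adjoint to `- ⊗ □¹`. -/
def pathObj (X : cSet.{u}) : cSet.{u} := Box.cyl.op ⋙ X

def pathEnd (ε : Bool) (X : cSet.{u}) : pathObj X ⟶ X :=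
  Functor.whiskerRight (NatTrans.op (Box.cylEnd ε)) X

def pathMap {X Y : cSet.{u}} (p : X ⟶ Y) : pathObj X ⟶ pathObj Y :=
  Functor.whiskerLeft Box.cyl.op p

theorem pathMap_pathEnd {X Y : cSet.{u}} (p : X ⟶ Y) (ε : Bool) :
    pathMap p ≫ pathEnd ε Y = pathEnd ε X ≫ p := by
  ext a : 2
  exact (p.naturality _).symm

/-- A homotopy `A ⊗ □¹ → X` from `f` to `g`, given by its adjoint `A → Hom_L(□¹, X)`. -/
structure Htpy {A X : cSet.{u}} (f g : A ⟶ X) where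
  hom : A ⟶ pathObj X
  left : hom ≫ pathEnd false X = f
  right : hom ≫ pathEnd true X = g

/-- The set `[A, X]` of homotopy classes: maps modulo the equivalence relation generated by
homotopies. -/
def HtpyClasses (A X : cSet.{u}) : Type u :=
  Quot fun f g : A ⟶ X => Nonempty (Htpy f g)

def HtpyClasses.precomp {A B : cSet.{u}} (f : A ⟶ B) (X : cSet.{u}) :
    HtpyClasses B X → HtpyClasses A X :=
  Quot.map (fun g => f ≫ g) fun _ _ ⟨h⟩ =>
    ⟨⟨f ≫ h.hom, by rw [Category.assoc, h.left], by rw [Category.assoc, h.right]⟩⟩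

/-- Weak equivalences of the Grothendieck model structure on cubical sets (cofibrations are the
monomorphisms, fibrations the maps with the right lifting property against all open box
inclusions): the maps `f : A → B` such that `[B, K] → [A, K]` is bijective for every Kan
complex `K`. -/
def IsWeakEquiv {A B : cSet.{u}} (f : A ⟶ B) : Prop :=
  ∀ K : cSet.{u}, IsKan K → Function.Bijective (HtpyClasses.precomp f K)

/-- A pointed cubical set. -/
structure PcSet : Type (u + 1) where
  X : cSet.{u}
  pt : X.obj (op ⟨0⟩)

namespace PcSet

@[ext]
structure Hom (X Y : PcSet.{u}) where
  hom : X.X ⟶ Y.X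
  map_pt : hom.app _ X.pt = Y.pt

instance : Category PcSet.{u} where
  Hom X Y := Hom X Y
  id X := ⟨𝟙 X.X, rfl⟩
  comp f g := ⟨f.hom ≫ g.hom, (congrArg (g.hom.app _) f.map_pt).trans g.map_pt⟩

/-- A pointed homotopy `(A ⊗ □¹) / ({a₀} ⊗ □¹) → X`: a homotopy that is constant (a degenerate
`1`-cube) on the base point. -/
structure Htpy {A X : PcSet.{u}} (f g : A ⟶ X) extends CubDG.Htpy f.hom g.hom where
  base : hom.app _ A.pt = X.X.map (Box.degen (n := 0) 0).op X.pt

/-- The set `[A, X]_*` of pointed homotopy classes. -/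
def HtpyClasses (A X : PcSet.{u}) : Type u :=
  Quot fun f g : A ⟶ X => Nonempty (Htpy f g)

def HtpyClasses.postcomp (A : PcSet.{u}) {X Y : PcSet.{u}} (p : X ⟶ Y) :
    HtpyClasses A X → HtpyClasses A Y :=
  Quot.map (fun f => f ≫ p) fun f g ⟨h⟩ => ⟨
    { hom := h.hom ≫ pathMap p.hom
      left := by
        rw [Category.assoc, pathMap_pathEnd, ← Category.assoc, h.left]
        rfl
      right := by
        rw [Category.assoc, pathMap_pathEnd, ← Category.assoc, h.right]
        rfl
      base := by
        change p.hom.app _ (h.hom.app _ A.pt) = _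
        rw [h.base, ← p.map_pt]
        exact NatTrans.naturality_apply p.hom _ _ }⟩

end PcSet

/-- The cubical sphere `Sⁿ = □ⁿ / ∂□ⁿ`, the pushout of `□ⁿ ← ∂□ⁿ → *`. -/
def sphere (n : ℕ) : PcSet.{u} where
  X := pushout (boundary.{u} n).ι
    ({ app _ := ↾fun _ => PUnit.unit } :
      (boundary.{u} n).toFunctor ⟶ (Functor.const Boxᵒᵖ).obj PUnit.{u + 1})
  pt := (pushout.inr (boundary.{u} n).ι _).app _ PUnit.unit

/-- The homotopy groups `πₙ(X) = [Sⁿ, X]_*` (as sets), as a functor of the pointed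
cubical set. -/
def cubicalPi (n : ℕ) : PcSet.{u} ⥤ Type u where
  obj X := PcSet.HtpyClasses (sphere n) X
  map p := ↾PcSet.HtpyClasses.postcomp (sphere n) p
  map_id X := by
    apply ConcreteCategory.hom_ext
    rintro ⟨f⟩
    rfl
  map_comp p q := by
    apply ConcreteCategory.hom_ext
    rintro ⟨f⟩
    rfl

/-- The vertex of `N_J G` given by a vertex of `G`. -/
def nerveVertex (J : Interval) (G : DGra.{u}) (g : G.V) : (nerveObj J G).obj (op ⟨0⟩) :=
  (⟨fun _ => g, fun _ => G.refl g⟩ : DGra.Hom (J.cube 0) G)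

/-- The vertex of `N_∞ G` given by a vertex of `G`, the image of the corresponding vertex
of `N₁ G`. -/
def nerveInfVertex (G : DGra.{u}) (g : G.V) : (nerveInf.obj G).obj (op ⟨0⟩) :=
  (colimit.ι (nerveSequence.flip.obj G) 0).app (op ⟨0⟩) (nerveVertex (stInterval 0) G g)

/-- The functor `(G, g) ↦ (N_∞ G, g)` from pointed digraphs to pointed cubical sets. -/
def nerveInfPt : PDGra.{u} ⥤ PcSet.{u} where
  obj G := ⟨nerveInf.obj G.G, nerveInfVertex G.G G.pt⟩
  map {G H} φ := PcSet.Hom.mk (nerveInf.map φ.hom) (by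
    have h := congrArg (fun t => t.app (op (⟨0⟩ : Box)))
      (ι_colimMap (nerveSequence.flip.map φ.hom) 0)
    have h' := ConcreteCategory.congr_hom h (nerveVertex (stInterval 0) G.G G.pt)
    refine h'.trans ?_
    change (colimit.ι (nerveSequence.flip.obj H.G) 0).app (op ⟨0⟩)
      ((nerve (stInterval 0)).map φ.hom |>.app (op ⟨0⟩)
        (nerveVertex (stInterval 0) G.G G.pt)) = _
    unfold nerveInfVertex
    congr 1
    rw [← φ.map_pt]
    rfl)
  map_id G := PcSet.Hom.ext (nerveInf.map_id G.G)
  map_comp f g := PcSet.Hom.ext (nerveInf.map_comp f.hom g.hom)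

end CubDG

end

/-!
The proof is cube by cube; it uses neither geometric realization nor the construction of the
model structure.

*Cubes.* Every morphism of the box category is a composite of degeneracies and connections
followed by faces (`Box.factors`), and a composite of degeneracies and connections is determined by
its sections (`Box.Surj.eq_of_sections`). So a degenerate cube comes from a unique nondegenerate one
along a unique such composite, and a map of cubical sets can be built by choosing its values on the
nondegenerate cubes one after the other, compatibly with the faces (`PartialMap.exists_hom`).

*Whitehead's theorem.* A map of Kan complexes whose source is nonempty, or whose target is empty,
is a weak equivalence if and only if it is bijective on homotopy groups
(`isWeakEquiv_iff_piBij`, `isIso_cubicalPi_map_iff`). The map is replaced by the fibration from its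
mapping path space. A fibration that is bijective on homotopy groups lifts against boundary
inclusions of cubes (`IsFib.isTrivFib`), hence is invertible up to homotopy.

*From the first nerve to the infinite one.* The step `N_J G → N_{J'} G` comes from a shrinking `r :
J' → J` that collapses an end arrow. A cube `f` of `N_{J'} G` outside the image has coordinates in
which it is not constant along that arrow. Restricting a prefix of the coordinates along the
retraction `ρ` of `J'` onto the complement of the collapsed end need not move the values of `f`
along arrows in the direction of the collapsed one; the largest prefix for which it does contains
the first bad coordinate (`Collapse.exists_bad_lt`), and this motion is a cube `H f` of one
dimension more with `f` as a face. The operation `H` commutes with degeneracies and connections,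
and `H (H f)` is degenerate. So the nondegenerate cubes outside the image fall into pairs `f`, `H
f`, and the faces of `H f` other than `f` precede `f` in dimension, in the number of bad
coordinates, or in the number of those beyond the prefix. Adjoining the pairs in this order is
filling open boxes, so that the step has the left lifting property against fibrations
(`Collapse.exists_lift`), and so has `N_1 G → N_∞ G` (`isAnodyne_inc_zero`). Such a map is a weak
equivalence, and two out of three gives `isWeakEquiv_nerveInf_map_iff`.

*Fillers in the infinite nerve.* An open box in `N_∞ G` lies in some `N_J G`. A longer interval `J'`
maps to `J` both by a shrinking and by a map that measures the distance from the middle; with the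
lattice operations of `J` these give a map of the cube on `J'` to the open box on `J` that extends
the shrinking on the faces (`exists_filler`). Hence `N_∞ G` is a Kan complex (`isKan_nerveInf`).

*Homotopy groups.* A class in `A_n(G, g)` is pulled back along shrinkings from a standard interval,
which gives a cube of `N_∞ G` with constant boundary. Any two end-preserving maps `s`, `s'` of
intervals are connected through `s ⊓ (s' ⊔ c)`, where `c` runs through the vertices, so that the
choice of the shrinkings does not matter (`EndMap.pull_eq`, `classPi_precomp_eq`). Homotopies
in the nerve of an interval are the chains of arrows between maps of pairs
(`classes_eq_of_htpyRel`, `htpyRel_of_homArrow`), which makes the comparison bijective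
(`comparison_bijective`, `comparisonIso`).
-/

noncomputable section

namespace CubDG

/-! ### The box category -/

/-- The set of `n`-cubes of a cubical set. -/
abbrev Cell (X : cSet.{u}) (n : ℕ) : Type u := X.obj (op (Box.mk n))

/-- The action of a map of the box category on the cubes of a cubical set. -/
def act (X : cSet.{u}) {m n : ℕ} (a : Box.mk m ⟶ Box.mk n) (x : Cell X n) : Cell X m :=
  X.map a.op x

theorem act_id (X : cSet.{u}) {n : ℕ} (x : Cell X n) : act X (𝟙 (Box.mk n)) x = x := by
  simp [act]

theorem act_act (X : cSet.{u}) {m n k : ℕ} (a : Box.mk m ⟶ Box.mk n) (b : Box.mk n ⟶ Box.mk k)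
    (x : Cell X k) : act X a (act X b x) = act X (a ≫ b) x := by
  simp [act]

theorem app_act {X Y : cSet.{u}} (p : X ⟶ Y) {m n : ℕ} (a : Box.mk m ⟶ Box.mk n)
    (x : Cell X n) : p.app (op (Box.mk m)) (act X a x) = act Y a (p.app (op (Box.mk n)) x) :=
  NatTrans.naturality_apply p a.op x

namespace Box

/-- The connection that combines the coordinates `i` and `i + 1`, as a morphism of boxes. -/
abbrev conn {n : ℕ} (i : Fin (n + 1)) (ε : Bool) : (⟨n + 2⟩ : Box) ⟶ ⟨n + 1⟩ :=
  ofWord (.conn i ε)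

theorem hom_ext' {m n : ℕ} {f g : Box.mk m ⟶ Box.mk n} (h : ∀ x j, f.toFun x j = g.toFun x j) :
    f = g := Box.Hom.ext (funext fun x => funext fun j => h x j)

@[simp] theorem comp_toFun {a b c : Box} (f : a ⟶ b) (g : b ⟶ c) (x : Fin a.dim → Bool) :
    (f ≫ g).toFun x = g.toFun (f.toFun x) := rfl

@[simp] theorem id_toFun {a : Box} (x : Fin a.dim → Bool) : (𝟙 a : a ⟶ a).toFun x = x := rfl

theorem face_toFun {n : ℕ} (i : Fin (n + 1)) (ε : Bool) (x : Fin n → Bool) :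
    (face i ε).toFun x = i.insertNth (α := fun _ => Bool) ε x := by
  change i.insertNth (α := fun _ => Bool) (if ε then ⊤ else ⊥) x = _
  cases ε <;> rfl

@[simp] theorem face_self {n : ℕ} (i : Fin (n + 1)) (ε : Bool) (x : Fin n → Bool) :
    (face i ε).toFun x i = ε := by
  rw [face_toFun, Fin.insertNth_apply_same]

@[simp] theorem face_succAbove {n : ℕ} (i : Fin (n + 1)) (ε : Bool) (x : Fin n → Bool)
    (j : Fin n) : (face i ε).toFun x (i.succAbove j) = x j := by
  rw [face_toFun, Fin.insertNth_apply_succAbove]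

@[simp] theorem degen_toFun {n : ℕ} (i : Fin (n + 1)) (x : Fin (n + 1) → Bool) (j : Fin n) :
    (degen i).toFun x j = x (i.succAbove j) := rfl

/-- The binary operation of the connection `conn i ε`. It has the neutral element `ε` and the
absorbing element `!ε`. -/
def bop (ε a b : Bool) : Bool := if ε then a ⊓ b else a ⊔ b

theorem conn_toFun {n : ℕ} (i : Fin (n + 1)) (ε : Bool) (x : Fin (n + 2) → Bool)
    (j : Fin (n + 1)) : (conn i ε).toFun x j =
      if j < i then x j.castSucc else if j = i then bop ε (x i.castSucc) (x i.succ)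
      else x j.succ := rfl

theorem conn_self {n : ℕ} (i : Fin (n + 1)) (ε : Bool) (x : Fin (n + 2) → Bool) :
    (conn i ε).toFun x i = bop ε (x i.castSucc) (x i.succ) := by
  simp [conn_toFun]

theorem conn_predAbove {n : ℕ} (i : Fin (n + 1)) (ε : Bool) (x : Fin (n + 2) → Bool)
    (q : Fin (n + 2)) (h : i.predAbove q ≠ i) :
    (conn i ε).toFun x (i.predAbove q) = x q := by
  rw [conn_toFun]
  rcases le_or_gt q i.castSucc with hq | hq
  · rw [Fin.predAbove_of_le_castSucc _ _ hq] at h ⊢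
    have : q.castPred _ < i := lt_of_le_of_ne
      (by simpa [Fin.le_def] using hq) h
    rw [if_pos this, Fin.castSucc_castPred]
  · rw [Fin.predAbove_of_castSucc_lt _ _ hq] at h ⊢
    have hq' := Fin.lt_def.1 hq
    have : ¬ q.pred (Fin.ne_zero_of_lt hq) < i := by
      rw [Fin.lt_def]; simp at hq' ⊢; omega
    rw [if_neg this, if_neg h, Fin.succ_pred]

theorem face_degen_self {n : ℕ} (i : Fin (n + 1)) (ε : Bool) : face i ε ≫ degen i = 𝟙 _ :=
  hom_ext' fun x j => by simp

theorem face_degen_succAbove {n : ℕ} (i : Fin (n + 2)) (j : Fin (n + 1)) (ε : Bool) :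
    face i ε ≫ degen (i.succAbove j) = degen j ≫ face (j.predAbove i) ε := by
  refine hom_ext' fun x k => ?_
  rw [comp_toFun, comp_toFun, degen_toFun]
  rcases Fin.eq_self_or_eq_succAbove (j.predAbove i) k with rfl | ⟨l, rfl⟩
  · rw [face_self, Fin.succAbove_succAbove_predAbove, face_self]
  · rw [Fin.succAbove_succAbove_succAbove_predAbove, face_succAbove, face_succAbove, degen_toFun]

theorem face_conn_castSucc {n : ℕ} (i : Fin (n + 1)) (ε : Bool) :
    face i.castSucc ε ≫ conn i ε = 𝟙 _ := by
  refine hom_ext' fun x j => ?_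
  rw [comp_toFun, id_toFun, conn_toFun]
  have e : i.succ = i.castSucc.succAbove i := by simp
  split_ifs with h1 h2
  · have : j.castSucc = i.castSucc.succAbove j := (Fin.succAbove_of_castSucc_lt _ _ h1).symm
    rw [this, face_succAbove]
  · rw [face_self, e, face_succAbove, h2]
    cases ε <;> simp [bop]
  · have : j.succ = i.castSucc.succAbove j :=
      (Fin.succAbove_of_le_castSucc _ _ (not_lt.1 h1)).symm
    rw [this, face_succAbove]

theorem face_conn_succ {n : ℕ} (i : Fin (n + 1)) (ε : Bool) :
    face i.succ ε ≫ conn i ε = 𝟙 _ := by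
  refine hom_ext' fun x j => ?_
  rw [comp_toFun, id_toFun, conn_toFun]
  have e : i.castSucc = i.succ.succAbove i := by simp
  split_ifs with h1 h2
  · have : j.castSucc = i.succ.succAbove j :=
      (Fin.succAbove_of_castSucc_lt _ _ (by
        rw [Fin.lt_def] at h1 ⊢; simp; omega)).symm
    rw [this, face_succAbove]
  · rw [face_self, e, face_succAbove, h2]
    cases ε <;> simp [bop]
  · have : j.succ = i.succ.succAbove j :=
      (Fin.succAbove_of_le_castSucc _ _ (by
        have : i < j := lt_of_le_of_ne (not_lt.1 h1) (Ne.symm h2)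
        rw [Fin.le_def]; simp; omega)).symm
    rw [this, face_succAbove]

theorem face_conn_absorb {n : ℕ} (i : Fin (n + 1)) (ε : Bool) (f : Fin (n + 2))
    (hf : f = i.castSucc ∨ f = i.succ) :
    face f (!ε) ≫ conn i ε = degen i ≫ face i (!ε) := by
  have hfi : ∀ l : Fin n, f.succAbove (i.succAbove l) =
      if i.succAbove l < i then (i.succAbove l).castSucc else (i.succAbove l).succ := by
    intro l
    have hne := Fin.succAbove_ne i l
    split_ifs with h
    · apply Fin.succAbove_of_castSucc_lt
      rcases hf with rfl | rfl
      · exact h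
      · rw [Fin.lt_def] at h ⊢; simp; omega
    · apply Fin.succAbove_of_le_castSucc
      have : i < i.succAbove l := lt_of_le_of_ne (not_lt.1 h) hne.symm
      rcases hf with rfl | rfl
      · exact this.le
      · rw [Fin.le_def]; simp; omega
  refine hom_ext' fun x j => ?_
  rw [comp_toFun, comp_toFun]
  rcases Fin.eq_self_or_eq_succAbove i j with rfl | ⟨l, rfl⟩
  · rw [face_self, conn_self]
    rcases hf with rfl | rfl <;> rw [face_self] <;> cases ε <;> simp [bop]
  · rw [face_succAbove, degen_toFun, conn_toFun, if_neg (Fin.succAbove_ne i l)]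
    have := hfi l
    split_ifs at this ⊢ with h <;> rw [← this, face_succAbove]

theorem face_val {n : ℕ} (i : Fin (n + 1)) (ε : Bool) (x : Fin n → Bool) (k : Fin (n + 1)) :
    (face i ε).toFun x k = if h : k.val < i.val then x ⟨k.val, by omega⟩ else
      if h' : k.val = i.val then ε else x ⟨k.val - 1, by omega⟩ := by
  split_ifs with h h'
  · have : k = i.succAbove ⟨k.val, by omega⟩ := by
      rw [Fin.succAbove_of_castSucc_lt i ⟨k.val, by omega⟩ h]; rfl
    conv_lhs => rw [this]
    rw [face_succAbove]
  · rw [Fin.ext h', face_self]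
  · have : k = i.succAbove ⟨k.val - 1, by omega⟩ := by
      rw [Fin.succAbove_of_le_castSucc _ _ (by rw [Fin.le_def]; simp; omega)]
      ext; simp; omega
    conv_lhs => rw [this]
    rw [face_succAbove]

theorem conn_val {n : ℕ} (i : Fin (n + 1)) (ε : Bool) (x : Fin (n + 2) → Bool)
    (j : Fin (n + 1)) : (conn i ε).toFun x j =
      if j.val < i.val then x ⟨j.val, by omega⟩ else
      if j.val = i.val then bop ε (x ⟨i.val, by omega⟩) (x ⟨i.val + 1, by omega⟩)
      else x ⟨j.val + 1, by omega⟩ := by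
  rw [conn_toFun]
  simp only [Fin.lt_def, Fin.ext_iff]
  rfl

theorem face_conn_lt {n : ℕ} (i : Fin (n + 1)) (ε δ : Bool) (f : Fin (n + 2))
    (hf : f.val ≤ i.val) : face f.castSucc δ ≫ conn i.succ ε = conn i ε ≫ face f δ := by
  refine hom_ext' fun x j => ?_
  rw [comp_toFun, comp_toFun, conn_val, face_val]
  simp only [face_val, conn_val, Fin.val_succ, Fin.val_castSucc]
  split_ifs <;> first
    | rfl
    | omega
    | (congr 1; ext; simp; omega)

theorem face_conn_gt {n : ℕ} (i : Fin (n + 1)) (ε δ : Bool) (f : Fin (n + 2))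
    (hf : i.val < f.val) : face f.succ δ ≫ conn i.castSucc ε = conn i ε ≫ face f δ := by
  refine hom_ext' fun x j => ?_
  rw [comp_toFun, comp_toFun, conn_val, face_val]
  simp only [face_val, conn_val, Fin.val_succ, Fin.val_castSucc]
  split_ifs <;> first
    | rfl
    | omega
    | (congr 1; ext; simp; omega)

theorem face_face {n : ℕ} (i j : Fin (n + 1)) (h : i ≤ j) (ε δ : Bool) :
    face i ε ≫ face j.succ δ = face j δ ≫ face i.castSucc ε := by
  refine hom_ext' fun x k => ?_
  rw [Fin.le_def] at h
  rw [comp_toFun, comp_toFun, face_val, face_val]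
  simp only [face_val, Fin.val_succ, Fin.val_castSucc]
  split_ifs <;> first
    | rfl
    | omega

/-- Composites of codegeneracies and coconnections. -/
inductive Surj : ∀ {m n : ℕ}, (Box.mk m ⟶ Box.mk n) → Prop
  | id (n : ℕ) : Surj (𝟙 (Box.mk n))
  | degen {m n : ℕ} (i : Fin (m + 1)) (v : Box.mk m ⟶ Box.mk n) : Surj v → Surj (degen i ≫ v)
  | conn {m n : ℕ} (i : Fin (m + 1)) (ε : Bool) (v : Box.mk (m + 1) ⟶ Box.mk n) :
      Surj v → Surj (conn i ε ≫ v)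

/-- The cofaces. -/
inductive IsFace : ∀ {m n : ℕ}, (Box.mk m ⟶ Box.mk n) → Prop
  | mk {n : ℕ} (i : Fin (n + 1)) (ε : Bool) : IsFace (face i ε)

/-- Composites of cofaces. -/
inductive Inj : ∀ {m n : ℕ}, (Box.mk m ⟶ Box.mk n) → Prop
  | id (n : ℕ) : Inj (𝟙 (Box.mk n))
  | face {m n : ℕ} (v : Box.mk m ⟶ Box.mk n) (i : Fin (n + 1)) (ε : Bool) :
      Inj v → Inj (v ≫ face i ε)

theorem Surj.comp {m n k : ℕ} {a : Box.mk m ⟶ Box.mk n} {b : Box.mk n ⟶ Box.mk k}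
    (ha : Surj a) (hb : Surj b) : Surj (a ≫ b) := by
  induction ha with
  | id n => rwa [Category.id_comp]
  | degen i v _ ih => rw [Category.assoc]; exact .degen _ _ (ih hb)
  | conn i ε v _ ih => rw [Category.assoc]; exact .conn _ _ _ (ih hb)

theorem Inj.comp {m n k : ℕ} {a : Box.mk m ⟶ Box.mk n} {b : Box.mk n ⟶ Box.mk k}
    (ha : Inj a) (hb : Inj b) : Inj (a ≫ b) := by
  induction hb with
  | id => rwa [Category.comp_id]
  | face v i ε _ ih => rw [← Category.assoc]; exact .face _ _ _ ih

theorem surj_degen {n : ℕ} (i : Fin (n + 1)) : Surj (degen i) := by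
  simpa using Surj.degen i _ (.id n)

theorem surj_conn {n : ℕ} (i : Fin (n + 1)) (ε : Bool) : Surj (conn i ε) := by
  simpa using Surj.conn i ε _ (.id _)

theorem inj_face {n : ℕ} (i : Fin (n + 1)) (ε : Bool) : Inj (face i ε) := by
  simpa using Inj.face _ i ε (.id n)

/-- A factorization as a composite of codegeneracies and coconnections followed by a composite
of cofaces. -/
def Factors {m n : ℕ} (a : Box.mk m ⟶ Box.mk n) : Prop :=
  ∃ (k : ℕ) (e : Box.mk m ⟶ Box.mk k) (d : Box.mk k ⟶ Box.mk n), Surj e ∧ Inj d ∧ a = e ≫ d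

theorem Factors.pre {m n k : ℕ} {a : Box.mk m ⟶ Box.mk n} (ha : Surj a)
    {b : Box.mk n ⟶ Box.mk k} (hb : Factors b) : Factors (a ≫ b) := by
  obtain ⟨l, e, d, he, hd, rfl⟩ := hb
  exact ⟨l, a ≫ e, d, ha.comp he, hd, by rw [Category.assoc]⟩

theorem Factors.post {m n k : ℕ} {a : Box.mk m ⟶ Box.mk n} (ha : Factors a)
    {b : Box.mk n ⟶ Box.mk k} (hb : Inj b) : Factors (a ≫ b) := by
  obtain ⟨l, e, d, he, hd, rfl⟩ := ha
  exact ⟨l, e, d ≫ b, he, hd.comp hb, by rw [Category.assoc]⟩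

theorem factors_face_degen {n : ℕ} (i j : Fin (n + 1)) (ε : Bool) {k : ℕ}
    (v : Box.mk n ⟶ Box.mk k) (hv : Surj v)
    (ih : ∀ {l : ℕ} (f : Box.mk l ⟶ Box.mk n), IsFace f → Factors (f ≫ v)) :
    Factors (face i ε ≫ degen j ≫ v) := by
  rcases Fin.eq_self_or_eq_succAbove i j with rfl | ⟨j, rfl⟩
  · rw [← Category.assoc, face_degen_self, Category.id_comp]
    exact ⟨_, v, 𝟙 _, hv, .id _, by rw [Category.comp_id]⟩
  · obtain _ | n := n
    · exact j.elim0
    · rw [← Category.assoc, face_degen_succAbove, Category.assoc]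
      exact Factors.pre (surj_degen j) (ih _ ⟨_, _⟩)

theorem factors_face_conn {n : ℕ} (i : Fin (n + 2)) (j : Fin (n + 1)) (ε δ : Bool) {k : ℕ}
    (v : Box.mk (n + 1) ⟶ Box.mk k) (hv : Surj v)
    (ih : ∀ {l : ℕ} (f : Box.mk l ⟶ Box.mk (n + 1)), IsFace f → Factors (f ≫ v)) :
    Factors (face i ε ≫ conn j δ ≫ v) := by
  rw [← Category.assoc]
  have hself : i = j.castSucc ∨ i = j.succ → Factors ((face i ε ≫ conn j δ) ≫ v) := by
    intro hi
    by_cases hε : ε = δ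
    · subst hε
      have : face i ε ≫ conn j ε = 𝟙 _ := by
        rcases hi with rfl | rfl
        · exact face_conn_castSucc j ε
        · exact face_conn_succ j ε
      rw [this, Category.id_comp]
      exact ⟨_, v, 𝟙 _, hv, .id _, by rw [Category.comp_id]⟩
    · obtain rfl : ε = !δ := by cases ε <;> cases δ <;> simp_all
      rw [face_conn_absorb _ _ _ hi, Category.assoc]
      exact Factors.pre (surj_degen j) (ih _ ⟨_, _⟩)
  rcases lt_trichotomy i.val j.val with h | h | h
  · obtain _ | n := n
    · omega
    · obtain ⟨j, rfl⟩ := Fin.eq_succ_of_ne_zero (i := j) (by rintro rfl; simp at h)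
      obtain ⟨i, rfl⟩ : ∃ i' : Fin (n + 2), i = i'.castSucc :=
        ⟨⟨i.val, by omega⟩, rfl⟩
      rw [face_conn_lt _ _ _ _ (by simp at h; omega), Category.assoc]
      exact Factors.pre (surj_conn _ _) (ih _ ⟨_, _⟩)
  · exact hself (Or.inl (Fin.ext h))
  · by_cases h' : i.val = j.val + 1
    · exact hself (Or.inr (Fin.ext h'))
    · obtain _ | n := n
      · omega
      · obtain ⟨i, rfl⟩ := Fin.eq_succ_of_ne_zero (i := i) (by rintro rfl; simp at h)
        obtain ⟨j, rfl⟩ : ∃ j' : Fin (n + 1), j = j'.castSucc :=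
          ⟨⟨j.val, by rw [Fin.val_succ] at h h'; omega⟩, rfl⟩
        rw [face_conn_gt j δ ε i (by
          simp only [Fin.val_succ, Fin.val_castSucc] at h h' ⊢; omega), Category.assoc]
        exact Factors.pre (surj_conn _ _) (ih _ ⟨_, _⟩)

theorem factors_face_surj {n k : ℕ} {e : Box.mk n ⟶ Box.mk k} (he : Surj e) :
    ∀ {l : ℕ} (f : Box.mk l ⟶ Box.mk n), IsFace f → Factors (f ≫ e) := by
  induction he with
  | id n =>
    rintro _ _ ⟨i, ε⟩
    exact ⟨_, 𝟙 _, face i ε, .id _, inj_face i ε, by simp⟩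
  | degen i v hv ih =>
    rintro _ _ ⟨j, ε⟩
    exact factors_face_degen _ _ _ _ hv ih
  | conn i δ v hv ih =>
    rintro _ _ ⟨j, ε⟩
    exact factors_face_conn _ _ _ _ _ hv ih

theorem factors_inj_surj {m n k : ℕ} {d : Box.mk m ⟶ Box.mk n} (hd : Inj d)
    {e : Box.mk n ⟶ Box.mk k} (he : Surj e) : Factors (d ≫ e) := by
  induction hd generalizing k with
  | id => exact ⟨_, e, 𝟙 _, he, .id _, by simp⟩
  | face v i ε hv ih =>
    obtain ⟨l, e', d', he', hd', h⟩ := factors_face_surj he _ ⟨i, ε⟩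
    rw [Category.assoc, h, ← Category.assoc]
    exact (ih he').post hd'

theorem factors_ofWord {m n : ℕ} (s : BoxWord m n) : Factors (ofWord s) := by
  induction s with
  | id n => exact ⟨n, 𝟙 _, 𝟙 _, .id n, .id n, by simp; rfl⟩
  | comp a b iha ihb =>
    obtain ⟨k, e, d, he, hd, h⟩ := iha
    obtain ⟨k', e', d', he', hd', h'⟩ := ihb
    have : ofWord (a.comp b) = e ≫ (d ≫ e') ≫ d' := by
      have : ofWord (a.comp b) = ofWord a ≫ ofWord b := rfl
      rw [this, h, h']; simp
    rw [this]
    exact Factors.pre he ((factors_inj_surj hd he').post hd')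
  | face i ε => exact ⟨_, 𝟙 _, face i ε, .id _, inj_face i ε, by simp⟩
  | degen i => exact ⟨_, degen i, 𝟙 _, surj_degen i, .id _, by simp⟩
  | conn i ε => exact ⟨_, conn i ε, 𝟙 _, surj_conn i ε, .id _, by simp⟩

theorem factors {m n : ℕ} (a : Box.mk m ⟶ Box.mk n) : Factors a := by
  obtain ⟨s, hs⟩ := a.isWord
  have : a = ofWord s := Box.Hom.ext hs.symm
  rw [this]
  exact factors_ofWord s

/-- A map of the box category is a composite of codegeneracies and coconnections, or it factors
through a coface. -/
theorem surj_or_face {m n : ℕ} (a : Box.mk m ⟶ Box.mk n) :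
    Surj a ∨ ∃ (k : ℕ) (v : Box.mk m ⟶ Box.mk k) (f : Box.mk k ⟶ Box.mk n),
      IsFace f ∧ a = v ≫ f := by
  obtain ⟨k, e, d, he, hd, rfl⟩ := factors a
  cases hd with
  | id => left; simpa using he
  | face v i ε hv => exact Or.inr ⟨_, e ≫ v, _, ⟨i, ε⟩, by simp⟩

theorem IsFace.dim {m n : ℕ} {f : Box.mk m ⟶ Box.mk n} (h : IsFace f) : n = m + 1 := by
  cases h; rfl

theorem Surj.le {m n : ℕ} {f : Box.mk m ⟶ Box.mk n} (h : Surj f) : n ≤ m := by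
  induction h <;> omega

theorem Surj.cases {m n : ℕ} {f : Box.mk m ⟶ Box.mk n} (h : Surj f) :
    (∃ e : m = n, f = eqToHom (by rw [e])) ∨ n < m := by
  cases h with
  | id => exact Or.inl ⟨rfl, rfl⟩
  | degen i v hv => have := hv.le; right; omega
  | conn i ε v hv => have := hv.le; right; omega

theorem Surj.eq_id {n : ℕ} {f : Box.mk n ⟶ Box.mk n} (h : Surj f) : f = 𝟙 _ := by
  rcases h.cases with ⟨_, rfl⟩ | h
  · rfl
  · omega

/-- An endomorphism of `[1]ⁿ` other than the identity factors through a smaller cube. -/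
theorem endo_cases {n : ℕ} (a : Box.mk n ⟶ Box.mk n) : a = 𝟙 _ ∨
    ∃ (k : ℕ) (v : Box.mk n ⟶ Box.mk k) (f : Box.mk k ⟶ Box.mk n), IsFace f ∧ a = v ≫ f := by
  rcases surj_or_face a with h | h
  · exact Or.inl h.eq_id
  · exact Or.inr h

theorem Surj.section {m n : ℕ} {e : Box.mk m ⟶ Box.mk n} (he : Surj e) :
    ∃ s : Box.mk n ⟶ Box.mk m, s ≫ e = 𝟙 _ := by
  induction he with
  | id n => exact ⟨𝟙 _, by simp⟩
  | degen i v _ ih =>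
    obtain ⟨s, hs⟩ := ih
    exact ⟨s ≫ face i false, by
      rw [Category.assoc, ← Category.assoc (face i false), face_degen_self]; simpa using hs⟩
  | conn i ε v _ ih =>
    obtain ⟨s, hs⟩ := ih
    exact ⟨s ≫ face i.castSucc ε, by
      rw [Category.assoc, ← Category.assoc (face _ ε), face_conn_castSucc]; simpa using hs⟩

end Box

/-! ### Surjections, sections and boundary inclusions of boxes -/

namespace Box

theorem toFun_mono {m n : ℕ} (a : Box.mk m ⟶ Box.mk n) : Monotone a.toFun := by
  obtain ⟨s, hs⟩ := a.isWord
  rw [← hs]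
  clear hs a
  dsimp only at s ⊢
  change Monotone (s.eval Bool)
  induction s with
  | id n => exact monotone_id
  | comp a b iha ihb => exact ihb.comp iha
  | face i ε =>
    intro x y h
    rw [Pi.le_def]
    intro j
    refine Fin.succAboveCases i ?_ (fun k => ?_) j
    · simp [BoxWord.eval]
    · simpa [BoxWord.eval] using h k
  | degen i => exact fun x y h j => h _
  | conn i ε =>
    intro x y h j
    simp only [BoxWord.eval]
    split_ifs
    · exact h _
    · exact inf_le_inf (h _) (h _)
    · exact sup_le_sup (h _) (h _)
    · exact h _

/-- A map between powers of `{0, 1}` has disjoint supports if every input coordinate influences at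
most one output coordinate. -/
def DisjointSupports {m n : ℕ} (f : (Fin m → Bool) → (Fin n → Bool)) : Prop :=
  ∃ φ : Fin m → Fin n → Prop, (∀ i j j', φ i j → φ i j' → j = j') ∧
    ∀ j x z, (∀ i, φ i j → x i = z i) → f x j = f z j

theorem disjointSupports {m n : ℕ} (a : Box.mk m ⟶ Box.mk n) : DisjointSupports a.toFun := by
  obtain ⟨s, hs⟩ := a.isWord
  rw [← hs]
  clear hs a
  dsimp only at s ⊢
  induction s with
  | id n => exact ⟨fun i j => i = j, fun i j j' h h' => h.symm.trans h',
      fun j x z h => h j rfl⟩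
  | comp a b iha ihb =>
    obtain ⟨φ, hφ, ha⟩ := iha
    obtain ⟨ψ, hψ, hb⟩ := ihb
    refine ⟨fun i k => ∃ j, φ i j ∧ ψ j k, ?_, fun k x z h => ?_⟩
    · rintro i k k' ⟨j, h1, h2⟩ ⟨j', h1', h2'⟩
      obtain rfl := hφ _ _ _ h1 h1'
      exact hψ _ _ _ h2 h2'
    · exact hb _ _ _ fun j hj => ha _ _ _ fun i hi => h i ⟨j, hi, hj⟩
  | face i ε =>
    refine ⟨fun l j => j = i.succAbove l, fun l j j' h h' => h.trans h'.symm, ?_⟩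
    intro j x z
    refine Fin.succAboveCases i ?_ (fun k => ?_) j
    · simp [BoxWord.eval]
    · intro h; simpa [BoxWord.eval] using h k rfl
  | degen i =>
    exact ⟨fun l j => l = i.succAbove j,
      fun l j j' h h' => Fin.succAbove_right_injective (h.symm.trans h'), fun j x z h => h _ rfl⟩
  | conn i ε =>
    refine ⟨fun l j => j = i.predAbove l, fun l j j' h h' => h.trans h'.symm, ?_⟩
    intro j x z h
    simp only [BoxWord.eval]
    rcases lt_trichotomy j i with hj | rfl | hj
    · rw [if_pos hj, if_pos hj]
      exact h _ (by simp [Fin.predAbove_of_le_castSucc, hj.le])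
    · have h1 := h j.castSucc (by simp)
      have h2 := h j.succ (by simp)
      simp only [h1, h2]
    · rw [if_neg hj.not_gt, if_neg hj.not_gt, if_neg hj.ne', if_neg hj.ne']
      exact h _ (by simp [Fin.predAbove_of_castSucc_lt, hj.le, Fin.lt_def])

/-- A map into a power of `{0, 1}` each of whose coordinates is constant or a projection. -/
def ConstOrProj {m n : ℕ} (s : Box.mk n ⟶ Box.mk m) : Prop :=
  ∀ i, (∃ c, ∀ y, s.toFun y i = c) ∨ ∃ l, ∀ y, s.toFun y i = y l

/-- The input coordinate `i` of `e` is a free coordinate for a section of `e` that makes it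
contribute to an output coordinate other than `k`. -/
def Foreign {m n : ℕ} (e : Box.mk m ⟶ Box.mk n) (k : Fin n) (i : Fin m) : Prop :=
  ∃ s : Box.mk n ⟶ Box.mk m, s ≫ e = 𝟙 _ ∧ ∃ l, l ≠ k ∧ ∀ y, s.toFun y i = y l

theorem face_castSucc_toFun {n : ℕ} (i : Fin (n + 1)) (ε : Bool) (x : Fin (n + 1) → Bool)
    (q : Fin (n + 2)) : (face i.castSucc ε).toFun x q =
      if q = i.castSucc then ε else x (i.predAbove q) := by
  split_ifs with h
  · rw [h, face_self]
  · obtain ⟨j, rfl⟩ := Fin.exists_succAbove_eq h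
    rw [face_succAbove]
    congr 1
    exact (Fin.predAbove_succAbove i j).symm

theorem face_succ_toFun {n : ℕ} (i : Fin (n + 1)) (ε : Bool) (x : Fin (n + 1) → Bool)
    (q : Fin (n + 2)) : (face i.succ ε).toFun x q =
      if q = i.succ then ε else x (i.predAbove q) := by
  split_ifs with h
  · rw [h, face_self]
  · obtain ⟨j, rfl⟩ := Fin.exists_succAbove_eq h
    rw [face_succAbove]
    congr 1
    rcases le_or_gt j i with h | h
    · rw [Fin.succAbove_succ_of_le _ _ h, Fin.predAbove_castSucc_of_le _ _ h]
    · rw [Fin.succAbove_succ_of_lt _ _ h, Fin.predAbove_succ_of_le _ _ h.le]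

/-- The map `x ↦ x ∘ i.predAbove` on the cubes whose `i`-th coordinate is `c`. -/
def dup {n : ℕ} (i : Fin (n + 1)) (c : Bool) : Box.mk (n + 1) ⟶ Box.mk (n + 2) :=
  degen i ≫ face i c ≫ face i.castSucc c

theorem dup_toFun {n : ℕ} (i : Fin (n + 1)) (c : Bool) (x : Fin (n + 1) → Bool) (hx : x i = c)
    (q : Fin (n + 2)) : (dup i c).toFun x q = x (i.predAbove q) := by
  have h : (face i c).toFun ((degen i).toFun x) = x := by
    funext j
    rcases Fin.eq_self_or_eq_succAbove i j with rfl | ⟨l, rfl⟩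
    · rw [face_self, hx]
    · rw [face_succAbove, degen_toFun]
  change (face i.castSucc c).toFun ((face i c).toFun ((degen i).toFun x)) q = _
  rw [h, face_castSucc_toFun]
  split_ifs with hq
  · rw [hq, Fin.predAbove_castSucc_self, hx]
  · rfl

theorem predAbove_eq {n : ℕ} {i : Fin (n + 1)} {q : Fin (n + 2)} (h : i.predAbove q = i) :
    q = i.castSucc ∨ q = i.succ := by
  by_cases hq : q = i.castSucc
  · exact Or.inl hq
  · obtain ⟨j, rfl⟩ := Fin.exists_succAbove_eq hq
    rw [Fin.predAbove_succAbove] at h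
    subst h
    right; simp

theorem bop_self (ε : Bool) (a b : Bool) (h : a = !ε ∨ b = !ε) : bop ε a b = !ε := by
  cases ε <;> cases a <;> cases b <;> simp_all [bop]

theorem bop_neutral (ε : Bool) : bop ε ε ε = ε := by cases ε <;> rfl

/-- Every point of the source of `e` is dominated, in the coordinates that matter for the `k`-th
output, by a point in the image of a section of `e` at which that output takes the same value.
Together with monotonicity this makes `e` determined by its sections. -/
theorem exists_section_of_surj {m n : ℕ} {e : Box.mk m ⟶ Box.mk n} (he : Surj e)
    (x : Fin m → Bool) (k : Fin n) :
    ∃ (s : Box.mk n ⟶ Box.mk m) (y : Fin n → Bool), s ≫ e = 𝟙 _ ∧ ConstOrProj s ∧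
      y k = e.toFun x k ∧
      ∀ i, Foreign e k i ∨ (x i = (!e.toFun x k) → s.toFun y i = !e.toFun x k) := by
  induction he with
  | id n => exact ⟨𝟙 _, x, by simp, fun i => Or.inr ⟨i, fun _ => rfl⟩, rfl, fun i => Or.inr fun h => h⟩
  | degen p v _ ih =>
    obtain ⟨s, y, hs, hcp, hy, hi⟩ := ih ((degen p).toFun x) k
    have hsec : ∀ (c : Bool) (t : _), t ≫ v = 𝟙 _ → (t ≫ face p c) ≫ degen p ≫ v = 𝟙 _ := by
      intro c t ht
      rw [Category.assoc, ← Category.assoc (face _ _), face_degen_self, Category.id_comp, ht]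
    refine ⟨s ≫ face p (x p), y, hsec _ _ hs, fun i => ?_, hy, fun i => ?_⟩
    · rcases Fin.eq_self_or_eq_succAbove p i with rfl | ⟨l, rfl⟩
      · exact Or.inl ⟨x i, fun y => by simp⟩
      · simpa using hcp l
    · rcases Fin.eq_self_or_eq_succAbove p i with rfl | ⟨l, rfl⟩
      · right; simp
      · rcases hi l with ⟨t, ht, l', hl', h⟩ | h
        · exact Or.inl ⟨t ≫ face p false, hsec _ _ ht, l', hl', by simpa using h⟩
        · right; simpa using h
  | conn p ε v _ ih =>
    obtain ⟨s, y, hs, hcp, hy, hi⟩ := ih ((conn p ε).toFun x) k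
    rw [comp_toFun]
    set U := v.toFun ((conn p ε).toFun x) k with hU
    have hsec1 : ∀ (t : _), t ≫ v = 𝟙 _ → (t ≫ face p.castSucc ε) ≫ conn p ε ≫ v = 𝟙 _ := by
      intro t ht
      rw [Category.assoc, ← Category.assoc (face _ _), face_conn_castSucc, Category.id_comp, ht]
    have hsec2 : ∀ (t : _), t ≫ v = 𝟙 _ → (t ≫ face p.succ ε) ≫ conn p ε ≫ v = 𝟙 _ := by
      intro t ht
      rw [Category.assoc, ← Category.assoc (face _ _), face_conn_succ, Category.id_comp, ht]
    have hcp1 : ConstOrProj (s ≫ face p.castSucc ε) := by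
      intro q
      simp only [comp_toFun, face_castSucc_toFun]
      split_ifs
      · exact Or.inl ⟨ε, fun _ => rfl⟩
      · exact hcp _
    have hcp2 : ConstOrProj (s ≫ face p.succ ε) := by
      intro q
      simp only [comp_toFun, face_succ_toFun]
      split_ifs
      · exact Or.inl ⟨ε, fun _ => rfl⟩
      · exact hcp _
    -- coordinates lying over a foreign coordinate of `v` are foreign
    have hfor : ∀ q, Foreign v k (p.predAbove q) → Foreign (conn p ε ≫ v) k q := by
      rintro q ⟨t, ht, l, hl, h⟩
      by_cases hq : q = p.castSucc
      · refine ⟨t ≫ face p.succ ε, hsec2 t ht, l, hl, fun y => ?_⟩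
        rw [comp_toFun, face_succ_toFun, if_neg, h]
        rw [hq]; exact (Fin.castSucc_lt_succ (i := p)).ne
      · refine ⟨t ≫ face p.castSucc ε, hsec1 t ht, l, hl, fun y => ?_⟩
        rw [comp_toFun, face_castSucc_toFun, if_neg hq, h]
    -- coordinates away from the connection behave as for `v`
    have haway : ∀ q, p.predAbove q ≠ p → Foreign (conn p ε ≫ v) k q ∨
        (x q = (!U) → s.toFun y (p.predAbove q) = !U) := by
      intro q hq
      rcases hi (p.predAbove q) with h | h
      · exact Or.inl (hfor q h)
      · rw [conn_predAbove _ _ _ _ hq] at h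
        exact Or.inr h
    have hne1 : ∀ q, p.predAbove q ≠ p → q ≠ p.castSucc ∧ q ≠ p.succ := by
      intro q hq
      constructor <;> (rintro rfl; simp at hq)
    have hii := hi p
    rw [conn_self] at hii
    by_cases hfp : Foreign v k p
    · refine ⟨s ≫ face p.castSucc ε, y, hsec1 s hs, hcp1, hy, fun q => ?_⟩
      by_cases hq : p.predAbove q = p
      · exact Or.inl (hfor q (by rwa [hq]))
      · refine (haway q hq).imp id fun h => ?_
        rwa [comp_toFun, face_castSucc_toFun, if_neg (hne1 q hq).1]
    have hii := hii.resolve_left hfp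
    by_cases hUε : U = ε
    · -- both coordinates have to be free to reach the absorbing value `!U`
      rcases hcp p with ⟨c, hc⟩ | ⟨l, hl⟩
      · refine ⟨s ≫ dup p c, y, ?_, fun q => ?_, hy, fun q => ?_⟩
        · have : (s ≫ dup p c) ≫ conn p ε = s := by
            refine hom_ext' fun z j => ?_
            rw [comp_toFun, comp_toFun]
            by_cases hj : j = p
            · subst hj
              rw [conn_self, dup_toFun _ _ _ (hc z), dup_toFun _ _ _ (hc z)]
              simp only [Fin.predAbove_castSucc_self, Fin.predAbove_succ_self]
              generalize s.toFun z j = a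
              cases ε <;> cases a <;> rfl
            · obtain ⟨q, rfl⟩ : ∃ q, p.predAbove q = j := Fin.predAbove_surjective p j
              rw [conn_predAbove _ _ _ _ hj, dup_toFun _ _ _ (hc z)]
          rw [← Category.assoc, this, hs]
        · simp only [comp_toFun]
          rcases hcp (p.predAbove q) with ⟨d, hd⟩ | ⟨l, hl⟩
          · exact Or.inl ⟨d, fun z => by rw [dup_toFun _ _ _ (hc z), hd]⟩
          · exact Or.inr ⟨l, fun z => by rw [dup_toFun _ _ _ (hc z), hl]⟩
        · rw [comp_toFun, dup_toFun _ _ _ (hc y)]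
          by_cases hq : p.predAbove q = p
          · right
            intro hx
            rw [hq]
            apply hii
            rw [hUε] at hx ⊢
            apply bop_self
            rcases predAbove_eq hq with rfl | rfl
            · exact Or.inl hx
            · exact Or.inr hx
          · exact haway q hq
      · have hlk : l = k := by
          by_contra hlk
          exact hfp ⟨s, hs, l, hlk, hl⟩
        refine ⟨s ≫ face p.castSucc ε, y, hsec1 s hs, hcp1, hy, fun q => ?_⟩
        by_cases hq : p.predAbove q = p
        · right
          intro hx
          exfalso
          have h1 : bop ε (x p.castSucc) (x p.succ) = !U := by
            rw [hUε] at hx ⊢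
            apply bop_self
            rcases predAbove_eq hq with rfl | rfl
            · exact Or.inl hx
            · exact Or.inr hx
          have h2 := hii h1
          rw [hl, hlk, hy] at h2
          simp at h2
        · refine (haway q hq).imp id fun h => ?_
          rwa [comp_toFun, face_castSucc_toFun, if_neg (hne1 q hq).1]
    · have hUε' : ε = !U := by
        revert hUε; generalize U = a; cases a <;> cases ε <;> simp
      by_cases hx : x p.castSucc = !U
      · by_cases hx' : x p.succ = !U
        · have hs1 : s.toFun y p = !U := hii (by rw [hx, hx', ← hUε', bop_neutral])
          refine ⟨s ≫ face p.castSucc ε, y, hsec1 s hs, hcp1, hy, fun q => ?_⟩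
          rw [comp_toFun, face_castSucc_toFun]
          by_cases hq : p.predAbove q = p
          · right
            intro _
            split_ifs
            · exact hUε'
            · rw [hq, hs1]
          · refine (haway q hq).imp id fun h => ?_
            rwa [if_neg (hne1 q hq).1]
        · refine ⟨s ≫ face p.castSucc ε, y, hsec1 s hs, hcp1, hy, fun q => ?_⟩
          rw [comp_toFun, face_castSucc_toFun]
          by_cases hq : p.predAbove q = p
          · right
            intro hxq
            rcases predAbove_eq hq with rfl | rfl
            · rw [if_pos rfl, hUε']
            · exact absurd hxq hx'
          · refine (haway q hq).imp id fun h => ?_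
            rwa [if_neg (hne1 q hq).1]
      · refine ⟨s ≫ face p.succ ε, y, hsec2 s hs, hcp2, hy, fun q => ?_⟩
        rw [comp_toFun, face_succ_toFun]
        by_cases hq : p.predAbove q = p
        · right
          intro hxq
          rcases predAbove_eq hq with rfl | rfl
          · exact absurd hxq hx
          · rw [if_pos rfl, hUε']
        · refine (haway q hq).imp id fun h => ?_
          rwa [if_neg (hne1 q hq).2]

/-- A composite of codegeneracies and coconnections is determined by its sections. -/
theorem Surj.eq_of_sections {m n : ℕ} {e : Box.mk m ⟶ Box.mk n} (he : Surj e)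
    (e' : Box.mk m ⟶ Box.mk n) (h : ∀ s : Box.mk n ⟶ Box.mk m, s ≫ e = 𝟙 _ → s ≫ e' = 𝟙 _) :
    e = e' := by
  refine hom_ext' fun x k => ?_
  obtain ⟨s, y, hs, -, hy, hi⟩ := exists_section_of_surj he x k
  obtain ⟨φ, hφ, hsupp⟩ := disjointSupports e'
  have happ : ∀ (s : Box.mk n ⟶ Box.mk m), s ≫ e = 𝟙 _ → ∀ y j, e'.toFun (s.toFun y) j = y j := by
    intro s hs y j
    have := congrArg (fun f => Box.Hom.toFun f y j) (h s hs)
    simpa using this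
  -- foreign coordinates do not influence the `k`-th output of `e'`
  have hforeign : ∀ i, Foreign e k i → ¬ φ i k := by
    rintro i ⟨t, ht, l, hl, hti⟩ hik
    obtain ⟨ψ, hψ, hsupp'⟩ := disjointSupports t
    have hli : ψ l i := by
      by_contra hli
      have := hsupp' i (fun _ => false) (Function.update (fun _ => false) l true) fun j hj => by
        rw [Function.update_of_ne]; rintro rfl; exact hli hj
      rw [hti, hti] at this
      simp at this
    have hil : φ i l := by
      by_contra hil
      have := hsupp l (t.toFun fun _ => false)
          (t.toFun (Function.update (fun _ => false) l true)) fun j hj => by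
        apply hsupp'
        intro l' hl'
        rw [Function.update_of_ne]
        rintro rfl
        obtain rfl := hψ _ _ _ hli hl'
        exact hil hj
      rw [happ t ht, happ t ht] at this
      simp at this
    exact hl (hφ _ _ _ hil hik)
  classical
  let z : Fin m → Bool := fun i => if Foreign e k i then s.toFun y i else x i
  have hz : e'.toFun z k = e'.toFun x k := by
    apply hsupp
    intro i hik
    exact if_neg fun hf => hforeign i hf hik
  have hys : e'.toFun (s.toFun y) k = e.toFun x k := by rw [happ s hs, hy]
  have hzi : ∀ i, z i = (!e.toFun x k) → s.toFun y i = !e.toFun x k := by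
    intro i
    by_cases hf : Foreign e k i
    · intro h; simpa [z, hf] using h
    · simpa [z, hf] using (hi i).resolve_left hf
  rw [← hz]
  by_contra hne
  cases hU : e.toFun x k with
  | false =>
    have hle : z ≤ s.toFun y := by
      intro i
      have := hzi i
      rw [hU] at this
      revert this; generalize z i = a; generalize s.toFun y i = b
      cases a <;> cases b <;> simp
    have := toFun_mono e' hle k
    rw [hys, hU] at this
    rw [hU] at hne
    exact hne (le_antisymm (Bool.false_le _) this)
  | true =>
    have hle : s.toFun y ≤ z := by
      intro i
      have := hzi i
      rw [hU] at this
      revert this; generalize z i = a; generalize s.toFun y i = b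
      cases a <;> cases b <;> simp
    have := toFun_mono e' hle k
    rw [hys, hU] at this
    rw [hU] at hne
    exact hne (le_antisymm this (Bool.le_true _))

end Box

/-! ### Faces, nondegenerate cubes and partially defined maps -/

/-- The faces of a cube. -/
def bd (X : cSet.{u}) {n : ℕ} (i : Fin (n + 1)) (ε : Bool) (x : Cell X (n + 1)) : Cell X n :=
  act X (Box.face i ε) x

theorem app_bd {X Y : cSet.{u}} (p : X ⟶ Y) {n : ℕ} (i : Fin (n + 1)) (ε : Bool)
    (x : Cell X (n + 1)) : p.app (op (Box.mk n)) (bd X i ε x) = bd Y i ε (p.app _ x) :=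
  app_act p _ x

theorem bd_bd (X : cSet.{u}) {n : ℕ} {i j : Fin (n + 1)} (h : i ≤ j) (ε δ : Bool)
    (x : Cell X (n + 2)) :
    bd X i ε (bd X j.succ δ x) = bd X j δ (bd X i.castSucc ε x) := by
  simp only [bd, act_act, Box.face_face i j h]

/-- A cube is degenerate if it is induced from a cube of smaller dimension. -/
def IsDegen (X : cSet.{u}) {n : ℕ} (x : Cell X n) : Prop :=
  ∃ (k : ℕ) (_ : k < n) (e : Box.mk n ⟶ Box.mk k) (c : Cell X k), x = act X e c

theorem eq_id_of_act_eq {X : cSet.{u}} {n : ℕ} {x : Cell X n} (hx : ¬ IsDegen X x)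
    {a : Box.mk n ⟶ Box.mk n} (h : act X a x = x) : a = 𝟙 _ := by
  rcases Box.endo_cases a with rfl | ⟨k, v, f, hf, rfl⟩
  · rfl
  · have := hf.dim
    exact absurd ⟨k, by omega, v, act X f x, by rw [act_act, h]⟩ hx

/-- Eilenberg–Zilber: the degeneracies of a nondegenerate cube are pairwise distinct. -/
theorem surj_eq_of_act_eq {X : cSet.{u}} {m n : ℕ} {x : Cell X n} (hx : ¬ IsDegen X x)
    {e e' : Box.mk m ⟶ Box.mk n} (he : Box.Surj e) (h : act X e x = act X e' x) : e = e' := by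
  refine he.eq_of_sections e' fun s hs => eq_id_of_act_eq hx ?_
  rw [← act_act, ← h, act_act, hs, act_id]

/-- A partially defined map of cubical sets, given by its graph; the values are constrained by
the relation `R`. -/
structure PartialMap (B X : cSet.{u}) (R : ∀ n, Cell B n → Cell X n → Prop) where
  rel : ∀ n, Cell B n → Cell X n → Prop
  func : ∀ {n b x x'}, rel n b x → rel n b x' → x = x'
  act_mem : ∀ {m n b x} (a : Box.mk m ⟶ Box.mk n), rel n b x → rel m (act B a b) (act X a x)
  sub : ∀ {n b x}, rel n b x → R n b x

namespace PartialMap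

variable {B X : cSet.{u}} {R : ∀ n, Cell B n → Cell X n → Prop}

/-- Partially defined maps are ordered by extension. -/
instance : Preorder (PartialMap B X R) where
  le L L' := ∀ n b x, L.rel n b x → L'.rel n b x
  le_refl _ _ _ _ h := h
  le_trans _ _ _ h h' n b x hx := h' n b x (h n b x hx)

/-- The domain of definition. -/
def Dom (L : PartialMap B X R) {n : ℕ} (b : Cell B n) : Prop := ∃ x, L.rel n b x

theorem Dom.act {L : PartialMap B X R} {m n : ℕ} {b : Cell B n} (h : L.Dom b)
    (a : Box.mk m ⟶ Box.mk n) : L.Dom (act B a b) :=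
  ⟨_, L.act_mem a h.choose_spec⟩

theorem Dom.mono {L L' : PartialMap B X R} (h : L ≤ L') {n : ℕ} {b : Cell B n} (hb : L.Dom b) :
    L'.Dom b := ⟨_, h _ _ _ hb.choose_spec⟩

theorem dom_of_dom_act {L : PartialMap B X R} {m n : ℕ} {b : Cell B n}
    {e : Box.mk m ⟶ Box.mk n} (he : Box.Surj e) (h : L.Dom (CubDG.act B e b)) : L.Dom b := by
  obtain ⟨s, hs⟩ := he.section
  have := h.act s
  rwa [act_act, hs, act_id] at this

/-- Extension of a partial map to one more nondegenerate cube, all of whose faces lie in the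
domain. -/
def adjoin (L : PartialMap B X R)
    (hR : ∀ {m n b x} (a : Box.mk m ⟶ Box.mk n), R n b x → R m (CubDG.act B a b) (CubDG.act X a x))
    {n : ℕ} (b : Cell B n) (x : Cell X n) (hbx : R n b x) (hb : ¬ IsDegen B b) (hdom : ¬ L.Dom b)
    (hf : ∀ {k} (f : Box.mk k ⟶ Box.mk n), Box.IsFace f →
      L.rel k (CubDG.act B f b) (CubDG.act X f x)) :
    PartialMap B X R where
  rel m c y := L.rel m c y ∨ ∃ a : Box.mk m ⟶ Box.mk n, c = CubDG.act B a b ∧ y = CubDG.act X a x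
  func := by
    have key : ∀ {m y'} (a : Box.mk m ⟶ Box.mk n), L.rel m (CubDG.act B a b) y' →
        CubDG.act X a x = y' := by
      intro m y' a h
      rcases Box.surj_or_face a with ha | ⟨k, v, f, hff, rfl⟩
      · exact absurd (dom_of_dom_act ha ⟨_, h⟩) hdom
      · have := L.act_mem v (hf f hff)
        rw [act_act, act_act] at this
        exact L.func this h
    have key' : ∀ {m} (a : Box.mk m ⟶ Box.mk n), Box.Surj a ∨
        L.rel m (CubDG.act B a b) (CubDG.act X a x) := by
      intro m a
      rcases Box.surj_or_face a with ha | ⟨k, v, f, hff, rfl⟩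
      · exact Or.inl ha
      · have := L.act_mem v (hf f hff)
        rw [act_act, act_act] at this
        exact Or.inr this
    rintro m c y y' (h | ⟨a, rfl, rfl⟩) (h' | ⟨a', hc, rfl⟩)
    · exact L.func h h'
    · subst hc; exact (key a' h).symm
    · exact key a h'
    · rcases key' a with ha | ha
      · rw [surj_eq_of_act_eq hb ha hc]
      · rw [hc] at ha
        exact (key a' ha).symm
  act_mem := by
    rintro m k c y a (h | ⟨a', rfl, rfl⟩)
    · exact Or.inl (L.act_mem a h)
    · exact Or.inr ⟨a ≫ a', by rw [act_act], by rw [act_act]⟩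
  sub := by
    rintro m c y (h | ⟨a', rfl, rfl⟩)
    · exact L.sub h
    · exact hR a' hbx

/-- A totally defined partial map is a map. -/
def toHom (L : PartialMap B X R) (h : ∀ n (b : Cell B n), L.Dom b) : B ⟶ X where
  app a := ↾fun b => (h a.unop.dim b).choose
  naturality a a' f := by
    ext b
    exact (L.func (L.act_mem f.unop (h a.unop.dim b).choose_spec)
      (h a'.unop.dim (CubDG.act B f.unop b)).choose_spec).symm

theorem toHom_rel (L : PartialMap B X R) (h : ∀ n (b : Cell B n), L.Dom b) {n : ℕ}
    (b : Cell B n) : L.rel n b ((L.toHom h).app (op (Box.mk n)) b) :=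
  (h n b).choose_spec

/-- Zorn's lemma for partial maps whose domain is closed under a relation `C`. -/
theorem exists_hom (C : ∀ n m, Cell B n → Cell B m → Prop) (L₀ : PartialMap B X R)
    (h₀ : ∀ n m b c, L₀.Dom b → C n m b c → L₀.Dom c)
    (step : ∀ L : PartialMap B X R, (∀ n m b c, L.Dom b → C n m b c → L.Dom c) → L₀ ≤ L →
      (∃ (n : ℕ) (b : Cell B n), ¬ L.Dom b) →
      ∃ L' : PartialMap B X R, (∀ n m b c, L'.Dom b → C n m b c → L'.Dom c) ∧ L ≤ L' ∧
        ∃ (n : ℕ) (b : Cell B n), ¬ L.Dom b ∧ L'.Dom b) :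
    ∃ f : B ⟶ X, (∀ n b x, L₀.rel n b x → f.app (op (Box.mk n)) b = x) ∧
      ∀ n (b : Cell B n), R n b (f.app (op (Box.mk n)) b) := by
  let S := {L : PartialMap B X R // (∀ n m b c, L.Dom b → C n m b c → L.Dom c)}
  obtain ⟨⟨M, hM⟩, hM₀, hmax⟩ := zorn_le_nonempty_Ici₀ (α := S) ⟨L₀, h₀⟩ (by
    intro c _ hc y hy
    refine ⟨⟨{ rel := fun n b x => ∃ L ∈ c, L.1.rel n b x
               func := ?_, act_mem := ?_, sub := ?_ }, ?_⟩, ?_⟩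
    · rintro n b x x' ⟨L, hL, h⟩ ⟨L', hL', h'⟩
      rcases hc.total hL hL' with hle | hle
      · exact L'.1.func (hle _ _ _ h) h'
      · exact L.1.func h (hle _ _ _ h')
    · rintro m n b x a ⟨L, hL, h⟩
      exact ⟨L, hL, L.1.act_mem a h⟩
    · rintro n b x ⟨L, hL, h⟩
      exact L.1.sub h
    · rintro n m b c' ⟨x, L, hL, h⟩ hC
      obtain ⟨y, hy⟩ := L.2 n m b c' ⟨x, h⟩ hC
      exact ⟨y, L, hL, hy⟩
    · intro z hz n b x h
      exact ⟨z, hz, h⟩) ⟨L₀, h₀⟩ le_rfl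
  have htot : ∀ n (b : Cell B n), M.Dom b := by
    by_contra hcon
    push Not at hcon
    obtain ⟨L', hL', hle, n, b, hb, hb'⟩ := step M hM hM₀ hcon
    exact hb (hb'.mono (hmax (b := ⟨L', hL'⟩) hle))
  exact ⟨M.toHom htot, fun n b x h => M.func (M.toHom_rel htot b) (hM₀ _ _ _ h),
    fun n b => M.sub (M.toHom_rel htot b)⟩

end PartialMap

/-! ### Compatible families of faces, fibrations and trivial fibrations -/

/-- Families of faces for an `(n + 1)`-cube. -/
abbrev Family (X : cSet.{u}) (n : ℕ) : Type u := Fin (n + 1) → Bool → Cell X n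

/-- The faces selected by `P` agree on their intersections. -/
def Compat (X : cSet.{u}) {n : ℕ} (P : Fin (n + 1) → Bool → Prop) (x : Family X n) : Prop :=
  ∀ ⦃m : ℕ⦄ (v v' : Box.mk m ⟶ Box.mk n) (j k : Fin (n + 1)) (δ δ' : Bool), P j δ → P k δ' →
    v ≫ Box.face j δ = v' ≫ Box.face k δ' → act X v (x j δ) = act X v' (x k δ')

theorem face_eq_face {m n : ℕ} {v v' : Box.mk m ⟶ Box.mk n} {j : Fin (n + 1)} {δ δ' : Bool}
    (h : v ≫ Box.face j δ = v' ≫ Box.face j δ') : δ = δ' ∧ v = v' := by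
  constructor
  · have := congrArg (fun f => Box.Hom.toFun f (fun _ => false) j) h
    simpa using this
  · have := congrArg (fun f => f ≫ Box.degen j) h
    simpa [Box.face_degen_self] using this

/-- A common point of two faces `i < j + 1` lies in their intersection. -/
theorem face_face_inter {m n : ℕ} {v v' : Box.mk m ⟶ Box.mk (n + 1)} {i j : Fin (n + 1)}
    (hij : i ≤ j) {ε δ : Bool} (h : v ≫ Box.face i.castSucc ε = v' ≫ Box.face j.succ δ) :
    ∃ w : Box.mk m ⟶ Box.mk n, v = w ≫ Box.face j δ ∧ v' = w ≫ Box.face i ε := by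
  have hK : i.castSucc.succAbove j = j.succ := by
    rw [Fin.succAbove_castSucc_of_le _ _ hij]
  refine ⟨v ≫ Box.degen j, ?_, ?_⟩
  · refine Box.hom_ext' fun x k => ?_
    rw [Category.assoc, Box.comp_toFun, Box.comp_toFun]
    rcases Fin.eq_self_or_eq_succAbove j k with rfl | ⟨l, rfl⟩
    · rw [Box.face_self]
      have := congrArg (fun f => Box.Hom.toFun f x k.succ) h
      simp only [Box.comp_toFun, Box.face_self] at this
      rw [← this]
      conv_rhs => rw [← hK]
      rw [Box.face_succAbove]
    · rw [Box.face_succAbove, Box.degen_toFun]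
  · have h2 : v' = (v' ≫ Box.face j.succ δ) ≫ Box.degen j.succ := by
      rw [Category.assoc, Box.face_degen_self, Category.comp_id]
    rw [h2, ← h, ← hK, Category.assoc, Box.face_degen_succAbove, Category.assoc]
    congr 3
    rw [Fin.predAbove_castSucc_of_le _ _ hij]

theorem compat_zero (X : cSet.{u}) (P : Fin 1 → Bool → Prop) (x : Family X 0) :
    Compat X P x := by
  intro m v v' j k δ δ' _ _ h
  obtain rfl : j = k := Subsingleton.elim (α := Fin 1) _ _
  obtain ⟨rfl, rfl⟩ := face_eq_face h
  rfl

theorem compat_succ (X : cSet.{u}) {n : ℕ} (P : Fin (n + 2) → Bool → Prop) (x : Family X (n + 1))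
    (hx : ∀ (i j : Fin (n + 1)) (ε δ : Bool), i ≤ j → P i.castSucc ε → P j.succ δ →
      bd X i ε (x j.succ δ) = bd X j δ (x i.castSucc ε)) : Compat X P x := by
  have key : ∀ {m : ℕ} (v v' : Box.mk m ⟶ Box.mk (n + 1)) (j k : Fin (n + 2)) (δ δ' : Bool),
      j < k → P j δ → P k δ' →
      v ≫ Box.face j δ = v' ≫ Box.face k δ' → act X v (x j δ) = act X v' (x k δ') := by
    intro m v v' j k δ δ' hjk hP hP' h
    obtain ⟨k, rfl⟩ := Fin.eq_succ_of_ne_zero (Fin.ne_zero_of_lt hjk)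
    obtain ⟨j, rfl⟩ : ∃ j' : Fin (n + 1), j'.castSucc = j :=
      ⟨⟨j.val, by have := Fin.lt_def.1 hjk; rw [Fin.val_succ] at this; omega⟩, rfl⟩
    have hle : j ≤ k := by
      have := Fin.lt_def.1 hjk
      rw [Fin.val_succ, Fin.val_castSucc] at this
      rw [Fin.le_def]; omega
    obtain ⟨w, rfl, rfl⟩ := face_face_inter hle h
    rw [← act_act, ← act_act]
    congr 1
    exact (hx j k δ δ' hle hP hP').symm
  intro m v v' j k δ δ' hP hP' h
  rcases lt_trichotomy j k with hjk | rfl | hjk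
  · exact key v v' j k δ δ' hjk hP hP' h
  · obtain ⟨rfl, rfl⟩ := face_eq_face h
    rfl
  · exact (key v' v k j δ' δ hjk hP' hP h.symm).symm

/-- The right lifting property against all open box inclusions, in terms of faces. -/
def IsFib {X Y : cSet.{u}} (p : X ⟶ Y) : Prop :=
  ∀ (n : ℕ) (i : Fin (n + 1)) (ε : Bool) (x : Family X n) (y : Cell Y (n + 1)),
    Compat X (fun j δ => (j, δ) ≠ (i, ε)) x →
    (∀ j δ, (j, δ) ≠ (i, ε) → p.app (op (Box.mk n)) (x j δ) = bd Y j δ y) →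
    ∃ z : Cell X (n + 1), p.app (op (Box.mk (n + 1))) z = y ∧
      ∀ j δ, (j, δ) ≠ (i, ε) → bd X j δ z = x j δ

/-- The right lifting property against all boundary inclusions, in terms of faces. -/
structure IsTrivFib {X Y : cSet.{u}} (p : X ⟶ Y) : Prop where
  zero : ∀ y : Cell Y 0, ∃ x, p.app (op (Box.mk 0)) x = y
  succ : ∀ (n : ℕ) (x : Family X n) (y : Cell Y (n + 1)), Compat X (fun _ _ => True) x →
    (∀ j δ, p.app (op (Box.mk n)) (x j δ) = bd Y j δ y) →
    ∃ z : Cell X (n + 1), p.app (op (Box.mk (n + 1))) z = y ∧ ∀ j δ, bd X j δ z = x j δ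

/-- Maps can be constructed cube by cube, if the allowed values on a cube can be chosen with a
prescribed boundary. -/
theorem exists_hom_of_boundary {B X : cSet.{u}} {R : ∀ n, Cell B n → Cell X n → Prop}
    (hR : ∀ {m n b x} (a : Box.mk m ⟶ Box.mk n), R n b x → R m (act B a b) (act X a x))
    (h0 : ∀ b : Cell B 0, ∃ x, R 0 b x)
    (hs : ∀ n (b : Cell B (n + 1)) (x : Family X n), Compat X (fun _ _ => True) x →
      (∀ j δ, R n (bd B j δ b) (x j δ)) → ∃ z, R (n + 1) b z ∧ ∀ j δ, bd X j δ z = x j δ)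
    (L₀ : PartialMap B X R) :
    ∃ f : B ⟶ X, (∀ n b x, L₀.rel n b x → f.app (op (Box.mk n)) b = x) ∧
      ∀ n (b : Cell B n), R n b (f.app (op (Box.mk n)) b) := by
  refine PartialMap.exists_hom (fun _ _ _ _ => False) L₀ (fun _ _ _ _ _ h => h.elim) ?_
  intro L _ _ hL
  classical
  -- a cube of minimal dimension outside the domain
  obtain ⟨b, hb⟩ := Nat.find_spec hL
  have hmin : ∀ m < Nat.find hL, ∀ c : Cell B m, L.Dom c := by
    intro m hm c
    by_contra hc
    exact Nat.find_min hL hm ⟨c, hc⟩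
  generalize Nat.find hL = n at b hb hmin
  have hdeg : ¬ IsDegen B b := by
    rintro ⟨k, hk, e, c, rfl⟩
    exact hb ((hmin k hk c).act e)
  suffices h : ∃ x, R n b x ∧ ∀ {k} (f : Box.mk k ⟶ Box.mk n), Box.IsFace f →
      L.rel k (act B f b) (act X f x) by
    obtain ⟨x, hx, hf⟩ := h
    exact ⟨L.adjoin hR b x hx hdeg hb hf, fun _ _ _ _ _ h => h.elim, fun _ _ _ h => Or.inl h,
      n, b, hb, x, Or.inr ⟨𝟙 _, by rw [act_id], by rw [act_id]⟩⟩
  cases n with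
  | zero =>
    obtain ⟨x, hx⟩ := h0 b
    exact ⟨x, hx, fun f hf => absurd hf.dim (by omega)⟩
  | succ n =>
    choose x hx using fun j δ => hmin n (Nat.lt_succ_self n) (bd B j δ b)
    obtain ⟨z, hz, hzf⟩ := hs n b x (by
      intro m v v' j k δ δ' _ _ h
      have h1 := L.act_mem v (hx j δ)
      have h2 := L.act_mem v' (hx k δ')
      rw [bd, act_act] at h1 h2
      rw [← h] at h2
      exact L.func h1 h2) (fun j δ => L.sub (hx j δ))
    refine ⟨z, hz, ?_⟩
    rintro k f ⟨i, ε⟩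
    have := hx i ε
    rw [← hzf] at this
    exact this

/-! ### Maps out of open boxes -/

theorem mem_openBox {n : ℕ} {i : Fin (n + 1)} {ε : Bool} {a : Boxᵒᵖ}
    (u : (stdCube.{u} (n + 1)).obj a) : u ∈ (openBox.{u} i ε).obj a ↔
      ∃ j δ, (j, δ) ≠ (i, ε) ∧ ∃ v : a.unop ⟶ ⟨n⟩, v ≫ Box.face j δ = u.down := by
  simp only [openBox, Subfunctor.iSup_obj, Set.mem_iUnion, faceSub, Subfunctor.range_obj,
    Set.mem_range]
  constructor
  · rintro ⟨j, δ, h, v, rfl⟩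
    exact ⟨j, δ, h, v.down, rfl⟩
  · rintro ⟨j, δ, h, v, hv⟩
    exact ⟨j, δ, h, ULift.up v, ULift.ext _ _ hv⟩

/-- A map of the box category as a cube of a standard cube. -/
def stdElt {m n : ℕ} (v : Box.mk m ⟶ Box.mk n) : Cell (stdCube.{u} n) m := ULift.up v

/-- The cubes of an open box. -/
def openElt {m n : ℕ} {i : Fin (n + 1)} {ε : Bool} (v : Box.mk m ⟶ Box.mk n) {j : Fin (n + 1)}
    {δ : Bool} (h : (j, δ) ≠ (i, ε)) : Cell (openBox.{u} i ε).toFunctor m :=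
  ⟨stdElt (v ≫ Box.face j δ), (mem_openBox _).2 ⟨j, δ, h, v, rfl⟩⟩

/-- The map out of an open box with prescribed values on the faces. -/
theorem exists_openBox_hom {X : cSet.{u}} {n : ℕ} (i : Fin (n + 1)) (ε : Bool) (x : Family X n)
    (hx : Compat X (fun j δ => (j, δ) ≠ (i, ε)) x) :
    ∃ f : (openBox.{u} i ε).toFunctor ⟶ X, ∀ (m : ℕ)
      (u : (openBox.{u} i ε).toFunctor.obj (op (Box.mk m))) (j δ) (v : Box.mk m ⟶ Box.mk n),
      (j, δ) ≠ (i, ε) → v ≫ Box.face j δ = u.1.down → f.app _ u = act X v (x j δ) := by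
  have h : ∀ (a : Boxᵒᵖ) (u : (openBox.{u} i ε).toFunctor.obj a),
      ∃ y : Cell X a.unop.dim, ∀ (j δ) (v : Box.mk a.unop.dim ⟶ Box.mk n),
      (j, δ) ≠ (i, ε) → v ≫ Box.face j δ = u.1.down → y = act X v (x j δ) := by
    rintro a ⟨u, hu⟩
    obtain ⟨j, δ, hne, v, hv⟩ := (mem_openBox u).1 hu
    refine ⟨act X v (x j δ), fun j' δ' v' hne' hv' => ?_⟩
    exact hx v v' j j' δ δ' hne hne' (hv.trans hv'.symm)
  choose F hF using h
  refine ⟨{ app := fun a => ↾fun u => F a u, naturality := ?_ }, fun m u j δ v h1 h2 => ?_⟩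
  · intro a b f
    ext u
    obtain ⟨j, δ, hne, v, hv⟩ := (mem_openBox u.1).1 u.2
    change F b _ = act X f.unop (F a u)
    rw [hF a u j δ v hne hv, act_act]
    refine hF b _ j δ _ hne ?_
    rw [Category.assoc, hv]
    rfl
  · exact hF (op (Box.mk m)) u j δ v h1 h2

theorem IsKan.fill {X : cSet.{u}} (hX : IsKan X) {n : ℕ} (i : Fin (n + 1)) (ε : Bool)
    (x : Family X n) (hx : Compat X (fun j δ => (j, δ) ≠ (i, ε)) x) :
    ∃ z : Cell X (n + 1), ∀ j δ, (j, δ) ≠ (i, ε) → bd X j δ z = x j δ := by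
  obtain ⟨f, hf⟩ := exists_openBox_hom i ε x hx
  obtain ⟨g, hg⟩ := hX n i ε f
  refine ⟨g.app (op (Box.mk (n + 1))) (stdElt (𝟙 _)), fun j δ hne => ?_⟩
  have h1 := hf n (openElt (𝟙 _) hne) j δ (𝟙 _) hne rfl
  rw [act_id, ← hg] at h1
  exact (app_act g (Box.face j δ) (stdElt (𝟙 _))).symm.trans h1

theorem isKan_of_fill {X : cSet.{u}}
    (h : ∀ (n : ℕ) (i : Fin (n + 1)) (ε : Bool) (x : Family X n),
      Compat X (fun j δ => (j, δ) ≠ (i, ε)) x →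
      ∃ z : Cell X (n + 1), ∀ j δ, (j, δ) ≠ (i, ε) → bd X j δ z = x j δ) : IsKan X := by
  intro n i ε f
  classical
  obtain ⟨z₀⟩ : Nonempty (Cell X n) :=
    ⟨f.app (op (Box.mk n)) (openElt (j := i) (δ := !ε) (𝟙 _) (by simp))⟩
  let x : Family X n := fun j δ =>
    if hne : (j, δ) ≠ (i, ε) then f.app (op (Box.mk n)) (openElt (𝟙 _) hne) else z₀
  have hnat : ∀ {m j δ} (v : Box.mk m ⟶ Box.mk n) (hne : (j, δ) ≠ (i, ε)),
      act X v (x j δ) = f.app (op (Box.mk m)) (openElt v hne) := by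
    intro m j δ v hne
    have hxf : x j δ = f.app (op (Box.mk n)) (openElt (𝟙 _) hne) := dif_pos hne
    rw [hxf]
    exact (app_act f v (openElt (𝟙 _) hne)).symm
  have helt : ∀ {m j k δ δ'} (v v' : Box.mk m ⟶ Box.mk n) (hP : (j, δ) ≠ (i, ε))
      (hP' : (k, δ') ≠ (i, ε)), v ≫ Box.face j δ = v' ≫ Box.face k δ' →
      openElt.{u} v hP = openElt v' hP' := fun v v' hP hP' hv =>
    Subtype.ext (congrArg stdElt hv)
  obtain ⟨z, hz⟩ := h n i ε x (by
    intro m v v' j k δ δ' hP hP' hv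
    rw [hnat v hP, hnat v' hP', helt v v' hP hP' hv])
  refine ⟨{ app := fun a => ↾fun u => act X u.down z, naturality := ?_ }, ?_⟩
  · intro a b g
    ext u
    change act X (g.unop ≫ u.down) z = act X g.unop (act X u.down z)
    rw [act_act]
  · ext a u
    obtain ⟨j, δ, hne, v, hv⟩ := (mem_openBox u.1).1 u.2
    change act X u.1.down z = f.app (op (Box.mk a.unop.dim)) u
    have h1 : act X v (bd X j δ z) = _ := (congrArg (act X v) (hz j δ hne)).trans (hnat v hne)
    rw [bd, act_act] at h1
    refine (congrArg (fun w => act X w z) hv.symm).trans (h1.trans ?_)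
    exact congrArg _ (Subtype.ext (ULift.ext _ _ hv))

/-! ### Path objects and constant cubes -/

namespace Box

/-- The map of the box category induced on cylinders. -/
def cylMap {m n : ℕ} (a : Box.mk m ⟶ Box.mk n) : Box.mk (m + 1) ⟶ Box.mk (n + 1) :=
  Box.cyl.map a

theorem cylMap_toFun {m n : ℕ} (a : Box.mk m ⟶ Box.mk n) (x : Fin (m + 1) → Bool) :
    (cylMap a).toFun x =
      Fin.snoc (α := fun _ => Bool) (a.toFun (Fin.init x)) (x (Fin.last m)) := rfl

theorem cylMap_face {n : ℕ} (i : Fin (n + 1)) (ε : Bool) :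
    cylMap (face i ε) = face i.castSucc ε := by
  refine Box.Hom.ext (funext fun x => ?_)
  rw [cylMap_toFun]
  exact (BoxWord.eval_cyl Bool (.face i ε) x).symm

theorem cylMap_degen {n : ℕ} (i : Fin (n + 1)) : cylMap (degen i) = degen i.castSucc := by
  refine Box.Hom.ext (funext fun x => ?_)
  rw [cylMap_toFun]
  exact (BoxWord.eval_cyl Bool (.degen i) x).symm

theorem cylMap_conn {n : ℕ} (i : Fin (n + 1)) (ε : Bool) :
    cylMap (conn i ε) = conn i.castSucc ε := by
  refine Box.Hom.ext (funext fun x => ?_)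
  rw [cylMap_toFun]
  exact (BoxWord.eval_cyl Bool (.conn i ε) x).symm

theorem cylMap_comp {m n k : ℕ} (a : Box.mk m ⟶ Box.mk n) (b : Box.mk n ⟶ Box.mk k) :
    cylMap (a ≫ b) = cylMap a ≫ cylMap b := Box.cyl.map_comp a b

theorem cylMap_id (n : ℕ) : cylMap (𝟙 (Box.mk n)) = 𝟙 (Box.mk (n + 1)) := Box.cyl.map_id _

theorem face_last_comp_cylMap {m n : ℕ} (a : Box.mk m ⟶ Box.mk n) (ε : Bool) :
    face (Fin.last m) ε ≫ cylMap a = a ≫ face (Fin.last n) ε :=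
  ((Box.cylEnd ε).naturality a).symm

theorem cylMap_comp_degen_last {m n : ℕ} (a : Box.mk m ⟶ Box.mk n) :
    cylMap a ≫ degen (Fin.last n) = degen (Fin.last m) ≫ a := by
  refine hom_ext' fun x j => ?_
  rw [comp_toFun, comp_toFun, degen_toFun, cylMap_toFun, Fin.succAbove_last, Fin.snoc_castSucc]
  congr 2
  funext l
  rw [degen_toFun, Fin.succAbove_last]
  rfl

theorem eq_of_zero {m : ℕ} (a b : Box.mk m ⟶ Box.mk 0) : a = b :=
  hom_ext' fun _ j => j.elim0

/-- The map from a cube to the point. -/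
def bang : ∀ n : ℕ, Box.mk n ⟶ Box.mk 0
  | 0 => 𝟙 _
  | n + 1 => degen 0 ≫ bang n

end Box

theorem act_pathObj (X : cSet.{u}) {m n : ℕ} (a : Box.mk m ⟶ Box.mk n)
    (z : Cell (pathObj X) n) : act (pathObj X) a z = act X (Box.cylMap a) (z : Cell X (n + 1)) :=
  rfl

theorem bd_pathObj (X : cSet.{u}) {n : ℕ} (i : Fin (n + 1)) (ε : Bool)
    (z : Cell (pathObj X) (n + 1)) :
    bd (pathObj X) i ε z = bd X i.castSucc ε (z : Cell X (n + 2)) := by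
  rw [bd, act_pathObj, Box.cylMap_face]; rfl

theorem pathEnd_app (X : cSet.{u}) {n : ℕ} (ε : Bool) (z : Cell (pathObj X) n) :
    (pathEnd ε X).app (op (Box.mk n)) z = bd X (Fin.last n) ε (z : Cell X (n + 1)) := rfl

/-- The constant path on a cube. -/
def constPath (X : cSet.{u}) : X ⟶ pathObj X where
  app a := ↾fun x => act X (Box.degen (Fin.last a.unop.dim)) x
  naturality a b f := by
    ext x
    change act X _ (act X f.unop x) = act X (Box.cylMap f.unop) (act X _ x)
    rw [act_act, act_act, Box.cylMap_comp_degen_last]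

theorem constPath_app (X : cSet.{u}) {n : ℕ} (x : Cell X n) :
    (constPath X).app (op (Box.mk n)) x = act X (Box.degen (Fin.last n)) x := rfl

theorem bd_last_degen (X : cSet.{u}) {n : ℕ} (i : Fin (n + 1)) (ε : Bool) (x : Cell X n) :
    bd X i ε (act X (Box.degen i) x) = x := by
  rw [bd, act_act, Box.face_degen_self, act_id]

/-- The constant cube at a vertex. -/
def cst (X : cSet.{u}) (n : ℕ) (x : Cell X 0) : Cell X n := act X (Box.bang n) x

theorem act_cst (X : cSet.{u}) {m n : ℕ} (a : Box.mk m ⟶ Box.mk n) (x : Cell X 0) :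
    act X a (cst X n x) = cst X m x := by
  rw [cst, act_act, Box.eq_of_zero (a ≫ Box.bang n) (Box.bang m)]; rfl

theorem app_cst {X Y : cSet.{u}} (p : X ⟶ Y) (n : ℕ) (x : Cell X 0) :
    p.app (op (Box.mk n)) (cst X n x) = cst Y n (p.app (op (Box.mk 0)) x) := app_act p _ x

theorem cst_zero (X : cSet.{u}) (x : Cell X 0) : cst X 0 x = x := act_id X x

/-! ### Cubes with the same boundary -/

/-- Two cubes with the same boundary. -/
def SameBd (X : cSet.{u}) {n : ℕ} (α β : Cell X n) : Prop :=
  ∀ ⦃k : ℕ⦄ (f : Box.mk k ⟶ Box.mk n), Box.IsFace f → act X f α = act X f β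

theorem SameBd.refl {X : cSet.{u}} {n : ℕ} (α : Cell X n) : SameBd X α α := fun _ _ _ => rfl

theorem SameBd.symm {X : cSet.{u}} {n : ℕ} {α β : Cell X n} (h : SameBd X α β) :
    SameBd X β α := fun _ f hf => (h f hf).symm

theorem SameBd.trans {X : cSet.{u}} {n : ℕ} {α β γ : Cell X n} (h : SameBd X α β)
    (h' : SameBd X β γ) : SameBd X α γ := fun _ f hf => (h f hf).trans (h' f hf)

theorem SameBd.app {X Y : cSet.{u}} (p : X ⟶ Y) {n : ℕ} {α β : Cell X n} (h : SameBd X α β) :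
    SameBd Y (p.app (op (Box.mk n)) α) (p.app (op (Box.mk n)) β) := fun _ f hf => by
  rw [← app_act, ← app_act, h f hf]

theorem sameBd_succ {X : cSet.{u}} {n : ℕ} {α β : Cell X (n + 1)} :
    SameBd X α β ↔ ∀ i ε, bd X i ε α = bd X i ε β :=
  ⟨fun h i ε => h _ ⟨i, ε⟩, fun h => by
    rintro _ _ ⟨i, ε⟩
    exact h i ε⟩

theorem sameBd_zero {X : cSet.{u}} (α β : Cell X 0) : SameBd X α β :=
  fun _ _ hf => absurd hf.dim (by omega)

theorem sameBd_path {X : cSet.{u}} {n : ℕ} {α β : Cell X (n + 1)} :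
    SameBd (pathObj X) (n := n) α β ↔
      ∀ (j : Fin n) δ, bd X j.castSucc δ α = bd X j.castSucc δ β := by
  cases n with
  | zero => exact ⟨fun _ j => j.elim0, fun _ => sameBd_zero _ _⟩
  | succ n =>
    exact (sameBd_succ (X := pathObj X)).trans
      (forall_congr' fun j => forall_congr' fun δ =>
        Eq.congr (bd_pathObj X _ _ _) (bd_pathObj X _ _ _))

theorem sameBd_path_path {X : cSet.{u}} {n : ℕ} {α β : Cell X (n + 2)} :
    SameBd (pathObj (pathObj X)) (n := n) α β ↔
      ∀ (j : Fin n) δ, bd X j.castSucc.castSucc δ α = bd X j.castSucc.castSucc δ β := by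
  exact (sameBd_path (X := pathObj X) (n := n) (α := α) (β := β)).trans
    (forall_congr' fun j => forall_congr' fun δ =>
        Eq.congr (bd_pathObj X _ _ _) (bd_pathObj X _ _ _))

/-! ### Elementary open box fillings -/

theorem Compat.bd_eq {X : cSet.{u}} {n : ℕ} {P : Fin (n + 2) → Bool → Prop}
    {x : Family X (n + 1)} (h : Compat X P x) {i j : Fin (n + 1)} (hij : i ≤ j) {ε δ : Bool}
    (hi : P i.castSucc ε) (hj : P j.succ δ) :
    bd X i ε (x j.succ δ) = bd X j δ (x i.castSucc ε) :=
  h _ _ _ _ _ _ hj hi (Box.face_face i j hij ε δ)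

/-- A path in the total space of a fibration with prescribed boundary and one prescribed end. -/
theorem IsFib.fill_end {X Y : cSet.{u}} {p : X ⟶ Y} (hp : IsFib p) {n : ℕ}
    (z₀ : Cell (pathObj X) n) (ε : Bool) (α : Cell X n)
    (hα : SameBd X α ((pathEnd ε X).app _ z₀)) (y : Cell (pathObj Y) n)
    (hy : SameBd (pathObj Y) y ((pathMap p).app _ z₀))
    (hαy : p.app _ α = (pathEnd ε Y).app _ y) :
    ∃ z : Cell (pathObj X) n, (pathMap p).app _ z = y ∧ SameBd (pathObj X) z z₀ ∧
      (pathEnd ε X).app _ z = α := by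
  let F : Family X n := fun J δ => Fin.lastCases (motive := fun _ => Cell X n) α
    (fun j => bd X j.castSucc δ (z₀ : Cell X (n + 1))) J
  have hF1 : ∀ δ, F (Fin.last n) δ = α := fun δ => Fin.lastCases_last
  have hF2 : ∀ (j : Fin n) δ, F j.castSucc δ = bd X j.castSucc δ (z₀ : Cell X (n + 1)) :=
    fun j δ => Fin.lastCases_castSucc _
  obtain ⟨z, hz, hzf⟩ := hp n (Fin.last n) (!ε) F y (by
    cases n with
    | zero => exact compat_zero _ _ _
    | succ n =>
      refine compat_succ _ _ _ fun i j ε' δ hij hP hP' => ?_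
      rw [hF2]
      by_cases hj : j = Fin.last n
      · subst hj
        rw [Fin.succ_last, hF1]
        have hδ : δ = ε := by
          by_contra hne
          exact hP' (by rw [Fin.succ_last, Bool.eq_not.2 hne])
        rw [sameBd_succ.1 hα, pathEnd_app, hδ]
        exact bd_bd X hij _ _ _
      · obtain ⟨j', hj'⟩ : ∃ j' : Fin (n + 1), j'.castSucc = j.succ :=
          Fin.exists_castSucc_eq.2 (by
            intro h; rw [← Fin.succ_last] at h; exact hj (Fin.succ_injective _ h))
        rw [← hj', hF2, hj']
        exact bd_bd X hij _ _ _) (by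
    intro J δ hne
    induction J using Fin.lastCases with
    | last =>
      rw [hF1, hαy, pathEnd_app]
      congr 1
      have : δ ≠ !ε := fun h => hne (by rw [h])
      revert this; cases δ <;> cases ε <;> simp
    | cast j =>
      rw [hF2]
      exact (app_bd p _ _ _).trans (sameBd_path.1 hy j δ).symm)
  refine ⟨z, hz, sameBd_path.2 fun j δ => ?_, ?_⟩
  · rw [hzf _ _ (by simp [(Fin.castSucc_lt_last j).ne]), hF2]
  · exact (hzf _ _ (by simp)).trans (hF1 _)

/-- The indices of the last two coordinates of an `(n + 2)`-cube. -/
def sqIdx (n : ℕ) (κ : Bool) : Fin (n + 2) := if κ then Fin.last (n + 1) else (Fin.last n).castSucc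

/-- The faces of an `(n + 2)`-cube in its last two coordinates. -/
def sqFace (X : cSet.{u}) {n : ℕ} (κ ε : Bool) (z : Cell X (n + 2)) : Cell X (n + 1) :=
  bd X (sqIdx n κ) ε z

theorem fin_cases_two {n : ℕ} (J : Fin (n + 2)) :
    (∃ κ, J = sqIdx n κ) ∨ ∃ j : Fin n, J = j.castSucc.castSucc := by
  induction J using Fin.lastCases with
  | last => exact Or.inl ⟨true, rfl⟩
  | cast J =>
    induction J using Fin.lastCases with
    | last => exact Or.inl ⟨false, rfl⟩
    | cast j => exact Or.inr ⟨j, rfl⟩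

/-- An `(n + 2)`-cube in the total space of a fibration, with prescribed boundary in the first `n`
coordinates and three prescribed faces in the last two coordinates. -/
theorem IsFib.fill_square {X Y : cSet.{u}} {p : X ⟶ Y} (hp : IsFib p) {n : ℕ}
    (z₀ : Cell X (n + 2)) (c : Bool → Bool → Cell X (n + 1)) (κ₀ ε₀ : Bool) (y : Cell Y (n + 2))
    (hside : ∀ κ ε, (κ, ε) ≠ (κ₀, ε₀) → SameBd (pathObj X) (n := n) (c κ ε) (sqFace X κ ε z₀))
    (hcorner : ∀ ε δ, (false, ε) ≠ (κ₀, ε₀) → (true, δ) ≠ (κ₀, ε₀) →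
      bd X (Fin.last n) ε (c true δ) = bd X (Fin.last n) δ (c false ε))
    (hyc : ∀ κ ε, (κ, ε) ≠ (κ₀, ε₀) → p.app _ (c κ ε) = sqFace Y κ ε y)
    (hys : SameBd (pathObj (pathObj Y)) (n := n) y (p.app (op (Box.mk (n + 2))) z₀)) :
    ∃ z : Cell X (n + 2), p.app (op (Box.mk (n + 2))) z = y ∧
      SameBd (pathObj (pathObj X)) (n := n) z z₀ ∧
      ∀ κ ε, (κ, ε) ≠ (κ₀, ε₀) → sqFace X κ ε z = c κ ε := by
  let F : Family X (n + 1) := fun J δ => Fin.lastCases (motive := fun _ => Cell X (n + 1))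
    (c true δ) (fun J' => Fin.lastCases (motive := fun _ => Cell X (n + 1)) (c false δ)
      (fun j => bd X j.castSucc.castSucc δ z₀) J') J
  have hFt : ∀ δ, F (Fin.last (n + 1)) δ = c true δ := fun δ => Fin.lastCases_last
  have hFs : ∀ δ, F (Fin.last n).castSucc δ = c false δ := fun δ => by
    simp only [F, Fin.lastCases_castSucc, Fin.lastCases_last]
  have hFj : ∀ (j : Fin n) δ, F j.castSucc.castSucc δ = bd X j.castSucc.castSucc δ z₀ :=
    fun j δ => by simp only [F, Fin.lastCases_castSucc]
  have hFκ : ∀ κ δ, F (sqIdx n κ) δ = c κ δ := by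
    intro κ δ; cases κ
    · exact hFs δ
    · exact hFt δ
  have hinj : ∀ {κ δ}, (κ, δ) ≠ (κ₀, ε₀) ↔ (sqIdx n κ, δ) ≠ (sqIdx n κ₀, ε₀) := by
    intro κ δ
    have h1 := (Fin.castSucc_lt_last (Fin.last n)).ne
    cases κ <;> cases κ₀ <;> simp [sqIdx, h1, h1.symm]
  have hnj : ∀ {j : Fin n} {δ}, (j.castSucc.castSucc, δ) ≠ (sqIdx n κ₀, ε₀) := by
    intro j δ h
    have h := congrArg (fun q => q.1.val) h
    have := j.isLt
    cases κ₀ <;> simp [sqIdx] at h <;> omega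
  obtain ⟨z, hz, hzf⟩ := hp (n + 1) (sqIdx n κ₀) ε₀ F y (by
    refine compat_succ _ _ _ fun i j ε δ hij hP hP' => ?_
    induction j using Fin.lastCases with
    | last =>
      rw [Fin.succ_last, hFt]
      have hP' := hinj.2 (show (sqIdx n true, δ) ≠ _ from hP')
      induction i using Fin.lastCases with
      | last =>
        rw [hFs]
        exact hcorner ε δ (hinj.2 hP) hP'
      | cast i =>
        rw [hFj, sameBd_path.1 (hside true δ hP') i ε]
        exact bd_bd X (Fin.le_last _) _ _ _
    | cast j =>
      obtain ⟨i, rfl⟩ : ∃ i' : Fin n, i'.castSucc = i :=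
        Fin.exists_castSucc_eq.2 (hij.trans_lt (Fin.castSucc_lt_last j)).ne
      rw [hFj, Fin.succ_castSucc]
      by_cases hj : j.succ = Fin.last n
      · rw [hj, hFs]
        have hP' : (sqIdx n false, δ) ≠ (sqIdx n κ₀, ε₀) := by
          rwa [Fin.succ_castSucc, hj] at hP'
        rw [sameBd_path.1 (hside false δ (hinj.2 hP')) i ε]
        change bd X _ ε (bd X (Fin.last n).castSucc δ z₀) = _
        rw [← hj, ← Fin.succ_castSucc]
        exact bd_bd X hij _ _ _
      · obtain ⟨j', hj'⟩ := Fin.exists_castSucc_eq.2 hj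
        rw [← hj', hFj, hj', ← Fin.succ_castSucc]
        exact bd_bd X hij _ _ _) (by
    intro J δ hne
    rcases fin_cases_two J with ⟨κ, rfl⟩ | ⟨j, rfl⟩
    · rw [hFκ]
      exact hyc κ δ (hinj.2 hne)
    · rw [hFj, app_bd]
      exact (sameBd_path_path.1 hys j δ).symm)
  refine ⟨z, hz, sameBd_path_path.2 fun j δ => ?_, fun κ ε hne => ?_⟩
  · rw [hzf _ _ hnj, hFj]
  · rw [sqFace, hzf _ _ (hinj.1 hne), hFκ]

/-- The one-point cubical set. -/
abbrev ptSet : cSet.{u} := (Functor.const Boxᵒᵖ).obj PUnit.{u + 1}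

/-- The map to the one-point cubical set. -/
def toPt (X : cSet.{u}) : X ⟶ ptSet.{u} where
  app _ := ↾fun _ => PUnit.unit

theorem ptSet_eq {n : ℕ} (a b : Cell ptSet.{u} n) : a = b := PUnit.ext a b

theorem IsKan.isFib {X : cSet.{u}} (hX : IsKan X) : IsFib (toPt X) := by
  intro n i ε x y hx _
  obtain ⟨z, hz⟩ := hX.fill i ε x hx
  exact ⟨z, ptSet_eq _ _, hz⟩

/-! ### Homotopies of spheres along paths -/

/-- The cube `α` has constant boundary `x`. -/
def IsLoop (X : cSet.{u}) {n : ℕ} (x : Cell X 0) (α : Cell X n) : Prop :=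
  SameBd X α (cst X n x)

theorem IsLoop.app {X Y : cSet.{u}} (p : X ⟶ Y) {n : ℕ} {x : Cell X 0} {α : Cell X n}
    (h : IsLoop X x α) : IsLoop Y (p.app (op (Box.mk 0)) x) (p.app (op (Box.mk n)) α) := by
  have := SameBd.app p h
  rwa [app_cst] at this

theorem isLoop_cst (X : cSet.{u}) (n : ℕ) (x : Cell X 0) : IsLoop X x (cst X n x) :=
  SameBd.refl _

/-- A homotopy from `α` to `β` that moves the boundary along the path `q`. -/
def HtpyAlong (X : cSet.{u}) {n : ℕ} (q : Cell (pathObj X) 0) (α β : Cell X n) : Prop :=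
  ∃ z : Cell (pathObj X) n, IsLoop (pathObj X) q z ∧ (pathEnd false X).app _ z = α ∧
    (pathEnd true X).app _ z = β

theorem HtpyAlong.isLoop_left {X : cSet.{u}} {n : ℕ} {q : Cell (pathObj X) 0} {α β : Cell X n}
    (h : HtpyAlong X q α β) : IsLoop X ((pathEnd false X).app (op (Box.mk 0)) q) α := by
  obtain ⟨z, hz, rfl, -⟩ := h
  exact hz.app _

theorem HtpyAlong.isLoop_right {X : cSet.{u}} {n : ℕ} {q : Cell (pathObj X) 0} {α β : Cell X n}
    (h : HtpyAlong X q α β) : IsLoop X ((pathEnd true X).app (op (Box.mk 0)) q) β := by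
  obtain ⟨z, hz, -, rfl⟩ := h
  exact hz.app _

/-- A homotopy from `α` to `β` that fixes the boundary `x`. -/
def HtpyRel (X : cSet.{u}) {n : ℕ} (x : Cell X 0) (α β : Cell X n) : Prop :=
  HtpyAlong X ((constPath X).app (op (Box.mk 0)) x) α β

theorem pathEnd_constPath (X : cSet.{u}) {n : ℕ} (ε : Bool) (x : Cell X n) :
    (pathEnd ε X).app _ ((constPath X).app (op (Box.mk n)) x) = x := by
  rw [pathEnd_app, constPath_app, bd_last_degen]

theorem HtpyRel.refl {X : cSet.{u}} {n : ℕ} {x : Cell X 0} {α : Cell X n} (h : IsLoop X x α) :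
    HtpyRel X x α α :=
  ⟨(constPath X).app _ α, h.app _, pathEnd_constPath X _ _, pathEnd_constPath X _ _⟩

theorem HtpyRel.isLoop_left {X : cSet.{u}} {n : ℕ} {x : Cell X 0} {α β : Cell X n}
    (h : HtpyRel X x α β) : IsLoop X x α := by
  have := HtpyAlong.isLoop_left h
  rwa [pathEnd_constPath] at this

theorem HtpyRel.isLoop_right {X : cSet.{u}} {n : ℕ} {x : Cell X 0} {α β : Cell X n}
    (h : HtpyRel X x α β) : IsLoop X x β := by
  have := HtpyAlong.isLoop_right h
  rwa [pathEnd_constPath] at this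

theorem HtpyAlong.app {X Y : cSet.{u}} (p : X ⟶ Y) {n : ℕ} {q : Cell (pathObj X) 0}
    {α β : Cell X n} (h : HtpyAlong X q α β) :
    HtpyAlong Y ((pathMap p).app (op (Box.mk 0)) q) (p.app _ α) (p.app _ β) := by
  obtain ⟨z, hz, rfl, rfl⟩ := h
  exact ⟨(pathMap p).app _ z, hz.app _, (app_bd p _ _ _).symm, (app_bd p _ _ _).symm⟩

theorem pathMap_constPath {X Y : cSet.{u}} (p : X ⟶ Y) {n : ℕ} (x : Cell X n) :
    (pathMap p).app _ ((constPath X).app (op (Box.mk n)) x) =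
      (constPath Y).app (op (Box.mk n)) (p.app (op (Box.mk n)) x) := app_act p _ x

theorem HtpyRel.app {X Y : cSet.{u}} (p : X ⟶ Y) {n : ℕ} {x : Cell X 0}
    {α β : Cell X n} (h : HtpyRel X x α β) :
    HtpyRel Y (p.app (op (Box.mk 0)) x) (p.app _ α) (p.app _ β) := by
  have := HtpyAlong.app p h
  rwa [pathMap_constPath] at this

/-- Transport of a sphere along a path. -/
theorem IsKan.exists_htpyAlong {X : cSet.{u}} (hX : IsKan X) {n : ℕ} (q : Cell (pathObj X) 0)
    (α : Cell X n) (hα : IsLoop X ((pathEnd false X).app (op (Box.mk 0)) q) α) :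
    ∃ β, HtpyAlong X q α β := by
  obtain ⟨z, -, hz, he⟩ := hX.isFib.fill_end (cst (pathObj X) n q) false α
    (by rw [app_cst]; exact hα) PUnit.unit (fun _ _ _ => ptSet_eq _ _) (ptSet_eq _ _)
  exact ⟨_, z, hz, he, rfl⟩

theorem IsKan.exists_htpyAlong' {X : cSet.{u}} (hX : IsKan X) {n : ℕ} (q : Cell (pathObj X) 0)
    (β : Cell X n) (hβ : IsLoop X ((pathEnd true X).app (op (Box.mk 0)) q) β) :
    ∃ α, HtpyAlong X q α β := by
  obtain ⟨z, -, hz, he⟩ := hX.isFib.fill_end (cst (pathObj X) n q) true β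
    (by rw [app_cst]; exact hβ) PUnit.unit (fun _ _ _ => ptSet_eq _ _) (ptSet_eq _ _)
  exact ⟨_, z, hz, rfl, he⟩

/-! ### Squares of paths -/

/-- Restriction of squares of paths to one of their four sides. -/
def sideMap (X : cSet.{u}) (κ ε : Bool) : pathObj (pathObj X) ⟶ pathObj X :=
  if κ then pathMap (pathEnd ε X) else pathEnd ε (pathObj X)

theorem sideMap_app (X : cSet.{u}) {n : ℕ} (κ ε : Bool) (z : Cell (pathObj (pathObj X)) n) :
    (sideMap X κ ε).app (op (Box.mk n)) z = sqFace X κ ε (z : Cell X (n + 2)) := by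
  cases κ
  · exact bd_pathObj X (Fin.last n) ε z
  · rfl

theorem bd_last_sqFace (X : cSet.{u}) {n : ℕ} (κ ε δ : Bool) (z : Cell X (n + 2)) :
    bd X (Fin.last n) δ (sqFace X κ ε z) = bd X (Fin.last n) ε (sqFace X (!κ) δ z) := by
  cases κ
  · exact (bd_bd X (le_refl (Fin.last n)) ε δ z).symm
  · exact bd_bd X (le_refl (Fin.last n)) δ ε z

/-- The corners of a square, listed along its sides. -/
def corner {α : Type*} (a : Bool → Bool → α) (κ ε δ : Bool) : α := if κ then a δ ε else a ε δ

theorem corner_swap {α : Type*} (a : Bool → Bool → α) (κ ε δ : Bool) :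
    corner a κ ε δ = corner a (!κ) δ ε := by cases κ <;> rfl

/-- Homotopies along three sides of a square of paths yield a homotopy along the fourth side. -/
theorem IsKan.htpyAlong_square {X : cSet.{u}} (hX : IsKan X) {n : ℕ}
    (σ : Cell (pathObj (pathObj X)) 0) (a : Bool → Bool → Cell X n) (κ₀ ε₀ : Bool)
    (h : ∀ κ ε, (κ, ε) ≠ (κ₀, ε₀) → HtpyAlong X ((sideMap X κ ε).app (op (Box.mk 0)) σ)
      (corner a κ ε false) (corner a κ ε true)) :
    HtpyAlong X ((sideMap X κ₀ ε₀).app (op (Box.mk 0)) σ)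
      (corner a κ₀ ε₀ false) (corner a κ₀ ε₀ true) := by
  classical
  let z₀ : Cell (pathObj (pathObj X)) n := cst (pathObj (pathObj X)) n σ
  have hz₀ : ∀ κ ε, cst (pathObj X) n ((sideMap X κ ε).app (op (Box.mk 0)) σ) =
      sqFace X κ ε (z₀ : Cell X (n + 2)) := fun κ ε =>
    (app_cst (sideMap X κ ε) n σ).symm.trans (sideMap_app X κ ε z₀)
  have h' : ∀ κ ε, ∃ z : Cell X (n + 1), (κ, ε) ≠ (κ₀, ε₀) →
      SameBd (pathObj X) (n := n) z (sqFace X κ ε (z₀ : Cell X (n + 2))) ∧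
      ∀ δ, bd X (Fin.last n) δ z = corner a κ ε δ := by
    intro κ ε
    by_cases hne : (κ, ε) ≠ (κ₀, ε₀)
    · obtain ⟨z, hz, h0, h1⟩ := h κ ε hne
      refine ⟨z, fun _ => ⟨?_, ?_⟩⟩
      · rw [← hz₀]; exact hz
      · rintro (_ | _)
        · exact h0
        · exact h1
    · exact ⟨sqFace X κ ε (z₀ : Cell X (n + 2)), fun h => absurd h hne⟩
  choose c hc using h'
  obtain ⟨z, -, hz, hzf⟩ := hX.isFib.fill_square (z₀ : Cell X (n + 2)) c κ₀ ε₀ PUnit.unit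
    (fun κ ε hne => (hc κ ε hne).1)
    (fun ε δ hs ht => by rw [(hc _ _ ht).2, (hc _ _ hs).2]; rfl)
    (fun _ _ _ => ptSet_eq _ _) (fun _ _ _ => ptSet_eq _ _)
  have hend : ∀ δ, bd X (Fin.last n) δ (sqFace X κ₀ ε₀ z) = corner a κ₀ ε₀ δ := by
    intro δ
    have hne : (!κ₀, δ) ≠ (κ₀, ε₀) := fun h => by
      have := congrArg Prod.fst h
      cases κ₀ <;> cases this
    rw [bd_last_sqFace, hzf _ _ hne, (hc _ _ hne).2, corner_swap a κ₀]
  refine ⟨sqFace X κ₀ ε₀ z, fun k f hf => ?_, hend false, hend true⟩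
  have h1 := SameBd.app (sideMap X κ₀ ε₀) hz f hf
  exact (congrArg _ (sideMap_app X κ₀ ε₀ (n := n) z).symm).trans
    (h1.trans (congrArg _ ((sideMap_app X κ₀ ε₀ z₀).trans (hz₀ κ₀ ε₀).symm)))

theorem sideMap_constPath (X : cSet.{u}) (ε : Bool) (q : Cell (pathObj X) 0) :
    (sideMap X false ε).app (op (Box.mk 0)) ((constPath (pathObj X)).app (op (Box.mk 0)) q) = q :=
  pathEnd_constPath (pathObj X) ε q

theorem sideMap_constPath' (X : cSet.{u}) (ε : Bool) (q : Cell (pathObj X) 0) :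
    (sideMap X true ε).app (op (Box.mk 0)) ((constPath (pathObj X)).app (op (Box.mk 0)) q) =
      (constPath X).app (op (Box.mk 0)) ((pathEnd ε X).app (op (Box.mk 0)) q) :=
  pathMap_constPath (pathEnd ε X) q

namespace HtpyAlong

variable {X : cSet.{u}} {n : ℕ} {q : Cell (pathObj X) 0} {α α' β β' : Cell X n}

theorem congr (hX : IsKan X) (h : HtpyAlong X q α β)
    (hα : HtpyRel X ((pathEnd false X).app (op (Box.mk 0)) q) α α')
    (hβ : HtpyRel X ((pathEnd true X).app (op (Box.mk 0)) q) β β') : HtpyAlong X q α' β' := by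
  have := hX.htpyAlong_square ((constPath (pathObj X)).app (op (Box.mk 0)) q)
    (fun s t => if s then (if t then β' else α') else (if t then β else α)) false true (by
      rintro (_ | _) (_ | _) hne
      · rw [sideMap_constPath]; exact h
      · exact absurd rfl hne
      · rw [sideMap_constPath']; exact hα
      · rw [sideMap_constPath']; exact hβ)
  rwa [sideMap_constPath] at this

theorem rel_right (hX : IsKan X) (h : HtpyAlong X q α β) (h' : HtpyAlong X q α' β')
    (hα : HtpyRel X ((pathEnd false X).app (op (Box.mk 0)) q) α α') :
    HtpyRel X ((pathEnd true X).app (op (Box.mk 0)) q) β β' := by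
  have := hX.htpyAlong_square ((constPath (pathObj X)).app (op (Box.mk 0)) q)
    (fun s t => if s then (if t then β' else α') else (if t then β else α)) true true (by
      rintro (_ | _) (_ | _) hne
      · rw [sideMap_constPath]; exact h
      · rw [sideMap_constPath]; exact h'
      · rw [sideMap_constPath']; exact hα
      · exact absurd rfl hne)
  rwa [sideMap_constPath'] at this

theorem rel_left (hX : IsKan X) (h : HtpyAlong X q α β) (h' : HtpyAlong X q α' β')
    (hβ : HtpyRel X ((pathEnd true X).app (op (Box.mk 0)) q) β β') :
    HtpyRel X ((pathEnd false X).app (op (Box.mk 0)) q) α α' := by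
  have := hX.htpyAlong_square ((constPath (pathObj X)).app (op (Box.mk 0)) q)
    (fun s t => if s then (if t then β' else α') else (if t then β else α)) true false (by
      rintro (_ | _) (_ | _) hne
      · rw [sideMap_constPath]; exact h
      · rw [sideMap_constPath]; exact h'
      · exact absurd rfl hne
      · rw [sideMap_constPath']; exact hβ)
  rwa [sideMap_constPath'] at this

end HtpyAlong

theorem HtpyRel.symm {X : cSet.{u}} (hX : IsKan X) {n : ℕ} {x : Cell X 0} {α β : Cell X n}
    (h : HtpyRel X x α β) : HtpyRel X x β α := by
  have := HtpyAlong.rel_right hX h (HtpyRel.refl h.isLoop_left)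
    (by rw [pathEnd_constPath]; exact HtpyRel.refl h.isLoop_left)
  rwa [pathEnd_constPath] at this

theorem HtpyRel.trans {X : cSet.{u}} (hX : IsKan X) {n : ℕ} {x : Cell X 0} {α β γ : Cell X n}
    (h : HtpyRel X x α β) (h' : HtpyRel X x β γ) : HtpyRel X x α γ :=
  HtpyAlong.congr hX h (by rw [pathEnd_constPath]; exact HtpyRel.refl h.isLoop_left)
    (by rw [pathEnd_constPath]; exact h')

/-! ### Homotopy groups in terms of cubes with constant boundary -/

/-- The quotient map from the standard cube to the sphere. -/
def sphInl (n : ℕ) : stdCube.{u} n ⟶ (sphere.{u} n).X := pushout.inl _ _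

/-- The base point of the sphere as a map. -/
def sphInr (n : ℕ) : ptSet.{u} ⟶ (sphere.{u} n).X := pushout.inr _ _

theorem sphere_condition (n : ℕ) :
    (boundary.{u} n).ι ≫ sphInl n = toPt (boundary.{u} n).toFunctor ≫ sphInr n :=
  pushout.condition

/-- The fundamental cube of the sphere. -/
def sphCell (n : ℕ) : Cell (sphere.{u} n).X n := (sphInl n).app (op (Box.mk n)) (stdElt (𝟙 _))

theorem isFace_mem_boundary {k n : ℕ} {f : Box.mk k ⟶ Box.mk n} (hf : Box.IsFace f) :
    stdElt.{u} f ∈ (boundary.{u} n).obj (op (Box.mk k)) := by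
  obtain ⟨i, ε⟩ := hf
  simp only [boundary, Subfunctor.iSup_obj, Set.mem_iUnion, faceSub, Subfunctor.range_obj,
    Set.mem_range]
  exact ⟨i, ε, stdElt (𝟙 _), rfl⟩

theorem mem_boundary {m n : ℕ} {v : Box.mk m ⟶ Box.mk n}
    (hv : stdElt.{u} v ∈ (boundary.{u} n).obj (op (Box.mk m))) :
    ∃ (k : ℕ) (w : Box.mk m ⟶ Box.mk k) (f : Box.mk k ⟶ Box.mk n), Box.IsFace f ∧ w ≫ f = v := by
  cases n with
  | zero => exact hv.elim
  | succ n =>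
    simp only [boundary, Subfunctor.iSup_obj, Set.mem_iUnion, faceSub, Subfunctor.range_obj,
      Set.mem_range] at hv
    obtain ⟨i, ε, w, hw⟩ := hv
    exact ⟨n, w.down, Box.face i ε, ⟨i, ε⟩, congrArg ULift.down hw⟩

theorem app_of_congr {X Y : cSet.{u}} {f g : X ⟶ Y} (h : f = g) {n : ℕ} (x : Cell X n) :
    f.app (op (Box.mk n)) x = g.app (op (Box.mk n)) x := by rw [h]

theorem app_ptSet {X : cSet.{u}} (f : ptSet.{u} ⟶ X) (n : ℕ) (a : Cell ptSet.{u} n)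
    (b : Cell ptSet.{u} 0) :
    f.app (op (Box.mk n)) a = cst X n (f.app (op (Box.mk 0)) b) :=
  app_act f (Box.bang n) b

theorem sphere_glue {m n : ℕ} (u : Cell (boundary.{u} n).toFunctor m) :
    (sphInl n).app (op (Box.mk m)) u.1 = cst (sphere.{u} n).X m (sphere.{u} n).pt :=
  (app_of_congr (sphere_condition n) u).trans (app_ptSet (sphInr n) m PUnit.unit PUnit.unit)

theorem isLoop_sphCell (n : ℕ) : IsLoop (sphere.{u} n).X (sphere.{u} n).pt (sphCell n) := by
  intro k f hf
  rw [act_cst, ← sphere_glue ⟨stdElt f, isFace_mem_boundary hf⟩, sphCell]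
  exact (app_act (sphInl n) f (stdElt (𝟙 _))).symm

theorem sphere_hom_ext {X : cSet.{u}} {n : ℕ} {f g : (sphere.{u} n).X ⟶ X}
    (h : f.app (op (Box.mk n)) (sphCell n) = g.app (op (Box.mk n)) (sphCell n))
    (hpt : f.app (op (Box.mk 0)) (sphere.{u} n).pt = g.app (op (Box.mk 0)) (sphere.{u} n).pt) :
    f = g := by
  have h1 : sphInl n ≫ f = sphInl n ≫ g := by
    ext a v
    have h1 : ∀ f : (sphere.{u} n).X ⟶ X, (sphInl n ≫ f).app a v =
        act X v.down (f.app (op (Box.mk n)) (sphCell n)) := fun f =>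
      app_act (sphInl n ≫ f) v.down (stdElt (𝟙 _))
    exact (h1 f).trans ((congrArg _ h).trans (h1 g).symm)
  have h2 : sphInr n ≫ f = sphInr n ≫ g := by
    ext a v
    have h1 : ∀ f : (sphere.{u} n).X ⟶ X, (sphInr n ≫ f).app a v =
        cst X a.unop.dim (f.app (op (Box.mk 0)) (sphere.{u} n).pt) := fun f =>
      app_ptSet (sphInr n ≫ f) a.unop.dim PUnit.unit PUnit.unit
    exact (h1 f).trans ((congrArg _ hpt).trans (h1 g).symm)
  exact pushout.hom_ext h1 h2

/-- The sphere is the cube with its boundary collapsed, so that cubes with constant boundary extend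
to pointed maps. -/
theorem exists_sphere_hom {X : cSet.{u}} {n : ℕ} {x : Cell X 0} {α : Cell X n}
    (h : IsLoop X x α) : ∃ f : (sphere.{u} n).X ⟶ X,
      f.app (op (Box.mk n)) (sphCell n) = α ∧
      f.app (op (Box.mk 0)) (sphere.{u} n).pt = x := by
  let F : stdCube.{u} n ⟶ X :=
    { app := fun a => ↾fun v => act X v.down α
      naturality := fun a b g => by
        ext v
        change act X (g.unop ≫ v.down) α = act X g.unop (act X v.down α)
        rw [act_act] }
  let G : ptSet.{u} ⟶ X :=
    { app := fun a => ↾fun _ => cst X a.unop.dim x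
      naturality := fun a b g => by
        ext v
        exact (act_cst X g.unop x).symm }
  have hFG : (boundary.{u} n).ι ≫ F = toPt (boundary.{u} n).toFunctor ≫ G := by
    ext a v
    obtain ⟨k, w, f, hf, hw⟩ := mem_boundary (v := v.1.down) v.2
    change act X v.1.down α = cst X a.unop.dim x
    refine (congrArg (fun t => act X t α) hw.symm).trans ?_
    rw [← act_act, h f hf, act_cst, act_cst]
  have hl : sphInl n ≫ (pushout.desc F G hFG : (sphere.{u} n).X ⟶ X) = F :=
    pushout.inl_desc F G hFG
  have hr : sphInr n ≫ (pushout.desc F G hFG : (sphere.{u} n).X ⟶ X) = G :=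
    pushout.inr_desc F G hFG
  exact ⟨pushout.desc F G hFG, (app_of_congr hl (stdElt (𝟙 _))).trans (act_id X α),
    (app_of_congr hr (n := 0) PUnit.unit).trans (cst_zero X x)⟩

/-- The pointed map out of the sphere with a given value on the fundamental cube. -/
def sphHom (X : PcSet.{u}) {n : ℕ} {α : Cell X.X n} (h : IsLoop X.X X.pt α) : sphere.{u} n ⟶ X :=
  ⟨(exists_sphere_hom h).choose, (exists_sphere_hom h).choose_spec.2⟩

theorem sphHom_sphCell (X : PcSet.{u}) {n : ℕ} {α : Cell X.X n} (h : IsLoop X.X X.pt α) :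
    (sphHom X h).hom.app (op (Box.mk n)) (sphCell n) = α :=
  (exists_sphere_hom h).choose_spec.1

theorem sphere_phom_ext {X : PcSet.{u}} {n : ℕ} {f g : sphere.{u} n ⟶ X}
    (h : f.hom.app (op (Box.mk n)) (sphCell n) = g.hom.app (op (Box.mk n)) (sphCell n)) :
    f = g :=
  PcSet.Hom.ext (sphere_hom_ext h (f.map_pt.trans g.map_pt.symm))

/-- The class of a cube with constant boundary in the homotopy group. -/
def piMk (X : PcSet.{u}) {n : ℕ} (α : Cell X.X n) (h : IsLoop X.X X.pt α) :
    (cubicalPi n).obj X := Quot.mk _ (sphHom X h)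

theorem isLoop_of_hom {X : PcSet.{u}} {n : ℕ} (f : sphere.{u} n ⟶ X) :
    IsLoop X.X X.pt (f.hom.app (op (Box.mk n)) (sphCell n)) := by
  have := (isLoop_sphCell n).app f.hom
  rwa [f.map_pt] at this

theorem piMk_surjective {X : PcSet.{u}} {n : ℕ} (c : (cubicalPi n).obj X) :
    ∃ α h, c = piMk X (n := n) α h := by
  obtain ⟨f⟩ := c
  exact ⟨_, isLoop_of_hom f, congrArg (Quot.mk _) (sphere_phom_ext (sphHom_sphCell _ _).symm)⟩

theorem cubicalPi_map_piMk {X Y : PcSet.{u}} (p : X ⟶ Y) {n : ℕ} {α : Cell X.X n}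
    (h : IsLoop X.X X.pt α) (h' : IsLoop Y.X Y.pt (p.hom.app _ α)) :
    (cubicalPi n).map p (piMk X α h) = piMk Y (p.hom.app (op (Box.mk n)) α) h' := by
  refine congrArg (Quot.mk _) (sphere_phom_ext ?_)
  rw [sphHom_sphCell]
  exact congrArg _ (sphHom_sphCell X h)

theorem piMk_eq_of_htpyRel {X : PcSet.{u}} {n : ℕ} {α β : Cell X.X n}
    (hα : IsLoop X.X X.pt α) (hβ : IsLoop X.X X.pt β) (h : HtpyRel X.X X.pt α β) :
    piMk X α hα = piMk X β hβ := by
  obtain ⟨z, hz, h0, h1⟩ := h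
  obtain ⟨F, hF, hpt⟩ := exists_sphere_hom hz
  have hend : ∀ ε, (F ≫ pathEnd ε X.X).app (op (Box.mk 0)) (sphere.{u} n).pt = X.pt := fun ε =>
    (congrArg _ hpt).trans (pathEnd_constPath X.X ε X.pt)
  refine Quot.sound ⟨⟨⟨F, ?_, ?_⟩, hpt⟩⟩
  · refine sphere_hom_ext ?_ ((hend false).trans (sphHom X hα).map_pt.symm)
    rw [sphHom_sphCell, ← h0, ← hF]; rfl
  · refine sphere_hom_ext ?_ ((hend true).trans (sphHom X hβ).map_pt.symm)
    rw [sphHom_sphCell, ← h1, ← hF]; rfl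

theorem piMk_eq_iff {X : PcSet.{u}} (hX : IsKan X.X) {n : ℕ} {α β : Cell X.X n}
    (hα : IsLoop X.X X.pt α) (hβ : IsLoop X.X X.pt β) :
    piMk X α hα = piMk X β hβ ↔ HtpyRel X.X X.pt α β := by
  refine ⟨fun h => ?_, piMk_eq_of_htpyRel hα hβ⟩
  have key : ∀ f g : sphere.{u} n ⟶ X,
      Relation.EqvGen (fun f g : sphere.{u} n ⟶ X => Nonempty (PcSet.Htpy f g)) f g →
      HtpyRel X.X X.pt (f.hom.app (op (Box.mk n)) (sphCell n))
        (g.hom.app (op (Box.mk n)) (sphCell n)) := by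
    intro f g hfg
    induction hfg with
    | rel f g h =>
      obtain ⟨H⟩ := h
      refine ⟨H.hom.app (op (Box.mk n)) (sphCell n), ?_, ?_, ?_⟩
      · have h1 := (isLoop_sphCell n).app H.hom
        rw [show H.hom.app (op (Box.mk 0)) (sphere.{u} n).pt = _ from H.base] at h1
        exact h1
      · exact app_of_congr H.left (sphCell n)
      · exact app_of_congr H.right (sphCell n)
    | refl f => exact HtpyRel.refl (isLoop_of_hom f)
    | symm f g _ h => exact h.symm hX
    | trans f g k _ _ h h' => exact h.trans hX h'
  have := key _ _ (Quot.eqvGen_exact h)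
  rwa [sphHom_sphCell, sphHom_sphCell] at this

/-- The map of homotopy groups induced by `f` at the base point `x` is bijective, in terms of
cubes with constant boundary. -/
def PiBij {X Y : cSet.{u}} (f : X ⟶ Y) (n : ℕ) (x : Cell X 0) : Prop :=
  (∀ α β : Cell X n, IsLoop X x α → IsLoop X x β →
    HtpyRel Y (f.app (op (Box.mk 0)) x) (f.app (op (Box.mk n)) α) (f.app (op (Box.mk n)) β) →
    HtpyRel X x α β) ∧
  ∀ β : Cell Y n, IsLoop Y (f.app (op (Box.mk 0)) x) β →
    ∃ α : Cell X n, IsLoop X x α ∧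
      HtpyRel Y (f.app (op (Box.mk 0)) x) (f.app (op (Box.mk n)) α) β

theorem isIso_cubicalPi_map_iff {X Y : PcSet.{u}} (hX : IsKan X.X) (hY : IsKan Y.X) (p : X ⟶ Y)
    (n : ℕ) : IsIso ((cubicalPi n).map p) ↔ PiBij p.hom n X.pt := by
  have hloop : ∀ {α : Cell X.X n}, IsLoop X.X X.pt α →
      IsLoop Y.X Y.pt (p.hom.app (op (Box.mk n)) α) := fun h => by
    have := h.app p.hom
    rwa [p.map_pt] at this
  have hpt : p.hom.app (op (Box.mk 0)) X.pt = Y.pt := p.map_pt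
  rw [isIso_iff_bijective, PiBij, hpt]
  constructor
  · rintro ⟨hi, hs⟩
    refine ⟨fun α β hα hβ h => (piMk_eq_iff hX hα hβ).1 (hi ?_), fun β hβ => ?_⟩
    · rw [cubicalPi_map_piMk p hα (hloop hα), cubicalPi_map_piMk p hβ (hloop hβ),
        piMk_eq_iff hY]
      exact h
    · obtain ⟨c, hc⟩ := hs (piMk Y β hβ)
      obtain ⟨α, hα, rfl⟩ := piMk_surjective c
      rw [cubicalPi_map_piMk p hα (hloop hα), piMk_eq_iff hY] at hc
      exact ⟨α, hα, hc⟩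
  · rintro ⟨hi, hs⟩
    constructor
    · intro c d h
      obtain ⟨α, hα, rfl⟩ := piMk_surjective c
      obtain ⟨β, hβ, rfl⟩ := piMk_surjective d
      rw [cubicalPi_map_piMk p hα (hloop hα), cubicalPi_map_piMk p hβ (hloop hβ),
        piMk_eq_iff hY] at h
      exact (piMk_eq_iff hX hα hβ).2 (hi α β hα hβ h)
    · intro d
      obtain ⟨β, hβ, rfl⟩ := piMk_surjective d
      obtain ⟨α, hα, h⟩ := hs β hβ
      refine ⟨piMk X α hα, ?_⟩
      rw [cubicalPi_map_piMk p hα (hloop hα), piMk_eq_iff hY]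
      exact h

/-! ### Bijections on homotopy groups and homotopies -/

theorem piBij_iff_of_htpyAlong {X Y : cSet.{u}} (hY : IsKan Y) {f g : X ⟶ Y} {n : ℕ}
    {x : Cell X 0} {q : Cell (pathObj Y) 0}
    (h0 : (pathEnd false Y).app (op (Box.mk 0)) q = f.app (op (Box.mk 0)) x)
    (h1 : (pathEnd true Y).app (op (Box.mk 0)) q = g.app (op (Box.mk 0)) x)
    (h : ∀ α : Cell X n, IsLoop X x α →
      HtpyAlong Y q (f.app (op (Box.mk n)) α) (g.app (op (Box.mk n)) α)) :
    PiBij f n x ↔ PiBij g n x := by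
  rw [PiBij, PiBij, ← h0, ← h1]
  constructor
  · rintro ⟨hi, hs⟩
    refine ⟨fun α β hα hβ hαβ => hi α β hα hβ ((h α hα).rel_left hY (h β hβ) hαβ), fun β hβ => ?_⟩
    obtain ⟨γ, hγ⟩ := hY.exists_htpyAlong' q β hβ
    obtain ⟨α, hα, hαγ⟩ := hs γ hγ.isLoop_left
    exact ⟨α, hα, (h α hα).rel_right hY hγ hαγ⟩
  · rintro ⟨hi, hs⟩
    refine ⟨fun α β hα hβ hαβ => hi α β hα hβ ((h α hα).rel_right hY (h β hβ) hαβ), fun β hβ => ?_⟩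
    obtain ⟨γ, hγ⟩ := hY.exists_htpyAlong q β hβ
    obtain ⟨α, hα, hαγ⟩ := hs γ hγ.isLoop_right
    exact ⟨α, hα, (h α hα).rel_left hY hγ hαγ⟩

theorem Htpy.piBij_iff {X Y : cSet.{u}} (hY : IsKan Y) {f g : X ⟶ Y} (H : Htpy f g) (n : ℕ)
    (x : Cell X 0) : PiBij f n x ↔ PiBij g n x :=
  piBij_iff_of_htpyAlong hY (q := H.hom.app (op (Box.mk 0)) x) (app_of_congr H.left x)
    (app_of_congr H.right x) fun α hα =>
    ⟨H.hom.app (op (Box.mk n)) α, hα.app H.hom, app_of_congr H.left α, app_of_congr H.right α⟩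

theorem piBij_iff_of_eqvGen {X Y : cSet.{u}} (hY : IsKan Y) {f g : X ⟶ Y}
    (h : Relation.EqvGen (fun f g : X ⟶ Y => Nonempty (Htpy f g)) f g) (n : ℕ) (x : Cell X 0) :
    PiBij f n x ↔ PiBij g n x := by
  induction h with
  | rel f g h => exact h.some.piBij_iff hY n x
  | refl f => exact Iff.rfl
  | symm f g _ h => exact h.symm
  | trans f g k _ _ h h' => exact h.trans h'

theorem piBij_id {X : cSet.{u}} (n : ℕ) (x : Cell X 0) : PiBij (𝟙 X) n x :=
  ⟨fun _ _ _ _ h => h, fun β hβ => ⟨β, hβ, HtpyRel.refl hβ⟩⟩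

theorem PiBij.comp {X Y Z : cSet.{u}} (hZ : IsKan Z) {f : X ⟶ Y} {g : Y ⟶ Z} {n : ℕ}
    {x : Cell X 0} (hf : PiBij f n x) (hg : PiBij g n (f.app (op (Box.mk 0)) x)) :
    PiBij (f ≫ g) n x := by
  refine ⟨fun α β hα hβ h => hf.1 α β hα hβ (hg.1 _ _ (hα.app f) (hβ.app f) h), fun γ hγ => ?_⟩
  obtain ⟨β, hβ, h⟩ := hg.2 γ hγ
  obtain ⟨α, hα, h'⟩ := hf.2 β hβ
  exact ⟨α, hα, (h'.app g).trans hZ h⟩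

/-- If `f ≫ g` and `g ≫ f` are bijective on homotopy groups, then so is `f`. -/
theorem PiBij.of_comp_comp {X Y : cSet.{u}} {f : X ⟶ Y} {g : Y ⟶ X} {n : ℕ}
    {x : Cell X 0} (hfg : PiBij (f ≫ g) n x) (hgf : PiBij (g ≫ f) n (f.app (op (Box.mk 0)) x)) :
    PiBij f n x := by
  refine ⟨fun α β hα hβ h => hfg.1 α β hα hβ (h.app g), fun β hβ => ?_⟩
  obtain ⟨α, hα, h⟩ := hfg.2 (g.app _ β) (hβ.app g)
  exact ⟨α, hα, hgf.1 _ _ (hα.app f) hβ (h.app f)⟩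

theorem Htpy.postcomp {A X Y : cSet.{u}} {f g : A ⟶ X} (H : Htpy f g) (p : X ⟶ Y) :
    Nonempty (Htpy (f ≫ p) (g ≫ p)) :=
  ⟨⟨H.hom ≫ pathMap p, by rw [Category.assoc, pathMap_pathEnd, ← Category.assoc, H.left], by
    rw [Category.assoc, pathMap_pathEnd, ← Category.assoc, H.right]⟩⟩

/-- Composition with a map, on homotopy classes. -/
def HtpyClasses.postcomp (A : cSet.{u}) {X Y : cSet.{u}} (p : X ⟶ Y) :
    HtpyClasses A X → HtpyClasses A Y :=
  Quot.map (fun f => f ≫ p) fun _ _ ⟨H⟩ => H.postcomp p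

/-- A weak equivalence of Kan complexes is bijective on homotopy groups. -/
theorem IsWeakEquiv.piBij {X Y : cSet.{u}} (hX : IsKan X) (hY : IsKan Y) {f : X ⟶ Y}
    (hf : IsWeakEquiv f) (n : ℕ) (x : Cell X 0) : PiBij f n x := by
  obtain ⟨⟨g⟩, hg⟩ := (hf X hX).2 (Quot.mk _ (𝟙 X))
  have h1 : Relation.EqvGen (fun f g : X ⟶ X => Nonempty (Htpy f g)) (f ≫ g) (𝟙 X) :=
    Quot.eqvGen_exact hg
  have h2 : Relation.EqvGen (fun f g : Y ⟶ Y => Nonempty (Htpy f g)) (g ≫ f) (𝟙 Y) := by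
    refine Quot.eqvGen_exact ((hf Y hY).1 ?_)
    have h := congrArg (HtpyClasses.postcomp X f) hg
    change (Quot.mk _ ((f ≫ g) ≫ f) : HtpyClasses X Y) = Quot.mk _ (𝟙 X ≫ f) at h
    change (Quot.mk _ (f ≫ g ≫ f) : HtpyClasses X Y) = Quot.mk _ (f ≫ 𝟙 Y)
    rwa [Category.assoc, Category.id_comp, ← Category.comp_id f] at h
  exact PiBij.of_comp_comp ((piBij_iff_of_eqvGen hX h1 n x).2 (piBij_id n x))
    ((piBij_iff_of_eqvGen hY h2 n _).2 (piBij_id n _))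

/-! ### Formal properties of weak equivalences -/

theorem HtpyClasses.precomp_comp {A B C : cSet.{u}} (f : A ⟶ B) (g : B ⟶ C) (K : cSet.{u}) :
    HtpyClasses.precomp (f ≫ g) K = HtpyClasses.precomp f K ∘ HtpyClasses.precomp g K := by
  funext h
  obtain ⟨h⟩ := h
  exact congrArg (Quot.mk _) (Category.assoc f g h)

theorem HtpyClasses.precomp_id (A K : cSet.{u}) : HtpyClasses.precomp (𝟙 A) K = id := by
  funext h
  obtain ⟨h⟩ := h
  exact congrArg (Quot.mk _) (Category.id_comp h)

theorem IsWeakEquiv.comp_iff_right {A B C : cSet.{u}} {f : A ⟶ B} (hf : IsWeakEquiv f)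
    (g : B ⟶ C) : IsWeakEquiv (f ≫ g) ↔ IsWeakEquiv g := by
  refine forall₂_congr fun K hK => ?_
  rw [HtpyClasses.precomp_comp]
  exact Function.Bijective.of_comp_iff' (hf K hK) _

theorem IsWeakEquiv.comp_iff_left {A B C : cSet.{u}} {g : B ⟶ C} (hg : IsWeakEquiv g)
    (f : A ⟶ B) : IsWeakEquiv (f ≫ g) ↔ IsWeakEquiv f := by
  refine forall₂_congr fun K hK => ?_
  rw [HtpyClasses.precomp_comp]
  exact Function.Bijective.of_comp_iff _ (hg K hK)

theorem Htpy.precomp_eq {A B : cSet.{u}} {f g : A ⟶ B} (H : Htpy f g) (K : cSet.{u}) :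
    HtpyClasses.precomp f K = HtpyClasses.precomp g K := by
  funext k
  obtain ⟨k⟩ := k
  exact Quot.sound (H.postcomp k)

theorem Htpy.isWeakEquiv_iff {A B : cSet.{u}} {f g : A ⟶ B} (H : Htpy f g) :
    IsWeakEquiv f ↔ IsWeakEquiv g :=
  forall₂_congr fun K _ => by rw [H.precomp_eq K]

/-! ### Cubes of paths with prescribed faces and ends -/

/-- The faces of a cube of paths together with its ends. -/
def pathFamily {X : cSet.{u}} {n : ℕ} (x : Family (pathObj X) n) (α : Bool → Cell X (n + 1)) :
    Family X (n + 1) := fun J δ =>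
  Fin.lastCases (motive := fun _ => Cell X (n + 1)) (α δ) (fun j => (x j δ : Cell X (n + 1))) J

theorem pathFamily_last {X : cSet.{u}} {n : ℕ} (x : Family (pathObj X) n)
    (α : Bool → Cell X (n + 1)) (δ : Bool) : pathFamily x α (Fin.last (n + 1)) δ = α δ :=
  Fin.lastCases_last

theorem pathFamily_castSucc {X : cSet.{u}} {n : ℕ} (x : Family (pathObj X) n)
    (α : Bool → Cell X (n + 1)) (j : Fin (n + 1)) (δ : Bool) :
    pathFamily x α j.castSucc δ = (x j δ : Cell X (n + 1)) := Fin.lastCases_castSucc _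

theorem compat_pathFamily {X : cSet.{u}} {n : ℕ} (P : Fin (n + 2) → Bool → Prop)
    (x : Family (pathObj X) n) (hx : Compat (pathObj X) (fun j δ => P j.castSucc δ) x)
    (α : Bool → Cell X (n + 1))
    (h : ∀ j δ ε, P j.castSucc δ → P (Fin.last (n + 1)) ε →
      bd X j δ (α ε) = (pathEnd ε X).app (op (Box.mk n)) (x j δ)) :
    Compat X P (pathFamily x α) := by
  refine compat_succ _ _ _ fun i j ε δ hij hi hj => ?_
  induction j using Fin.lastCases with
  | last =>
    rw [Fin.succ_last, pathFamily_last, pathFamily_castSucc]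
    exact h i ε δ hi hj
  | cast j =>
    obtain ⟨n, rfl⟩ : ∃ m, n = m + 1 := ⟨n - 1, by have := j.isLt; omega⟩
    obtain ⟨i, rfl⟩ : ∃ i' : Fin (n + 1), i'.castSucc = i :=
      Fin.exists_castSucc_eq.2 (hij.trans_lt (Fin.castSucc_lt_last j)).ne
    rw [Fin.succ_castSucc, pathFamily_castSucc, pathFamily_castSucc]
    have := hx.bd_eq (i := i) (j := j) (ε := ε) (δ := δ) hij hi hj
    exact (bd_pathObj X i ε _).symm.trans (this.trans (bd_pathObj X j δ _))

/-! ### Trivial fibrations -/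

/-- The partial map with empty domain. -/
def PartialMap.empty (B X : cSet.{u}) (R : ∀ n, Cell B n → Cell X n → Prop) :
    PartialMap B X R where
  rel _ _ _ := False
  func h := h.elim
  act_mem _ h := h.elim
  sub h := h.elim

theorem IsTrivFib.exists_section {X Y : cSet.{u}} {q : X ⟶ Y} (hq : IsTrivFib q) :
    ∃ σ : Y ⟶ X, σ ≫ q = 𝟙 Y := by
  obtain ⟨σ, -, h⟩ := exists_hom_of_boundary (B := Y) (X := X)
    (R := fun n y x => q.app (op (Box.mk n)) x = y)
    (fun a h => by rw [app_act, h]) hq.zero (fun n b x hx h => hq.succ n x b hx h)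
    (PartialMap.empty _ _ _)
  refine ⟨σ, ?_⟩
  ext a y
  exact h a.unop.dim y

theorem IsTrivFib.exists_htpy {X Y : cSet.{u}} {q : X ⟶ Y} (hq : IsTrivFib q) {σ : Y ⟶ X}
    (hσ : σ ≫ q = 𝟙 Y) : Nonempty (Htpy (q ≫ σ) (𝟙 X)) := by
  have hσ' : ∀ {n} (y : Cell Y n), q.app (op (Box.mk n)) (σ.app (op (Box.mk n)) y) = y :=
    fun y => app_of_congr hσ y
  suffices h : ∃ H : X ⟶ pathObj X, ∀ n (x : Cell X n),
      (pathEnd false X).app (op (Box.mk n)) (H.app (op (Box.mk n)) x) =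
        σ.app (op (Box.mk n)) (q.app (op (Box.mk n)) x) ∧
      (pathEnd true X).app (op (Box.mk n)) (H.app (op (Box.mk n)) x) = x ∧
      (pathMap q).app (op (Box.mk n)) (H.app (op (Box.mk n)) x) =
        (constPath Y).app (op (Box.mk n)) (q.app (op (Box.mk n)) x) by
    obtain ⟨H, hH⟩ := h
    refine ⟨⟨H, ?_, ?_⟩⟩
    · ext a x
      exact (hH a.unop.dim x).1
    · ext a x
      exact (hH a.unop.dim x).2.1
  refine (exists_hom_of_boundary (B := X) (X := pathObj X)
    (R := fun n x z => (pathEnd false X).app (op (Box.mk n)) z =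
        σ.app (op (Box.mk n)) (q.app (op (Box.mk n)) x) ∧
      (pathEnd true X).app (op (Box.mk n)) z = x ∧
      (pathMap q).app (op (Box.mk n)) z =
        (constPath Y).app (op (Box.mk n)) (q.app (op (Box.mk n)) x)) ?_ ?_ ?_
    (PartialMap.empty _ _ _)).imp fun _ h => h.2
  · rintro m n b x a ⟨h1, h2, h3⟩
    refine ⟨?_, ?_, ?_⟩
    · rw [app_act, h1, app_act, app_act]
    · rw [app_act, h2]
    · rw [app_act, h3, app_act, app_act]
  · intro b
    let α : Bool → Cell X 0 := fun δ => if δ then b else σ.app (op (Box.mk 0)) (q.app _ b)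
    obtain ⟨z, hz, hzf⟩ := hq.succ 0 (fun _ δ => α δ)
      ((constPath Y).app (op (Box.mk 0)) (q.app _ b) : Cell Y 1) (compat_zero _ _ _) (by
        intro j δ
        obtain rfl : j = Fin.last 0 := Subsingleton.elim (α := Fin 1) _ _
        refine Eq.trans ?_ (pathEnd_constPath Y δ (q.app (op (Box.mk 0)) b)).symm
        cases δ
        · exact hσ' _
        · rfl)
    exact ⟨z, hzf (Fin.last 0) false, hzf (Fin.last 0) true, hz⟩
  · intro n b x hx h
    let α : Bool → Cell X (n + 1) := fun δ =>
      if δ then b else σ.app (op (Box.mk (n + 1))) (q.app _ b)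
    have hα : ∀ j δ ε, bd X j δ (α ε) = (pathEnd ε X).app (op (Box.mk n)) (x j δ) := by
      rintro j δ (_ | _)
      · rw [(h j δ).1]
        exact (app_bd σ _ _ _).symm.trans (congrArg _ (app_bd q _ _ _).symm)
      · rw [(h j δ).2.1]; rfl
    obtain ⟨z, hz, hzf⟩ := hq.succ (n + 1) (pathFamily x α)
      ((constPath Y).app (op (Box.mk (n + 1))) (q.app _ b) : Cell Y (n + 2))
      (compat_pathFamily _ x hx α fun j δ ε _ _ => hα j δ ε) (by
        intro J δ
        induction J using Fin.lastCases with
        | last =>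
          rw [pathFamily_last]
          refine Eq.trans ?_ (pathEnd_constPath Y δ (q.app (op (Box.mk (n + 1))) b)).symm
          cases δ
          · exact hσ' _
          · rfl
        | cast j =>
          rw [pathFamily_castSucc]
          refine (h j δ).2.2.trans ?_
          rw [app_bd]
          exact (app_bd (constPath Y) j δ _).trans (bd_pathObj Y j δ _))
    refine ⟨z, ⟨?_, ?_, hz⟩, fun j δ => ?_⟩
    · exact (hzf _ _).trans (pathFamily_last x α false)
    · exact (hzf _ _).trans (pathFamily_last x α true)
    · exact (bd_pathObj X j δ z).trans ((hzf _ _).trans (pathFamily_castSucc x α j δ))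

theorem IsTrivFib.isWeakEquiv {X Y : cSet.{u}} {q : X ⟶ Y} (hq : IsTrivFib q) :
    IsWeakEquiv q := by
  obtain ⟨σ, hσ⟩ := hq.exists_section
  obtain ⟨H⟩ := hq.exists_htpy hσ
  intro K _
  refine Function.bijective_iff_has_inverse.2 ⟨HtpyClasses.precomp σ K, fun c => ?_, fun c => ?_⟩
  · have := congrFun (HtpyClasses.precomp_comp σ q K) c
    rw [hσ, HtpyClasses.precomp_id] at this
    exact this.symm
  · have := congrFun (HtpyClasses.precomp_comp q σ K) c
    rw [H.precomp_eq, HtpyClasses.precomp_id] at this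
    exact this.symm

theorem IsTrivFib.piBij {X Y : cSet.{u}} (hX : IsKan X) {q : X ⟶ Y} (hq : IsTrivFib q) (n : ℕ)
    (x : Cell X 0) : PiBij q n x := by
  obtain ⟨σ, hσ⟩ := hq.exists_section
  obtain ⟨H⟩ := hq.exists_htpy hσ
  refine PiBij.of_comp_comp (g := σ) ((H.piBij_iff hX n x).2 (piBij_id n x)) ?_
  rw [hσ]
  exact piBij_id n _

theorem IsFib.isKan {X Y : cSet.{u}} {p : X ⟶ Y} (hp : IsFib p) (hY : IsKan Y) : IsKan X := by
  refine isKan_of_fill fun n i ε x hx => ?_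
  obtain ⟨y, hy⟩ := hY.fill i ε (fun j δ => p.app _ (x j δ)) (by
    intro m v v' j k δ δ' h h' hv
    rw [← app_act, ← app_act, hx v v' j k δ δ' h h' hv])
  obtain ⟨z, -, hz⟩ := hp n i ε x y hx fun j δ h => (hy j δ h).symm
  exact ⟨z, hz⟩

/-! ### Factorization through the mapping path space -/

/-- The mapping path space: the pairs of a cube of `X` and a cube of paths in `Y` that starts at
its image. -/
def pathSpace {X Y : cSet.{u}} (f : X ⟶ Y) : cSet.{u} where
  obj a := {z : X.obj a × (pathObj Y).obj a // f.app a z.1 = (pathEnd false Y).app a z.2}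
  map {a b} g := ↾fun z => ⟨(X.map g z.1.1, (pathObj Y).map g z.1.2), by
    rw [NatTrans.naturality_apply, z.2, NatTrans.naturality_apply]⟩
  map_id a := by
    refine ConcreteCategory.hom_ext _ _ fun ⟨⟨x, y⟩, h⟩ => ?_
    refine Subtype.ext ?_
    change (_, _) = (_, _)
    exact congrArg₂ Prod.mk (act_id X x) (act_id (pathObj Y) y)
  map_comp g h := by
    refine ConcreteCategory.hom_ext _ _ fun ⟨⟨x, y⟩, hz⟩ => ?_
    refine Subtype.ext ?_
    change (_, _) = (_, _)
    exact congrArg₂ Prod.mk (act_act X h.unop g.unop x).symm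
      (act_act (pathObj Y) h.unop g.unop y).symm

namespace pathSpace

variable {X Y : cSet.{u}} (f : X ⟶ Y)

/-- The projection to the source; it is a trivial fibration if the target is a Kan complex. -/
def fst : pathSpace f ⟶ X where
  app a := ↾fun z => z.1.1

/-- The path component of a cube of the mapping path space. -/
def snd : pathSpace f ⟶ pathObj Y where
  app a := ↾fun z => z.1.2

/-- The end-point map of the mapping path space. -/
def proj : pathSpace f ⟶ Y := snd f ≫ pathEnd true Y

/-- The map itself and the end-point map agree up to homotopy. -/
def htpy : Htpy (fst f ≫ f) (proj f) where
  hom := snd f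
  left := by
    ext a z
    exact z.2.symm
  right := rfl

variable {f}

theorem ext {n : ℕ} {z z' : Cell (pathSpace f) n}
    (h : (fst f).app (op (Box.mk n)) z = (fst f).app (op (Box.mk n)) z')
    (h' : (snd f).app (op (Box.mk n)) z = (snd f).app (op (Box.mk n)) z') : z = z' :=
  Subtype.ext (Prod.ext h h')

theorem cond {n : ℕ} (z : Cell (pathSpace f) n) :
    f.app (op (Box.mk n)) ((fst f).app (op (Box.mk n)) z) =
      (pathEnd false Y).app (op (Box.mk n)) ((snd f).app (op (Box.mk n)) z) := z.2

/-- The cubes of the mapping path space. -/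
def mk {n : ℕ} (x : Cell X n) (y : Cell (pathObj Y) n)
    (h : f.app (op (Box.mk n)) x = (pathEnd false Y).app (op (Box.mk n)) y) :
    Cell (pathSpace f) n := ⟨(x, y), h⟩

end pathSpace

theorem Compat.app {X Y : cSet.{u}} (p : X ⟶ Y) {n : ℕ} {P : Fin (n + 1) → Bool → Prop}
    {x : Family X n} (h : Compat X P x) :
    Compat Y P fun j δ => p.app (op (Box.mk n)) (x j δ) := by
  intro m v v' j k δ δ' hj hk hv
  rw [← app_act, ← app_act, h v v' j k δ δ' hj hk hv]

theorem Compat.mono {X : cSet.{u}} {n : ℕ} {P Q : Fin (n + 1) → Bool → Prop}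
    {x : Family X n} (h : Compat X P x) (hQ : ∀ j δ, Q j δ → P j δ) : Compat X Q x :=
  fun _ v v' j k δ δ' hj hk hv => h v v' j k δ δ' (hQ _ _ hj) (hQ _ _ hk) hv

theorem isTrivFib_fst {X Y : cSet.{u}} (f : X ⟶ Y) (hY : IsKan Y) :
    IsTrivFib (pathSpace.fst f) where
  zero x := ⟨pathSpace.mk x ((constPath Y).app (op (Box.mk 0)) (f.app _ x))
    (pathEnd_constPath Y false _).symm, rfl⟩
  succ n e x he hex := by
    obtain ⟨y, hy⟩ := hY.fill (Fin.last (n + 1)) true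
      (pathFamily (fun j δ => (pathSpace.snd f).app (op (Box.mk n)) (e j δ))
        fun _ => f.app (op (Box.mk (n + 1))) x)
      (compat_pathFamily _ _ ((he.app (pathSpace.snd f)).mono fun _ _ _ => trivial) _ (by
        intro j δ ε _ hε
        obtain rfl : ε = false := by
          by_contra h
          exact hε (by rw [Bool.eq_true_of_not_eq_false h])
        rw [← app_bd, ← hex, pathSpace.cond]))
    have hcs : ∀ (j : Fin (n + 1)) δ, bd Y j.castSucc δ y =
        (pathSpace.snd f).app (op (Box.mk n)) (e j δ) := fun j δ =>
      (hy _ _ fun h => (Fin.castSucc_lt_last j).ne (congrArg Prod.fst h)).trans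
        (pathFamily_castSucc _ _ j δ)
    refine ⟨pathSpace.mk x y ?_, rfl, fun j δ => pathSpace.ext ?_ ?_⟩
    · exact ((hy (Fin.last (n + 1)) false (by simp)).trans (pathFamily_last _ _ _)).symm
    · exact (hex j δ).symm
    · exact (bd_pathObj Y j δ y).trans (hcs j δ)

theorem isFib_proj {X Y : cSet.{u}} (f : X ⟶ Y) (hX : IsKan X) (hY : IsKan Y) :
    IsFib (pathSpace.proj f) := by
  intro n i ε e y' he hey
  obtain ⟨x, hx⟩ := hX.fill i ε _ (he.app (pathSpace.fst f))
  let α : Bool → Cell Y (n + 1) := fun δ => if δ then y' else f.app (op (Box.mk (n + 1))) x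
  have hne : ∀ {j : Fin (n + 1)} {δ}, (j, δ) ≠ (i, ε) ↔ (j.castSucc, δ) ≠ (i.castSucc, ε) := by
    intro j δ
    simp [Prod.ext_iff]
  have hne' : ∀ {δ}, (Fin.last (n + 1), δ) ≠ (i.castSucc, ε) := fun h =>
    (Fin.castSucc_lt_last i).ne' (congrArg Prod.fst h)
  obtain ⟨y, hy⟩ := hY.fill i.castSucc ε
    (pathFamily (fun j δ => (pathSpace.snd f).app (op (Box.mk n)) (e j δ)) α)
    (compat_pathFamily _ _ ((he.app (pathSpace.snd f)).mono fun _ _ h => hne.2 h) _ (by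
      rintro j δ (_ | _) hj -
      · refine (app_bd f j δ x).symm.trans ?_
        rw [hx j δ (hne.2 hj), pathSpace.cond]
      · exact (hey j δ (hne.2 hj)).symm))
  refine ⟨pathSpace.mk x y ?_, ?_, fun j δ h => pathSpace.ext ?_ ?_⟩
  · exact ((hy _ false hne').trans (pathFamily_last _ α _)).symm
  · exact (hy _ true hne').trans (pathFamily_last _ α _)
  · exact hx j δ h
  · exact (bd_pathObj Y j δ y).trans ((hy _ _ (hne.1 h)).trans (pathFamily_castSucc _ α j δ))

theorem piBij_proj {X Y : cSet.{u}} (f : X ⟶ Y) (hX : IsKan X) (hY : IsKan Y)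
    (hf : ∀ n x, PiBij f n x) (n : ℕ) (e : Cell (pathSpace f) 0) :
    PiBij (pathSpace.proj f) n e :=
  ((pathSpace.htpy f).piBij_iff hY n e).1
    (PiBij.comp hY ((isTrivFib_fst f hY).piBij ((isFib_proj f hX hY).isKan hY) n e) (hf n _))

theorem isWeakEquiv_of_isTrivFib_proj {X Y : cSet.{u}} (f : X ⟶ Y) (hY : IsKan Y)
    (h : IsTrivFib (pathSpace.proj f)) : IsWeakEquiv f :=
  ((isTrivFib_fst f hY).isWeakEquiv.comp_iff_right f).1
    ((pathSpace.htpy f).isWeakEquiv_iff.2 h.isWeakEquiv)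

/-! ### Fibrations that are bijective on homotopy groups -/

theorem cst_constPath (X : cSet.{u}) (n : ℕ) (x : Cell X 0) :
    cst (pathObj X) n ((constPath X).app (op (Box.mk 0)) x) = cst X (n + 1) x :=
  (app_cst (constPath X) n x).symm.trans (act_cst X (Box.degen (Fin.last n)) x)

theorem htpyRel_iff {X : cSet.{u}} {n : ℕ} {x : Cell X 0} {α β : Cell X n} :
    HtpyRel X x α β ↔ ∃ z : Cell X (n + 1), SameBd (pathObj X) (n := n) z (cst X (n + 1) x) ∧
      bd X (Fin.last n) false z = α ∧ bd X (Fin.last n) true z = β := by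
  rw [← cst_constPath]
  exact Iff.rfl

theorem sqFace_cst (X : cSet.{u}) {n : ℕ} (x : Cell X 0) (κ ε : Bool) :
    sqFace X κ ε (cst X (n + 2) x) = cst X (n + 1) x := act_cst X _ x

theorem bd_cst (X : cSet.{u}) {n : ℕ} (i : Fin (n + 1)) (ε : Bool) (x : Cell X 0) :
    bd X i ε (cst X (n + 1) x) = cst X n x := act_cst X _ x

theorem isLoop_succ_iff {X : cSet.{u}} {n : ℕ} {x : Cell X 0} {z : Cell X (n + 1)} :
    IsLoop X x z ↔ SameBd (pathObj X) (n := n) z (cst X (n + 1) x) ∧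
      ∀ ε, bd X (Fin.last n) ε z = cst X n x := by
  rw [IsLoop, sameBd_succ]
  constructor
  · intro h
    exact ⟨sameBd_path.2 fun j δ => h j.castSucc δ, fun ε => (h _ ε).trans (bd_cst X _ _ _)⟩
  · rintro ⟨h1, h2⟩ i ε
    induction i using Fin.lastCases with
    | last => exact (h2 ε).trans (bd_cst X _ _ _).symm
    | cast j => exact sameBd_path.1 h1 j ε

theorem sameBd_sqFace {X : cSet.{u}} {n : ℕ} {z z' : Cell X (n + 2)}
    (h : SameBd (pathObj (pathObj X)) (n := n) z z') (κ ε : Bool) :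
    SameBd (pathObj X) (n := n) (sqFace X κ ε z) (sqFace X κ ε z') := fun _ f hf =>
  (congrArg _ (sideMap_app X κ ε (n := n) z).symm).trans
    ((SameBd.app (sideMap X κ ε) h f hf).trans (congrArg _ (sideMap_app X κ ε (n := n) z')))

/-- In a Kan complex, the end of a cube of paths can be replaced by a homotopic cube. -/
theorem IsKan.replace_end {Y : cSet.{u}} (hY : IsKan Y) {n : ℕ} {x : Cell Y 0}
    (Z : Cell Y (n + 1)) (β : Cell Y n) (h : HtpyRel Y x β (bd Y (Fin.last n) true Z)) :
    ∃ Z' : Cell Y (n + 1), SameBd (pathObj Y) (n := n) Z' Z ∧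
      bd Y (Fin.last n) false Z' = bd Y (Fin.last n) false Z ∧ bd Y (Fin.last n) true Z' = β := by
  have hγ : SameBd Y (bd Y (Fin.last n) true Z) (cst Y n x) := h.isLoop_right
  obtain ⟨G, hG, hG0, hG1⟩ := htpyRel_iff.1 h
  -- the constant homotopy of `Z`, in a new last coordinate
  let z₀ : Cell Y (n + 2) := (constPath Y).app (op (Box.mk (n + 1))) Z
  have hz₀ : ∀ ε, sqFace Y false ε z₀ =
      (constPath Y).app (op (Box.mk n)) (bd Y (Fin.last n) ε Z) := fun ε =>
    (bd_pathObj Y (Fin.last n) ε z₀).symm.trans (app_bd (constPath Y) (Fin.last n) ε Z).symm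
  have hz₁ : ∀ ε, sqFace Y true ε z₀ = Z := fun ε => pathEnd_constPath Y ε Z
  let c : Bool → Bool → Cell Y (n + 1) := fun κ ε =>
    if κ then Z else if ε then G else (constPath Y).app (op (Box.mk n)) (bd Y (Fin.last n) false Z)
  obtain ⟨z, -, hz, hzc⟩ := hY.isFib.fill_square z₀ c true false PUnit.unit
    (by
      rintro (_ | _) (_ | _) hne
      · rw [hz₀]; exact SameBd.refl _
      · rw [hz₀]
        refine hG.trans ?_
        have := SameBd.app (constPath Y) hγ.symm
        rwa [app_cst, cst_constPath] at this
      · exact absurd rfl hne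
      · rw [hz₁]; exact SameBd.refl _)
    (by
      rintro (_ | _) (_ | _) _ hne
      · exact absurd rfl hne
      · exact (pathEnd_constPath Y true _).symm
      · exact absurd rfl hne
      · exact hG1.symm)
    (fun _ _ _ => ptSet_eq _ _) (fun _ _ _ => ptSet_eq _ _)
  refine ⟨sqFace Y true false z, ?_, ?_, ?_⟩
  · have := SameBd.app (pathMap (pathEnd false Y)) hz
    refine SameBd.trans this ?_
    rw [← hz₁ false]
    exact SameBd.refl _
  · rw [bd_last_sqFace]
    exact (congrArg _ (hzc false false (by simp))).trans (pathEnd_constPath Y false _)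
  · rw [bd_last_sqFace]
    exact (congrArg _ (hzc false true (by simp))).trans hG0

/-- The initial end of the cube of paths `w` can be replaced by any cube with the same boundary
and the same image. -/
def EndReplaceable {E Y : cSet.{u}} (p : E ⟶ Y) {m : ℕ} (w : Cell E (m + 1)) : Prop :=
  ∀ α : Cell E m, SameBd E α (bd E (Fin.last m) false w) →
    p.app (op (Box.mk m)) α = p.app (op (Box.mk m)) (bd E (Fin.last m) false w) →
    ∃ w' : Cell E (m + 1), p.app (op (Box.mk (m + 1))) w' = p.app (op (Box.mk (m + 1))) w ∧
      SameBd (pathObj E) (n := m) w' w ∧ bd E (Fin.last m) false w' = α ∧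
      bd E (Fin.last m) true w' = bd E (Fin.last m) true w

/-- Replaceability passes along homotopies of cubes of paths: a replacement of the initial end is
transported to the other cube, replaced there, and the result is carried back by filling. -/
theorem EndReplaceable.of_homotopy {E Y : cSet.{u}} {p : E ⟶ Y} (hp : IsFib p) {m : ℕ}
    (W : Cell E (m + 2)) (h : EndReplaceable p (sqFace E true false W)) :
    EndReplaceable p (sqFace E true true W) := by
  intro α hα hαp
  -- transport `α` along the homotopy
  obtain ⟨A, hAp, hA, hA1⟩ := hp.fill_end (sqFace E false false W) true α
    (by rw [bd_last_sqFace] at hα; exact hα)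
    (p.app (op (Box.mk (m + 1))) (sqFace E false false W)) (SameBd.refl _)
    (by rw [hαp, bd_last_sqFace]; exact app_bd p _ _ _)
  have hcorner : (pathEnd false E).app (op (Box.mk m)) (sqFace E false false W) =
      bd E (Fin.last m) false (sqFace E true false W) := (bd_last_sqFace E true false false W).symm
  obtain ⟨w', hwp, hw, hw0, hw1⟩ := h (bd E (Fin.last m) false A)
    (by rw [← hcorner]; exact hA.app (pathEnd false E))
    (by
      rw [← hcorner]
      refine (app_bd p _ _ _).trans (Eq.trans ?_ (app_bd p _ _ _).symm)
      exact congrArg (bd Y (Fin.last m) false) hAp)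
  let c : Bool → Bool → Cell E (m + 1) := fun κ ε =>
    if κ then w' else if ε then sqFace E false true W else A
  obtain ⟨z, hzp, hz, hzc⟩ := hp.fill_square W c true true (p.app (op (Box.mk (m + 2))) W)
    (by
      rintro (_ | _) (_ | _) hne
      · exact hA
      · exact SameBd.refl _
      · exact hw
      · exact absurd rfl hne)
    (by
      rintro (_ | _) (_ | _) _ hne
      · exact hw0
      · exact absurd rfl hne
      · exact hw1.trans (bd_last_sqFace E true false true W)
      · exact absurd rfl hne)
    (by
      rintro (_ | _) (_ | _) hne
      · exact hAp.trans (app_bd p _ _ _)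
      · exact app_bd p _ _ _
      · exact hwp.trans (app_bd p _ _ _)
      · exact absurd rfl hne)
    (SameBd.refl _)
  refine ⟨sqFace E true true z, ?_, ?_, ?_, ?_⟩
  · exact (app_bd p _ _ _).trans ((congrArg _ hzp).trans (app_bd p _ _ _).symm)
  · exact SameBd.app (pathMap (pathEnd true E)) hz
  · rw [bd_last_sqFace]
    exact (congrArg _ (hzc false false (by simp))).trans hA1
  · rw [bd_last_sqFace E true true true z, bd_last_sqFace E true true true W]
    exact congrArg _ (hzc false true (by simp))

/-- For a constant cube of paths, the replacement `α` of the end is a loop whose image is constant.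
It is null homotopic by injectivity on homotopy groups, and by surjectivity the null homotopy can be
corrected to lie over a constant one. -/
theorem endReplaceable_cst {E Y : cSet.{u}} {p : E ⟶ Y} (hp : IsFib p) (hY : IsKan Y)
    (hpi : ∀ n e, PiBij p n e) (m : ℕ) (e : Cell E 0) : EndReplaceable p (cst E (m + 1) e) := by
  intro α hα hαp
  rw [bd_cst] at hα hαp
  have hpc : ∀ n, p.app (op (Box.mk n)) (cst E n e) = cst Y n (p.app (op (Box.mk 0)) e) :=
    fun n => app_cst p n e
  -- a null homotopy `H` of `α`
  obtain ⟨H, hH, hH0, hH1⟩ := htpyRel_iff.1 ((hpi m e).1 α (cst E m e) hα (isLoop_cst E m e)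
    (by rw [hαp, hpc]; exact HtpyRel.refl (isLoop_cst Y m _)))
  -- its image represents an element `γ` of the homotopy group of `Y`
  let c : Bool → Bool → Cell Y (m + 1) := fun κ ε =>
    if κ || ε then cst Y (m + 1) (p.app (op (Box.mk 0)) e) else p.app (op (Box.mk (m + 1))) H
  have hpH : ∀ δ, bd Y (Fin.last m) δ (p.app (op (Box.mk (m + 1))) H) =
      cst Y m (p.app (op (Box.mk 0)) e) := by
    rintro (_ | _)
    · rw [← app_bd, hH0, hαp, hpc]
    · rw [← app_bd, hH1, hpc]
  obtain ⟨Z, -, hZ, hZc⟩ := hY.isFib.fill_square (cst Y (m + 2) (p.app (op (Box.mk 0)) e)) c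
    true true PUnit.unit
    (by
      intro κ ε hne
      rw [sqFace_cst]
      cases κ <;> cases ε
      · have := SameBd.app (pathMap p) hH
        refine SameBd.trans this ?_
        rw [← hpc]
        exact SameBd.refl _
      all_goals exact SameBd.refl _)
    (by
      rintro (_ | _) δ _ _
      · refine Eq.trans ?_ (hpH δ).symm
        exact bd_cst Y _ _ _
      · exact (bd_cst Y _ _ _).trans (bd_cst Y _ _ _).symm)
    (fun _ _ _ => ptSet_eq _ _) (fun _ _ _ => ptSet_eq _ _)
  have hγ : IsLoop Y (p.app (op (Box.mk 0)) e) (sqFace Y true true Z) := by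
    refine isLoop_succ_iff.2 ⟨?_, fun δ => ?_⟩
    · have := SameBd.app (pathMap (pathEnd true Y)) hZ
      exact SameBd.trans this fun k f _ =>
        congrArg (act (pathObj Y) f) (sqFace_cst Y (p.app (op (Box.mk 0)) e) true true)
    · rw [bd_last_sqFace, hZc _ _ (by simp)]
      cases δ
      · exact hpH true
      · exact bd_cst Y _ _ _
  -- correct `H` by an element `β` over `γ`
  obtain ⟨β, hβ, hβγ⟩ := (hpi (m + 1) e).2 _ hγ
  obtain ⟨hβ1, hβ2⟩ := isLoop_succ_iff.1 hβ
  obtain ⟨Z', hZ', hZ'0, hZ'1⟩ := hY.replace_end Z _ hβγ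
  have hZ's : ∀ ε, sqFace Y false ε Z' = c false ε := fun ε =>
    (sameBd_path.1 hZ' (Fin.last m) ε).trans (hZc false ε (by simp))
  let c' : Bool → Bool → Cell E (m + 1) := fun κ ε =>
    if κ then (if ε then β else (constPath E).app (op (Box.mk m)) α) else H
  obtain ⟨z, hzp, hz, hzc⟩ := hp.fill_square (cst E (m + 2) e) c' false true Z'
    (by
      intro κ ε hne
      rw [sqFace_cst]
      rcases κ with _ | _
      · exact hH
      · rcases ε with _ | _
        · have := SameBd.app (constPath E) hα
          rwa [app_cst, cst_constPath] at this
        · exact hβ1)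
    (by
      rintro (_ | _) (_ | _) hne _
      · exact (pathEnd_constPath E false α).trans hH0.symm
      · exact (hβ2 false).trans hH1.symm
      · exact absurd rfl hne
      · exact absurd rfl hne)
    (by
      rintro (_ | _) (_ | _) hne
      · exact (hZ's false).symm
      · exact absurd rfl hne
      · refine (pathMap_constPath p α).trans ?_
        rw [hαp, hpc]
        refine Eq.trans ?_ (hZ'0.trans (hZc true false (by simp))).symm
        exact act_cst Y (Box.degen (Fin.last m)) _
      · exact hZ'1.symm)
    (sameBd_path_path.2 fun j δ => by
      refine (sameBd_path.1 hZ' j.castSucc δ).trans ?_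
      refine (sameBd_path_path.1 hZ j δ).trans ?_
      rw [hpc])
  refine ⟨sqFace E false true z, ?_, ?_, ?_, ?_⟩
  · refine (app_bd p _ _ _).trans ?_
    rw [hzp, hpc]
    exact hZ's true
  · have := sameBd_sqFace hz false true
    rwa [sqFace_cst] at this
  · rw [bd_last_sqFace]
    exact (congrArg _ (hzc true false (by simp))).trans (pathEnd_constPath E true α)
  · rw [bd_last_sqFace]
    exact (congrArg _ (hzc true true (by simp))).trans ((hβ2 true).trans (bd_cst E _ _ _).symm)

/-- Contracting the coordinates of `w` one after the other by connections reduces the claim to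
constant cubes. -/
theorem endReplaceable {E Y : cSet.{u}} {p : E ⟶ Y} (hp : IsFib p) (hY : IsKan Y)
    (hpi : ∀ n e, PiBij p n e) {m : ℕ} (w : Cell E (m + 1)) : EndReplaceable p w := by
  suffices h : ∀ (k : ℕ) (π : Box.mk (m + 1) ⟶ Box.mk k) (u : Cell E k),
      EndReplaceable p (act E π u) by
    have := h (m + 1) (𝟙 _) w
    rwa [act_id] at this
  intro k
  induction k with
  | zero =>
    intro π u
    rw [Box.eq_of_zero π (Box.bang _)]
    exact endReplaceable_cst hp hY hpi m u
  | succ k ih =>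
    intro π u
    -- contract the last coordinate of `u`
    have hend : ∀ ε, sqFace E true ε (act E (Box.cylMap π ≫ Box.conn (Fin.last k) true) u) =
        act E (π ≫ Box.face (Fin.last (k + 1)) ε ≫ Box.conn (Fin.last k) true) u := fun ε => by
      rw [← Category.assoc, ← Box.face_last_comp_cylMap, Category.assoc]
      exact act_act E _ _ u
    have h0 : Box.face (Fin.last (k + 1)) false ≫ Box.conn (Fin.last k) true =
        Box.degen (Fin.last k) ≫ Box.face (Fin.last k) false :=
      Box.face_conn_absorb (Fin.last k) true _ (Or.inr (Fin.succ_last _).symm)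
    have h1 : Box.face (Fin.last (k + 1)) true ≫ Box.conn (Fin.last k) true = 𝟙 _ :=
      Box.face_conn_succ (Fin.last k) true
    have h := EndReplaceable.of_homotopy hp
      (act E (Box.cylMap π ≫ Box.conn (Fin.last k) true) u) (by
        rw [hend, h0, ← Category.assoc, ← act_act]
        exact ih (π ≫ Box.degen (Fin.last k)) (bd E (Fin.last k) false u))
    rw [hend, h1, Category.comp_id] at h
    exact h

/-- A fibration of Kan complexes that is bijective on homotopy groups is a trivial fibration. -/
theorem IsFib.isTrivFib {E Y : cSet.{u}} {p : E ⟶ Y} (hp : IsFib p) (hY : IsKan Y)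
    (hne : Nonempty (Cell Y 0) → Nonempty (Cell E 0)) (hpi : ∀ n e, PiBij p n e) :
    IsTrivFib p where
  zero y := by
    obtain ⟨e⟩ := hne ⟨y⟩
    obtain ⟨α, -, z, -, hz0, hz1⟩ := (hpi 0 e).2 y (sameBd_zero _ _)
    obtain ⟨w, hw, -, -⟩ := hp.fill_end ((constPath E).app (op (Box.mk 0)) α) false α
      (sameBd_zero _ _) z (sameBd_zero _ _) hz0.symm
    refine ⟨(pathEnd true E).app (op (Box.mk 0)) w, ?_⟩
    rw [← hz1, ← hw]
    exact app_bd p _ _ _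
  succ n x y hx hxy := by
    obtain ⟨w, hwp, hw⟩ := hp n (Fin.last n) false x y (hx.mono fun _ _ _ => trivial)
      fun j δ _ => hxy j δ
    have hx0 : SameBd E (x (Fin.last n) false) (bd E (Fin.last n) false w) := by
      cases n with
      | zero => exact sameBd_zero _ _
      | succ n =>
        refine sameBd_succ.2 fun i ε => ?_
        have h1 := hx.bd_eq (i := i) (j := Fin.last n) (Fin.le_last i) (ε := ε) (δ := false)
          trivial trivial
        rw [Fin.succ_last] at h1
        rw [h1, ← hw _ _ (by simp [Prod.ext_iff, (Fin.castSucc_lt_last i).ne])]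
        exact (bd_bd E (Fin.le_last i) ε false w).symm
    obtain ⟨z, hzp, hz, hz0, hz1⟩ := endReplaceable hp hY hpi w _ hx0 (by
      rw [hxy, app_bd, hwp])
    refine ⟨z, hzp.trans hwp, fun j δ => ?_⟩
    induction j using Fin.lastCases with
    | last =>
      cases δ
      · exact hz0
      · exact hz1.trans (hw _ _ (by simp))
    | cast j =>
      refine (sameBd_path.1 hz j δ).trans (hw _ _ ?_)
      simp [Prod.ext_iff, (Fin.castSucc_lt_last j).ne]

/-- Whitehead's theorem for Kan complexes. -/
theorem isWeakEquiv_iff_piBij {X Y : cSet.{u}} (hX : IsKan X) (hY : IsKan Y) (f : X ⟶ Y)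
    (hne : Nonempty (Cell Y 0) → Nonempty (Cell X 0)) :
    IsWeakEquiv f ↔ ∀ n x, PiBij f n x :=
  ⟨fun hf n x => hf.piBij hX hY n x, fun hf => isWeakEquiv_of_isTrivFib_proj f hY
    ((isFib_proj f hX hY).isTrivFib hY (fun h => (hne h).map fun x =>
      pathSpace.mk x ((constPath Y).app (op (Box.mk 0)) (f.app _ x))
        (pathEnd_constPath Y false _).symm) (piBij_proj f hX hY hf))⟩

/-! ### Cubes of nerves as functions -/

/-- The vertices of an interval. -/
abbrev Interval.Pt (J : Interval) : Type := Fin (J.len + 1)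

/-- The end-points of an interval. -/
def Interval.end' (J : Interval) (ε : Bool) : J.Pt := if ε then ⊤ else ⊥

/-- The lattice operation that gives the connection `ε`. -/
def latOp {L : Type*} [Lattice L] (ε : Bool) (a b : L) : L := if ε then a ⊓ b else a ⊔ b

theorem latOp_comm {L : Type*} [Lattice L] (ε : Bool) (a b : L) : latOp ε a b = latOp ε b a := by
  cases ε
  · exact sup_comm a b
  · exact inf_comm a b

theorem latOp_end (J : Interval) (ε : Bool) (a : J.Pt) : latOp ε a (J.end' ε) = a := by
  cases ε
  · exact sup_bot_eq a
  · exact inf_top_eq a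

theorem latOp_end_not (J : Interval) (ε : Bool) (a : J.Pt) :
    latOp ε a (J.end' (!ε)) = J.end' (!ε) := by
  cases ε
  · exact sup_top_eq a
  · exact inf_bot_eq a

/-- The map of vertices underlying a coconnection. -/
def connFun {L : Type*} [Lattice L] {n : ℕ} (i : Fin (n + 1)) (ε : Bool) (x : Fin (n + 2) → L) :
    Fin (n + 1) → L := fun j =>
  if j < i then x j.castSucc else if j = i then latOp ε (x i.castSucc) (x i.succ) else x j.succ

section nv

variable {J : Interval} {G : DGra.{u}} {n : ℕ}

/-- The function on vertices underlying a cube of the nerve. -/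
def nv (f : Cell (nerveObj J G) n) : (Fin n → J.Pt) → G.V := DGra.Hom.toFun (G := J.cube n) f

theorem nv_ext {f g : Cell (nerveObj J G) n} (h : ∀ x, nv f x = nv g x) : f = g :=
  DGra.Hom.ext (funext h)

theorem nv_arrow (f : Cell (nerveObj J G) n) (x : Fin n → J.Pt) (i : Fin n) (a : J.Pt)
    (h : J.toDGra.Arrow (x i) a) : G.Arrow (nv f x) (nv f (Function.update x i a)) :=
  DGra.Hom.map_arrow (G := J.cube n) f (Or.inr ⟨i, by
    rw [Function.update_self]; exact h, fun j hj => by rw [Function.update_of_ne hj]⟩)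

/-- The cube of the nerve with a given underlying function. -/
def ncell (F : (Fin n → J.Pt) → G.V) (hF : ∀ x i a, J.toDGra.Arrow (x i) a →
    G.Arrow (F x) (F (Function.update x i a))) : Cell (nerveObj J G) n :=
  DGra.Hom.mk (G := J.cube n) F (by
    rintro x y (rfl | ⟨i, hi, hj⟩)
    · exact G.refl _
    · have : y = Function.update x i (y i) := by
        funext j
        by_cases hji : j = i
        · subst hji; rw [Function.update_self]
        · rw [Function.update_of_ne hji, hj j hji]
      rw [this]
      exact hF x i _ hi)

theorem nv_ncell (F : (Fin n → J.Pt) → G.V) (hF) : nv (ncell (J := J) F hF) = F := rfl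

theorem nv_act {m : ℕ} (a : Box.mk m ⟶ Box.mk n) (f : Cell (nerveObj J G) n)
    (x : Fin m → J.Pt) :
    nv (act (nerveObj J G) a f) x = nv f ((J.cubeMap a).toFun x) := rfl

theorem cubeMap_ofWord {m : ℕ} (s : BoxWord m n) (x : Fin m → J.Pt) :
    (J.cubeMap (Box.ofWord s)).toFun x = s.eval J.Pt x :=
  congrFun (J.cubeMap_eq (Box.ofWord s) s rfl) x

theorem cubeMap_face (i : Fin (n + 1)) (ε : Bool) (x : Fin n → J.Pt) :
    (J.cubeMap (Box.face i ε)).toFun x = i.insertNth (α := fun _ => J.Pt) (J.end' ε) x :=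
  cubeMap_ofWord (.face i ε) x

theorem cubeMap_degen (i : Fin (n + 1)) (x : Fin (n + 1) → J.Pt) :
    (J.cubeMap (Box.degen i)).toFun x = fun j => x (i.succAbove j) :=
  cubeMap_ofWord (.degen i) x

theorem cubeMap_conn (i : Fin (n + 1)) (ε : Bool) (x : Fin (n + 2) → J.Pt) :
    (J.cubeMap (Box.conn i ε)).toFun x = connFun i ε x :=
  cubeMap_ofWord (.conn i ε) x

theorem cubeMap_cylMap {m : ℕ} (a : Box.mk m ⟶ Box.mk n) (x : Fin (m + 1) → J.Pt) :
    (J.cubeMap (Box.cylMap a)).toFun x =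
      Fin.snoc (α := fun _ => J.Pt) ((J.cubeMap a).toFun (Fin.init x)) (x (Fin.last m)) := by
  obtain ⟨s, hs⟩ := a.isWord
  have h : Box.cylMap a = Box.ofWord s.cyl := Box.Hom.ext (funext fun y => by
    rw [Box.cylMap_toFun, ← hs]
    exact (BoxWord.eval_cyl Bool s y).symm)
  have h' : a = Box.ofWord s := Box.Hom.ext hs.symm
  rw [h, cubeMap_ofWord, h', cubeMap_ofWord, BoxWord.eval_cyl]

theorem nv_bd (i : Fin (n + 1)) (ε : Bool) (f : Cell (nerveObj J G) (n + 1))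
    (x : Fin n → J.Pt) :
    nv (bd (nerveObj J G) i ε f) x = nv f (i.insertNth (α := fun _ => J.Pt) (J.end' ε) x) := by
  rw [bd, nv_act, cubeMap_face]

theorem nv_degen (i : Fin (n + 1)) (f : Cell (nerveObj J G) n) (x : Fin (n + 1) → J.Pt) :
    nv (act (nerveObj J G) (Box.degen i) f) x = nv f fun j => x (i.succAbove j) := by
  rw [nv_act, cubeMap_degen]

theorem nv_conn (i : Fin (n + 1)) (ε : Bool) (f : Cell (nerveObj J G) (n + 1))
    (x : Fin (n + 2) → J.Pt) :
    nv (act (nerveObj J G) (Box.conn i ε) f) x = nv f (connFun i ε x) := by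
  rw [nv_act, cubeMap_conn]

end nv

/-! ### The sequence of nerves and its colimit -/

/-- The map of nerves induced by a shrinking. -/
def shrMap {J J' : Interval} (r : J ⟶ J') (G : DGra.{u}) : nerveObj J' G ⟶ nerveObj J G :=
  (nerveFunctor.map r.op).app G

theorem nv_shrMap {J J' : Interval} (r : J ⟶ J') {G : DGra.{u}} {n : ℕ}
    (f : Cell (nerveObj J' G) n) (x : Fin n → J.Pt) :
    nv ((shrMap r G).app (op (Box.mk n)) f) x = nv f fun i => r.hom.toFun (x i) := rfl

theorem shrMap_injective {J J' : Interval} (r : J ⟶ J') {G : DGra.{u}} {n : ℕ}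
    {f g : Cell (nerveObj J' G) n}
    (h : (shrMap r G).app (op (Box.mk n)) f = (shrMap r G).app (op (Box.mk n)) g) : f = g := by
  refine nv_ext fun x => ?_
  choose s hs using r.surj
  have := congrArg (fun c => nv c fun i => s (x i)) h
  simp only [nv_shrMap] at this
  have e : (fun i => r.hom.toFun (s (x i))) = x := funext fun i => hs _
  rwa [e] at this

/-- The composite shrinking between two terms of the sequence of standard intervals. -/
def stShr {k k' : ℕ} (h : k ≤ k') : stInterval k' ⟶ stInterval k :=
  ((Functor.ofSequence fun k => (stShrinking k).op).map (homOfLE h)).unop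

theorem stShr_refl (k : ℕ) : stShr (le_refl k) = 𝟙 _ :=
  congrArg Quiver.Hom.unop
    ((Functor.ofSequence fun k => (stShrinking k).op).map_id k)

theorem stShr_succ {k k' : ℕ} (h : k ≤ k') :
    stShr (h.trans k'.le_succ) = stShrinking k' ≫ stShr h := by
  have h1 : homOfLE (h.trans k'.le_succ) = homOfLE h ≫ homOfLE (Nat.le_add_right k' 1) := rfl
  rw [stShr, h1, Functor.map_comp, Functor.ofSequence_map_homOfLE_succ]
  rfl

theorem stShr_val {k k' : ℕ} (h : k ≤ k') (x : Fin (k' + 2)) :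
    (((stShr h).hom.toFun x : Fin (k + 2)) : ℕ) = min (x.val - (k' / 2 - k / 2)) (k + 1) := by
  induction k', h using Nat.le_induction with
  | base =>
    rw [stShr_refl]
    change x.val = _
    have := x.isLt
    omega
  | succ k' h ih =>
    rw [stShr_succ h]
    have h1 : (((stShrinking k').hom.toFun x : Fin (k' + 2)) : ℕ) =
        if Even k' then min x.val (k' + 1) else x.val - 1 := rfl
    refine (ih ((stShrinking k').hom.toFun x)).trans ?_
    rw [h1]
    have := x.isLt
    split_ifs with he
    · rw [Nat.even_iff] at he
      omega
    · rw [Nat.even_iff] at he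
      omega

/-- The arrows of the standard intervals. -/
theorem stInterval_arrow_iff {k : ℕ} {x y : (stInterval k).Pt} :
    (stInterval k).toDGra.Arrow x y ↔
      x.val = y.val ∨ ((x.val = y.val + 1 ∨ y.val = x.val + 1) ∧ Even (x.val + k / 2)) := by
  constructor
  · rintro (rfl | ⟨i, ⟨h, rfl, rfl⟩ | ⟨h, rfl, rfl⟩⟩)
    · exact Or.inl rfl
    · rw [stInterval_fwd, decide_eq_true_iff] at h
      exact Or.inr ⟨Or.inr rfl, h⟩
    · rw [stInterval_fwd, decide_eq_false_iff_not] at h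
      refine Or.inr ⟨Or.inl rfl, ?_⟩
      rw [Fin.val_succ]
      rw [Nat.even_iff] at h ⊢
      omega
  · rintro (h | ⟨h | h, he⟩)
    · exact Or.inl (Fin.ext h)
    · have hy : y.val < k + 1 := by have : x.val < k + 2 := x.isLt; omega
      refine Or.inr ⟨⟨y.val, hy⟩, Or.inr ⟨?_, Fin.ext h, rfl⟩⟩
      rw [stInterval_fwd, decide_eq_false_iff_not]
      rw [Nat.even_iff] at he ⊢
      simp only
      omega
    · have hx : x.val < k + 1 := by have : y.val < k + 2 := y.isLt; omega
      refine Or.inr ⟨⟨x.val, hx⟩, Or.inl ⟨?_, rfl, Fin.ext h⟩⟩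
      rw [stInterval_fwd, decide_eq_true_iff]
      exact he

section inc

variable (G : DGra.{u})

/-- The map from a nerve of the sequence to the infinite nerve. -/
def inc (k : ℕ) : nerveObj (stInterval k) G ⟶ nerveInf.obj G :=
  colimit.ι (nerveSequence.flip.obj G) k

variable {G}

theorem inc_trans {k k' : ℕ} (h : k ≤ k') :
    shrMap (stShr h) G ≫ inc G k' = inc G k :=
  colimit.w (nerveSequence.flip.obj G) (homOfLE h)

theorem inc_trans_app {k k' : ℕ} (h : k ≤ k') {n : ℕ} (f : Cell (nerveObj (stInterval k) G) n) :
    (inc G k').app (op (Box.mk n)) ((shrMap (stShr h) G).app (op (Box.mk n)) f) =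
      (inc G k).app (op (Box.mk n)) f := app_of_congr (inc_trans h) f

/-- The cubes of the infinite nerve as a colimit of sets. -/
def incIsColimit (G : DGra.{u}) (n : ℕ) :=
  isColimitOfPreserves ((evaluation _ _).obj (op (Box.mk n)))
    (colimit.isColimit (nerveSequence.flip.obj G))

theorem exists_inc {n : ℕ} (z : Cell (nerveInf.obj G) n) :
    ∃ k f, (inc G k).app (op (Box.mk n)) f = z :=
  Types.jointly_surjective_of_isColimit (incIsColimit G n) z

theorem exists_inc_ge {n : ℕ} (z : Cell (nerveInf.obj G) n) :
    ∃ k₀, ∀ k, k₀ ≤ k → ∃ f, (inc G k).app (op (Box.mk n)) f = z := by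
  obtain ⟨k₀, f, rfl⟩ := exists_inc z
  exact ⟨k₀, fun k hk => ⟨_, inc_trans_app hk f⟩⟩

theorem inc_injective {k n : ℕ} {f g : Cell (nerveObj (stInterval k) G) n}
    (h : (inc G k).app (op (Box.mk n)) f = (inc G k).app (op (Box.mk n)) g) : f = g := by
  obtain ⟨k', a, h'⟩ := (Types.FilteredColimit.isColimit_eq_iff' (incIsColimit G n) f g).1 h
  exact shrMap_injective (stShr a.le) h'

theorem nerveInf_map_inc {G' : DGra.{u}} (φ : G ⟶ G') (k : ℕ) :
    inc G k ≫ nerveInf.map φ = (nerve (stInterval k)).map φ ≫ inc G' k :=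
  ι_colimMap (nerveSequence.flip.map φ) k

end inc

/-! ### Collapses of an end arrow of an interval -/

/-- A shrinking `r : J' → J` that collapses one end arrow, with the section `s` of `r` that misses
the collapsed end, and a subset `τ` of the vertices of `J'` whose complement is a
neighbourhood of the end `ε`, such that the transition from the complement of `τ` to `τ` has the
same direction as the collapsed arrow. -/
structure Collapse (J' J : Interval) where
  r : J' ⟶ J
  s : J.Pt → J'.Pt
  s_arrow : ∀ {a b}, J.toDGra.Arrow a b → J'.toDGra.Arrow (s a) (s b)
  r_s : ∀ a, r.hom.toFun (s a) = a
  /-- the direction of the collapsed arrow -/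
  fwd : Bool
  arrow_s_r : ∀ a : J'.Pt, if fwd then J'.toDGra.Arrow a (s (r.hom.toFun a))
    else J'.toDGra.Arrow (s (r.hom.toFun a)) a
  s_mono : Monotone s
  τ : J'.Pt → Bool
  ε : Bool
  τ_arrow : ∀ {a b}, J'.toDGra.Arrow a b → τ a ≠ τ b → τ b = fwd
  τ_end : τ (J'.end' ε) = false
  τ_end_not : τ (J'.end' (!ε)) = true
  τ_s_r : ∀ a : J'.Pt, τ (s (r.hom.toFun a)) = τ a
  τ_op : ∀ a b, τ (latOp ε a b) = (τ a || τ b)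
  s_r_end : s (r.hom.toFun (J'.end' ε)) = J'.end' ε

namespace Collapse

variable {J' J : Interval} (D : Collapse J' J)

/-- The retraction of `J'` onto the complement of the collapsed end. -/
def ρ (a : J'.Pt) : J'.Pt := D.s (D.r.hom.toFun a)

theorem ρ_ρ (a : J'.Pt) : D.ρ (D.ρ a) = D.ρ a := congrArg D.s (D.r_s _)

theorem ρ_arrow {a b : J'.Pt} (h : J'.toDGra.Arrow a b) : J'.toDGra.Arrow (D.ρ a) (D.ρ b) :=
  D.s_arrow (D.r.hom.map_arrow h)

theorem ρ_mono : Monotone D.ρ := D.s_mono.comp D.r.mono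

theorem ρ_op (δ : Bool) (a b : J'.Pt) : D.ρ (latOp δ a b) = latOp δ (D.ρ a) (D.ρ b) := by
  cases δ
  · exact D.ρ_mono.map_sup a b
  · exact D.ρ_mono.map_inf a b

/-- The retraction `ρ`, applied to the first `q` coordinates. -/
def clamp {n : ℕ} (q : ℕ) (x : Fin n → J'.Pt) : Fin n → J'.Pt :=
  fun i => if i.val < q then D.ρ (x i) else x i

variable {n : ℕ}

theorem clamp_zero (x : Fin n → J'.Pt) : D.clamp 0 x = x := by
  funext i; simp [clamp]

theorem clamp_clamp (q q' : ℕ) (x : Fin n → J'.Pt) :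
    D.clamp q (D.clamp q' x) = D.clamp (max q q') x := by
  funext i
  simp only [clamp, lt_max_iff]
  by_cases h : i.val < q <;> by_cases h' : i.val < q' <;> simp [h, h', ρ_ρ]

theorem clamp_congr {q q' : ℕ} (h : q = q' ∨ (n ≤ q ∧ n ≤ q')) (x : Fin n → J'.Pt) :
    D.clamp q x = D.clamp q' x := by
  funext i
  have := i.isLt
  have : i.val < q ↔ i.val < q' := by omega
  simp only [clamp, this]

theorem clamp_update (q : ℕ) (x : Fin n → J'.Pt) (i : Fin n) (a : J'.Pt) :
    D.clamp q (Function.update x i a) =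
      Function.update (D.clamp q x) i (if i.val < q then D.ρ a else a) := by
  funext j
  by_cases h : j = i
  · subst h; simp [clamp]
  · simp [clamp, h]

theorem clamp_succ (x : Fin n → J'.Pt) (i : Fin n) :
    D.clamp (i.val + 1) x = D.clamp i.val (Function.update x i (D.ρ (x i))) := by
  funext j
  by_cases h : j = i
  · subst h; simp [clamp]
  · have : j.val < i.val + 1 ↔ j.val < i.val := by
      have := fun e => h (Fin.ext e)
      omega
    simp [clamp, h, this]

theorem init_clamp (q : ℕ) (y : Fin (n + 1) → J'.Pt) :
    (Fin.init (D.clamp q y) : Fin n → J'.Pt) = D.clamp q (Fin.init y) := rfl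

theorem clamp_snoc_end (q : ℕ) (z : Fin n → J'.Pt) :
    D.clamp q (Fin.snoc (α := fun _ => J'.Pt) z (J'.end' D.ε)) =
      Fin.snoc (α := fun _ => J'.Pt) (D.clamp q z) (J'.end' D.ε) := by
  funext j
  induction j using Fin.lastCases with
  | last =>
    have h : D.ρ (J'.end' D.ε) = J'.end' D.ε := D.s_r_end
    simp [clamp, h]
  | cast j => simp [clamp]

theorem τ_clamp_last (q : ℕ) (y : Fin (n + 1) → J'.Pt) :
    D.τ (D.clamp q y (Fin.last n)) = D.τ (y (Fin.last n)) := by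
  rw [clamp]
  split_ifs
  · exact D.τ_s_r _
  · rfl

theorem clamp_insertNth (q : ℕ) (j : Fin (n + 1)) (a : J'.Pt) (x : Fin n → J'.Pt) :
    D.clamp q (j.insertNth (α := fun _ => J'.Pt) a x) =
      j.insertNth (α := fun _ => J'.Pt) (if j.val < q then D.ρ a else a)
        (D.clamp (if j.val < q then q - 1 else q) x) := by
  rw [Fin.eq_insertNth_iff]
  refine ⟨by simp [clamp], ?_⟩
  funext i
  have h : (j.succAbove i).val < q ↔ i.val < if j.val < q then q - 1 else q := by
    rcases lt_or_ge i.castSucc j with hi | hi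
    · rw [Fin.succAbove_of_castSucc_lt _ _ hi]
      have : i.val < j.val := hi
      simp only [Fin.val_castSucc]
      split_ifs <;> omega
    · rw [Fin.succAbove_of_le_castSucc _ _ hi]
      have : j.val ≤ i.val := hi
      simp only [Fin.val_succ]
      split_ifs <;> omega
  simp only [Fin.removeNth, clamp, h, Fin.insertNth_apply_succAbove]

/-! ### Good coordinates and movable prefixes -/

/-- The function `F` does not change if `ρ` is applied to the coordinate `i`. -/
def Good {V : Type*} (F : (Fin n → J'.Pt) → V) (i : Fin n) : Prop :=
  ∀ x, F (Function.update x i (D.ρ (x i))) = F x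

theorem Good.clamp {V : Type*} {F : (Fin n → J'.Pt) → V} {i : Fin n} (h : D.Good F i) (q : ℕ) :
    D.Good (fun x => F (D.clamp q x)) i := by
  intro x
  change F _ = F _
  rw [clamp_update, ← h (D.clamp q x)]
  congr 2
  by_cases hi : i.val < q <;> simp [Collapse.clamp, hi, ρ_ρ]

theorem good_clamp {V : Type*} (F : (Fin n → J'.Pt) → V) {i : Fin n} {q : ℕ} (h : i.val < q) :
    D.Good (fun x => F (D.clamp q x)) i := by
  intro x
  change F _ = F _
  congr 1
  rw [clamp_update, if_pos h, ρ_ρ]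
  funext j
  by_cases hj : j = i
  · subst hj; simp [Collapse.clamp, h]
  · simp [hj]

theorem clamp_eq_of_good {V : Type*} {F : (Fin n → J'.Pt) → V} {q q' : ℕ} (hq : q ≤ q')
    (h : ∀ i : Fin n, q ≤ i.val → i.val < q' → D.Good F i) (x : Fin n → J'.Pt) :
    F (D.clamp q' x) = F (D.clamp q x) := by
  induction q', hq using Nat.le_induction with
  | base => rfl
  | succ q' hq ih =>
    have ih := ih fun i hi hi' => h i hi (by omega)
    by_cases hn : q' < n
    · rw [D.clamp_succ x ⟨q', hn⟩, clamp_update, ← ih]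
      rw [← h ⟨q', hn⟩ hq (by simp) (D.clamp q' x)]
      simp [Collapse.clamp]
    · rw [← ih, D.clamp_congr (q := q' + 1) (q' := q') (Or.inr ⟨by omega, by omega⟩)]

/-- Arrows in the direction of the collapsed arrow. -/
def Dir (G : DGra.{u}) (a b : G.V) : Prop := if D.fwd then G.Arrow a b else G.Arrow b a

theorem dir_refl {G : DGra.{u}} (a : G.V) : D.Dir G a a := by
  rw [Dir]; split_ifs <;> exact G.refl a

/-- The function underlies a cube of the nerve. -/
def IsMap (G : DGra.{u}) (F : (Fin n → J'.Pt) → G.V) : Prop :=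
  ∀ x i a, J'.toDGra.Arrow (x i) a → G.Arrow (F x) (F (Function.update x i a))

theorem IsMap.dir {G : DGra.{u}} {F : (Fin n → J'.Pt) → G.V} (hF : IsMap G F)
    (x : Fin n → J'.Pt) (i : Fin n) : D.Dir G (F x) (F (Function.update x i (D.ρ (x i)))) := by
  have h := D.arrow_s_r (x i)
  rw [Dir]
  split_ifs at h ⊢ with hf
  · exact hF x i _ h
  · have := hF (Function.update x i (D.ρ (x i))) i (x i) (by
      rw [Function.update_self]; exact h)
    rwa [Function.update_idem, Function.update_eq_self] at this

/-- Applying `ρ` to the first `q` coordinates moves all values along arrows in the direction of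
the collapsed arrow. -/
def Movable (G : DGra.{u}) (F : (Fin n → J'.Pt) → G.V) (q : ℕ) : Prop :=
  ∀ x, D.Dir G (F x) (F (D.clamp q x))

theorem movable_zero {G : DGra.{u}} (F : (Fin n → J'.Pt) → G.V) : D.Movable G F 0 := fun x => by
  rw [clamp_zero]; exact D.dir_refl _

open Classical in
/-- The largest movable prefix of the coordinates. -/
def pf (G : DGra.{u}) (F : (Fin n → J'.Pt) → G.V) : ℕ := Nat.findGreatest (D.Movable G F) n

theorem movable_pf {G : DGra.{u}} (F : (Fin n → J'.Pt) → G.V) : D.Movable G F (D.pf G F) := by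
  classical
  exact Nat.findGreatest_spec (P := D.Movable G F) (Nat.zero_le n) (D.movable_zero F)

theorem pf_le {G : DGra.{u}} (F : (Fin n → J'.Pt) → G.V) : D.pf G F ≤ n := by
  classical
  exact Nat.findGreatest_le n

theorem Movable.le_pf {G : DGra.{u}} {F : (Fin n → J'.Pt) → G.V} {q : ℕ} (h : D.Movable G F q)
    (hq : q ≤ n) : q ≤ D.pf G F := by
  classical
  exact Nat.le_findGreatest hq h

theorem Movable.congr {G : DGra.{u}} {F : (Fin n → J'.Pt) → G.V} {q q' : ℕ} (h : D.Movable G F q)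
    (hq : q = q' ∨ (n ≤ q ∧ n ≤ q')) : D.Movable G F q' := fun x => by
  rw [← D.clamp_congr hq]; exact h x

/-- The first bad coordinate lies in the largest movable prefix. -/
theorem exists_bad_lt {G : DGra.{u}} {F : (Fin n → J'.Pt) → G.V} (hF : IsMap G F)
    (h : ∃ i, ¬ D.Good F i) : ∃ i : Fin n, ¬ D.Good F i ∧ i.val < D.pf G F := by
  classical
  obtain ⟨i, hi, hmin⟩ := WellFounded.has_min (wellFounded_lt (α := Fin n)) {i | ¬ D.Good F i} h
  refine ⟨i, hi, Nat.lt_of_succ_le (Movable.le_pf D (fun x => ?_) i.isLt)⟩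
  rw [clamp_succ, D.clamp_eq_of_good (F := F) (Nat.zero_le i.val) (fun j _ hj => ?_), clamp_zero]
  · exact hF.dir D x i
  · by_contra hb
    exact hmin j hb hj

/-! ### The homotopy that pushes the largest movable prefix away from the collapsed end -/

/-- The underlying function of the homotopy from `F` to its restriction along `ρ` on the first
`q` coordinates. -/
def HF {V : Type*} (F : (Fin n → J'.Pt) → V) (q : ℕ) (y : Fin (n + 1) → J'.Pt) : V :=
  if D.τ (y (Fin.last n)) then F (D.clamp q (Fin.init y)) else F (Fin.init y)

theorem init_update_last {V : Type*} (y : Fin (n + 1) → V) (a : V) :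
    (Fin.init (Function.update y (Fin.last n) a) : Fin n → V) = Fin.init y := by
  funext j
  exact Function.update_of_ne (Fin.castSucc_lt_last j).ne a y

theorem init_update_castSucc {V : Type*} (y : Fin (n + 1) → V) (i : Fin n) (a : V) :
    (Fin.init (Function.update y i.castSucc a) : Fin n → V) =
      Function.update (Fin.init y) i a := by
  funext j
  by_cases h : j = i
  · subst h; simp [Fin.init]
  · have : j.castSucc ≠ i.castSucc := fun e => h (Fin.castSucc_injective _ e)
    simp [Fin.init, h]

theorem isMap_HF {G : DGra.{u}} {F : (Fin n → J'.Pt) → G.V} (hF : IsMap G F) {q : ℕ}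
    (hq : D.Movable G F q) : IsMap G (D.HF F q) := by
  intro x i a h
  induction i using Fin.lastCases with
  | last =>
    have hd := hq (Fin.init x)
    have hτ := D.τ_arrow h
    simp only [HF, init_update_last, Function.update_self]
    rw [Dir] at hd
    rcases h1 : D.τ (x (Fin.last n)) <;> rcases h2 : D.τ a <;> rw [h1, h2] at hτ <;>
      simp only [if_true, if_false, Bool.false_eq_true]
    · exact G.refl _
    · rw [← hτ (by simp)] at hd
      exact hd
    · rw [← hτ (by simp)] at hd
      exact hd
    · exact G.refl _
  | cast j =>
    have hl : Function.update x j.castSucc a (Fin.last n) = x (Fin.last n) :=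
      Function.update_of_ne (Fin.castSucc_lt_last j).ne' _ _
    simp only [HF, init_update_castSucc, hl]
    split_ifs
    · rw [clamp_update]
      refine hF _ j _ ?_
      rw [clamp]
      split_ifs
      · exact D.ρ_arrow h
      · exact h
    · exact hF _ j a h

theorem good_HF_last {V : Type*} (F : (Fin n → J'.Pt) → V) (q : ℕ) :
    D.Good (D.HF F q) (Fin.last n) := by
  intro x
  simp only [HF, init_update_last, Function.update_self]
  rw [show D.τ (D.ρ (x (Fin.last n))) = _ from D.τ_s_r _]

theorem Good.HF {V : Type*} {F : (Fin n → J'.Pt) → V} {i : Fin n} (h : D.Good F i) (q : ℕ) :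
    D.Good (D.HF F q) i.castSucc := by
  intro x
  have hl : Function.update x i.castSucc (D.ρ (x i.castSucc)) (Fin.last n) = x (Fin.last n) :=
    Function.update_of_ne (Fin.castSucc_lt_last i).ne' _ _
  simp only [Collapse.HF, init_update_castSucc, hl]
  have h1 := h (Fin.init x)
  have h2 := Good.clamp D h q (Fin.init x)
  simp only at h2
  exact congrArg₂ (fun a b => if D.τ (x (Fin.last n)) then a else b) h2 h1

theorem HF_snoc {V : Type*} (F : (Fin n → J'.Pt) → V) (q : ℕ) (x : Fin n → J'.Pt) (t : J'.Pt) :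
    D.HF F q (Fin.snoc (α := fun _ => J'.Pt) x t) = if D.τ t then F (D.clamp q x) else F x := by
  simp [HF]

section cells

variable {G : DGra.{u}}

theorem isMap_nv (f : Cell (nerveObj J' G) n) : IsMap G (nv f) := nv_arrow f

/-- The homotopy that pushes the largest movable prefix of a cube away from the collapsed end. -/
def H (f : Cell (nerveObj J' G) n) : Cell (nerveObj J' G) (n + 1) :=
  ncell (D.HF (nv f) (D.pf G (nv f))) (D.isMap_HF (isMap_nv f) (D.movable_pf _))

theorem nv_H (f : Cell (nerveObj J' G) n) : nv (D.H f) = D.HF (nv f) (D.pf G (nv f)) := rfl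

theorem insertNth_last_eq_snoc {V : Type*} (a : V) (x : Fin n → V) :
    (Fin.last n).insertNth (α := fun _ => V) a x = Fin.snoc (α := fun _ => V) x a :=
  Fin.insertNth_last' a x

theorem bd_last_H (f : Cell (nerveObj J' G) n) :
    bd (nerveObj J' G) (Fin.last n) D.ε (D.H f) = f := by
  refine nv_ext fun x => ?_
  rw [nv_bd, nv_H, insertNth_last_eq_snoc, HF_snoc, D.τ_end]
  simp

/-- A degeneracy or connection is compatible with the homotopy, if it carries prefixes to
prefixes. -/
theorem H_act_of_prefix {m : ℕ} (σ : Box.mk m ⟶ Box.mk n) (f : Cell (nerveObj J' G) n)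
    (h : ∀ x, nv f (D.clamp (D.pf G (nv f)) ((J'.cubeMap σ).toFun x)) =
      nv f ((J'.cubeMap σ).toFun
        (D.clamp (D.pf G (nv (act (nerveObj J' G) σ f))) x))) :
    D.H (act (nerveObj J' G) σ f) = act (nerveObj J' G) (Box.cylMap σ) (D.H f) := by
  refine nv_ext fun y => ?_
  rw [nv_act, cubeMap_cylMap, nv_H, nv_H, HF_snoc, HF, h]
  rfl

theorem H_degen (i : Fin (n + 1)) (f : Cell (nerveObj J' G) n) :
    D.H (act (nerveObj J' G) (Box.degen i) f) =
      act (nerveObj J' G) (Box.cylMap (Box.degen i)) (D.H f) := by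
  set F' := nv (act (nerveObj J' G) (Box.degen i) f) with hF'
  let c : ℕ → ℕ := fun q => if q ≤ i.val then q else q - 1
  have hc : ∀ q (x : Fin (n + 1) → J'.Pt),
      (fun j => D.clamp q x (i.succAbove j)) = D.clamp (c q) fun j => x (i.succAbove j) := by
    intro q x
    funext j
    have : (i.succAbove j).val < q ↔ j.val < c q := by
      rcases lt_or_ge j.castSucc i with h | h
      · rw [Fin.succAbove_of_castSucc_lt _ _ h]
        have : j.val < i.val := h
        simp only [Fin.val_castSucc, c]
        split_ifs <;> omega
      · rw [Fin.succAbove_of_le_castSucc _ _ h]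
        have : i.val ≤ j.val := h
        simp only [Fin.val_succ, c]
        split_ifs <;> omega
    simp only [clamp, this]
  have hmov : ∀ q, D.Movable G F' q ↔ D.Movable G (nv f) (c q) := by
    intro q
    constructor
    · intro h x
      have := h (i.insertNth (α := fun _ => J'.Pt) ⊥ x)
      rw [hF', nv_degen, nv_degen, hc] at this
      simpa using this
    · intro h x
      rw [hF', nv_degen, nv_degen, hc]
      exact h _
  have h1 : c (D.pf G F') ≤ D.pf G (nv f) := by
    refine Movable.le_pf D ((hmov _).1 (D.movable_pf F')) ?_
    have := D.pf_le F'
    have := i.isLt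
    simp only [c]; split_ifs <;> omega
  have h2 : D.pf G (nv f) ≤ c (D.pf G F') := by
    have hle := D.pf_le (nv f)
    have : c (if D.pf G (nv f) ≤ i.val then D.pf G (nv f) else D.pf G (nv f) + 1) =
        D.pf G (nv f) := by
      simp only [c]; split_ifs <;> omega
    have h3 := Movable.le_pf D ((hmov _).2 (this.symm ▸ D.movable_pf (nv f)))
      (by split_ifs <;> omega)
    simp only [c]
    split_ifs at h3 ⊢ <;> omega
  refine D.H_act_of_prefix _ f fun x => ?_
  rw [cubeMap_degen, cubeMap_degen, hc, ← hF', le_antisymm h1 h2]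

theorem connFun_clamp (i : Fin (n + 1)) (δ : Bool) (q : ℕ) (hq : q ≠ i.val + 1)
    (x : Fin (n + 2) → J'.Pt) :
    connFun i δ (D.clamp q x) = D.clamp (if q ≤ i.val then q else q - 1) (connFun i δ x) := by
  funext j
  rcases lt_trichotomy j i with h | rfl | h
  · have hv : j.val < i.val := h
    have : j.val < q ↔ j.val < if q ≤ i.val then q else q - 1 := by split_ifs <;> omega
    simp only [connFun, clamp, h, if_true, Fin.val_castSucc, ← this]
  · have h1 : j.val < q ↔ j.val < if q ≤ j.val then q else q - 1 := by split_ifs <;> omega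
    have h2 : j.val + 1 < q ↔ j.val < q := by omega
    simp only [connFun, clamp, lt_irrefl, if_true, if_false, Fin.val_castSucc, Fin.val_succ, h2,
      ← h1]
    split_ifs
    · exact (D.ρ_op _ _ _).symm
    · rfl
  · have hv : i.val < j.val := h
    have : j.val + 1 < q ↔ j.val < if q ≤ i.val then q else q - 1 := by split_ifs <;> omega
    simp only [connFun, clamp, h.not_gt, h.ne', if_false, Fin.val_succ, this]

theorem exists_connFun_eq (i : Fin (n + 1)) (δ : Bool) (x : Fin (n + 1) → J'.Pt) :
    ∃ z, connFun i δ z = x ∧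
      connFun i δ (D.clamp (i.val + 1) z) = D.clamp (i.val + 1) x := by
  refine ⟨fun j => if h : j.val ≤ i.val then x ⟨j.val, by omega⟩ else
    if j.val = i.val + 1 then J'.end' δ else x ⟨j.val - 1, by omega⟩, ?_, ?_⟩
  · funext j
    rcases lt_trichotomy j i with h | rfl | h
    · have hv : j.val < i.val := h
      simp [connFun, h, hv.le]
    · simp [connFun, latOp_end]
    · have hv : i.val < j.val := h
      simp [connFun, h.not_gt, h.ne', show ¬ j.val + 1 ≤ i.val by omega,
        show ¬ j.val = i.val by omega]
  · funext j
    rcases lt_trichotomy j i with h | rfl | h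
    · have hv : j.val < i.val := h
      simp [connFun, clamp, h, hv.le, show j.val < i.val + 1 by omega]
    · simp [connFun, clamp, latOp_end]
    · have hv : i.val < j.val := h
      simp [connFun, clamp, h.not_gt, h.ne', show ¬ j.val + 1 ≤ i.val by omega,
        show ¬ j.val = i.val by omega, show ¬ j.val < i.val + 1 by omega]

theorem H_conn (i : Fin (n + 1)) (δ : Bool) (f : Cell (nerveObj J' G) (n + 1)) :
    D.H (act (nerveObj J' G) (Box.conn i δ) f) =
      act (nerveObj J' G) (Box.cylMap (Box.conn i δ)) (D.H f) := by
  set F' := nv (act (nerveObj J' G) (Box.conn i δ) f) with hF'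
  let c : ℕ → ℕ := fun q => if q ≤ i.val then q else q - 1
  have hsurj : ∀ x : Fin (n + 1) → J'.Pt, ∃ z, connFun i δ z = x := fun x =>
    (D.exists_connFun_eq i δ x).imp fun _ h => h.1
  have hmov : ∀ q, q ≠ i.val + 1 → (D.Movable G F' q ↔ D.Movable G (nv f) (c q)) := by
    intro q hq
    constructor
    · intro h x
      obtain ⟨z, rfl⟩ := hsurj x
      have := h z
      rwa [hF', nv_conn, nv_conn, D.connFun_clamp i δ q hq] at this
    · intro h x
      rw [hF', nv_conn, nv_conn, D.connFun_clamp i δ q hq]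
      exact h _
  have hi := i.isLt
  -- the largest movable prefix does not separate the two coordinates that are joined
  have hcut : D.pf G F' ≠ i.val + 1 := by
    intro h
    have h1 : D.Movable G (nv f) (i.val + 1) := by
      intro x
      obtain ⟨z, hz, hz'⟩ := D.exists_connFun_eq i δ x
      have := D.movable_pf F' z
      rwa [h, hF', nv_conn, nv_conn, hz, hz'] at this
    have h2 : D.Movable G F' (i.val + 2) := (hmov _ (by omega)).2 (by simpa [c] using h1)
    have := Movable.le_pf D h2 (by omega)
    omega
  have h1 : c (D.pf G F') ≤ D.pf G (nv f) := by
    refine Movable.le_pf D ((hmov _ hcut).1 (D.movable_pf F')) ?_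
    have := D.pf_le F'
    simp only [c]; split_ifs <;> omega
  have h2 : D.pf G (nv f) ≤ c (D.pf G F') := by
    have hle := D.pf_le (nv f)
    have : c (if D.pf G (nv f) ≤ i.val then D.pf G (nv f) else D.pf G (nv f) + 1) =
        D.pf G (nv f) := by
      simp only [c]; split_ifs <;> omega
    have h3 := Movable.le_pf D ((hmov _ (by split_ifs <;> omega)).2
      (this.symm ▸ D.movable_pf (nv f))) (by split_ifs <;> omega)
    simp only [c]
    split_ifs at h3 ⊢ <;> omega
  refine D.H_act_of_prefix _ f fun x => ?_
  rw [cubeMap_conn, cubeMap_conn, D.connFun_clamp i δ _ hcut]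
  exact congrArg (fun q => nv f (D.clamp q (connFun i δ x))) (le_antisymm h2 h1)

theorem H_surj {m : ℕ} {σ : Box.mk m ⟶ Box.mk n} (hσ : Box.Surj σ)
    (f : Cell (nerveObj J' G) n) :
    D.H (act (nerveObj J' G) σ f) = act (nerveObj J' G) (Box.cylMap σ) (D.H f) := by
  induction hσ with
  | id n => rw [act_id, Box.cylMap_id, act_id]
  | degen i v _ ih => rw [← act_act, H_degen, ih, act_act, Box.cylMap_comp]
  | conn i δ v _ ih => rw [← act_act, H_conn, ih, act_act, Box.cylMap_comp]

/-- A second application of the homotopy only gives connections, so that cubes `H f` are not sources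
of further pairs. -/
theorem H_H (f : Cell (nerveObj J' G) n) :
    D.H (D.H f) = act (nerveObj J' G) (Box.conn (Fin.last n) D.ε) (D.H f) := by
  set F := nv f with hF
  set p := D.pf G F with hp
  set Q := D.pf G (nv (D.H f)) with hQ
  have hHF : nv (D.H f) = D.HF F p := rfl
  have hpQ : p ≤ Q := by
    refine Movable.le_pf D (fun y => ?_) ((D.pf_le F).trans (Nat.le_succ n))
    rw [hHF, HF, HF, τ_clamp_last, init_clamp, clamp_clamp, max_self]
    split_ifs
    · exact D.dir_refl _
    · exact D.movable_pf F _
  have hQp : Q = p ∨ (p = n ∧ Q = n + 1) := by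
    have h1 : D.Movable G F Q := by
      intro x
      have := D.movable_pf (nv (D.H f)) (Fin.snoc (α := fun _ => J'.Pt) x (J'.end' D.ε))
      rwa [clamp_snoc_end, hHF, HF_snoc, HF_snoc, D.τ_end, if_neg (by simp), if_neg (by simp)]
        at this
    have h2 := D.pf_le (nv (D.H f))
    have h3 := D.pf_le F
    rcases Nat.lt_or_ge n Q with h | h
    · have := Movable.le_pf D (Movable.congr D h1 (q' := n) (Or.inr ⟨h.le, le_rfl⟩)) le_rfl
      omega
    · have := Movable.le_pf D h1 h
      omega
  have hclamp : ∀ y : Fin (n + 1) → J'.Pt,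
      nv (D.H f) (D.clamp Q y) = D.HF F p (D.clamp p y) := by
    intro y
    rcases hQp with h | ⟨h, h'⟩
    · rw [h]; rfl
    · refine D.clamp_eq_of_good (F := D.HF F p) hpQ (fun i hi _ => ?_) y
      obtain rfl : i = Fin.last n := Fin.ext (by have := i.isLt; simp; omega)
      exact D.good_HF_last F p
  refine nv_ext fun y => ?_
  rw [nv_conn, nv_H, HF, hclamp, HF, hHF, HF, HF, τ_clamp_last, init_clamp, clamp_clamp, max_self]
  have h1 : connFun (Fin.last n) D.ε y (Fin.last n) =
      latOp D.ε (y (Fin.last n).castSucc) (y (Fin.last (n + 1))) := by simp [connFun]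
  have h2 : (Fin.init (connFun (Fin.last n) D.ε y) : Fin n → J'.Pt) = Fin.init (Fin.init y) := by
    funext j
    simp [Fin.init, connFun, Fin.castSucc_lt_last]
  rw [h1, h2, D.τ_op]
  change (if _ then if D.τ (y (Fin.last n).castSucc) = true then _ else _ else
    if D.τ (y (Fin.last n).castSucc) = true then _ else _) = _
  rcases D.τ (y (Fin.last n).castSucc) <;> rcases D.τ (y (Fin.last (n + 1))) <;> rfl

end cells

end Collapse

/-! ### Nondegeneracy of the homotopy -/

theorem Box.Inj.le {m n : ℕ} {f : Box.mk m ⟶ Box.mk n} (h : Box.Inj f) : m ≤ n := by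
  induction h <;> omega

theorem IsDegen.cases {X : cSet.{u}} {m : ℕ} {x : Cell X (m + 2)} (h : IsDegen X x) :
    (∃ i c, x = act X (Box.degen i) c) ∨ ∃ i δ c, x = act X (Box.conn i δ) c := by
  obtain ⟨k, hk, e, c, rfl⟩ := h
  obtain ⟨l, s, d, hs, hd, rfl⟩ := Box.factors e
  rw [← act_act]
  generalize act X d c = c'
  have hl := hd.le
  cases hs with
  | id => omega
  | degen i v hv => exact Or.inl ⟨i, act X v c', by rw [act_act]⟩
  | conn i δ v hv => exact Or.inr ⟨i, δ, act X v c', by rw [act_act]⟩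

theorem isDegen_act {X : cSet.{u}} {k n : ℕ} (h : k < n) (e : Box.mk n ⟶ Box.mk k)
    (c : Cell X k) : IsDegen X (act X e c) := ⟨k, h, e, c, rfl⟩

namespace Collapse

variable {J' J : Interval} (D : Collapse J' J) {G : DGra.{u}} {n : ℕ}

/-- If the homotopy of `F` is a connection in its last two coordinates, then `F` itself is the
homotopy of its face. -/
theorem eq_HF_of_conn {V : Type*} {F : (Fin (n + 1) → J'.Pt) → V} {p : ℕ}
    {c : (Fin (n + 1) → J'.Pt) → V}
    (h : ∀ y, D.HF F p y = c (connFun (Fin.last n) D.ε y)) (x : Fin (n + 1) → J'.Pt) :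
    F x = D.HF (fun z => F (Fin.snoc (α := fun _ => J'.Pt) z (J'.end' D.ε))) p x := by
  have key : ∀ (z : Fin n → J'.Pt) (a b : J'.Pt),
      connFun (Fin.last n) D.ε (Fin.snoc (α := fun _ => J'.Pt)
        (Fin.snoc (α := fun _ => J'.Pt) z a) b) =
      Fin.snoc (α := fun _ => J'.Pt) z (latOp D.ε a b) := by
    intro z a b
    funext j
    induction j using Fin.lastCases with
    | last => simp [connFun]
    | cast j => simp [connFun, Fin.castSucc_lt_last]
  obtain ⟨z, a, rfl⟩ : ∃ z a, x = Fin.snoc (α := fun _ => J'.Pt) z a :=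
    ⟨Fin.init x, x (Fin.last n), (Fin.snoc_init_self x).symm⟩
  have h1 := h (Fin.snoc (α := fun _ => J'.Pt)
    (Fin.snoc (α := fun _ => J'.Pt) z a) (J'.end' D.ε))
  have h2 := h (Fin.snoc (α := fun _ => J'.Pt)
    (Fin.snoc (α := fun _ => J'.Pt) z (J'.end' D.ε)) a)
  rw [key, latOp_comm, ← key, ← h] at h1
  rw [HF_snoc, HF_snoc, D.τ_end, if_neg (by simp)] at h1
  rw [h1, HF_snoc, clamp_snoc_end]

/-- If `H f` is a connection of this form, then `f` is `H g`, where `g` is the last face of `f`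
at the end `D.ε`. So the homotopy `H f` of a cube `f` outside the image of `H` is not such a
connection. -/
theorem eq_H_of_conn {f : Cell (nerveObj J' G) (n + 1)} {c : Cell (nerveObj J' G) (n + 1)}
    (h : D.H f = act _ (Box.conn (Fin.last n) D.ε) c) :
    f = D.H (bd (nerveObj J' G) (Fin.last n) D.ε f) := by
  set F := nv f with hF
  set p := D.pf G F with hp
  set F' := nv (bd (nerveObj J' G) (Fin.last n) D.ε f) with hF'
  have hF'' : F' = fun z => F (Fin.snoc (α := fun _ => J'.Pt) z (J'.end' D.ε)) := by
    funext z
    rw [hF', nv_bd, insertNth_last_eq_snoc]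
  have h1 : ∀ x, F x = D.HF F' p x := fun x => by
    rw [hF'']
    refine D.eq_HF_of_conn (c := nv c) (fun y => ?_) x
    rw [← nv_conn, ← h, nv_H]
  set p' := D.pf G F' with hp'
  have hpn : p ≤ n + 1 := D.pf_le F
  have hp'n : p' ≤ n := D.pf_le F'
  have hmin : min p n ≤ p' := by
    have h2 : D.Movable G F' p := fun z => by
      have := D.movable_pf F (Fin.snoc (α := fun _ => J'.Pt) z (J'.end' D.ε))
      rw [clamp_snoc_end] at this
      rw [hF'']
      exact this
    refine Movable.le_pf D (Movable.congr D h2 ?_) (min_le_right p n)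
    omega
  have hle : p' ≤ p := by
    by_contra hlt
    have h2 : D.Movable G F p' := fun x => by
      rw [h1, h1, HF, HF, τ_clamp_last, init_clamp, clamp_clamp, max_comm, ← clamp_clamp]
      split_ifs
      · exact D.movable_pf F' _
      · exact D.movable_pf F' _
    exact hlt (Movable.le_pf D h2 (by omega))
  refine nv_ext fun x => ?_
  rw [← hF, h1, nv_H, HF, HF, D.clamp_congr (q := p) (q' := p') (by omega)]

/-- The homotopy of a nondegenerate cube is nondegenerate, unless the cube does not meet the
collapsed end or is itself such a homotopy. -/
theorem not_isDegen_H {f : Cell (nerveObj J' G) (n + 1)} (hf : ¬ IsDegen _ f)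
    (hbad : ∃ i, ¬ D.Good (nv f) i)
    (hH : f ≠ D.H (bd (nerveObj J' G) (Fin.last n) D.ε f)) : ¬ IsDegen _ (D.H f) := by
  have hb := D.bd_last_H f
  -- a degeneracy in the old coordinates is a degeneracy of the face `f`
  have hcyl : ∀ {k} (_ : k < n + 1) (a : Box.mk (n + 1) ⟶ Box.mk k) c,
      D.H f ≠ act (nerveObj J' G) (Box.cylMap a) c := by
    intro k hk a c h
    apply hf
    rw [← hb, h, bd, act_act, Box.face_last_comp_cylMap, ← act_act]
    exact isDegen_act hk a _
  intro hdeg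
  rcases hdeg.cases with ⟨i, c, h⟩ | ⟨i, δ, c, h⟩
  · induction i using Fin.lastCases with
    | last =>
      have h1 : ∀ x, nv f (D.clamp (D.pf G (nv f)) x) = nv f x := by
        intro x
        have h2 : ∀ t : J'.Pt, D.HF (nv f) (D.pf G (nv f))
            (Fin.snoc (α := fun _ => J'.Pt) x t) = nv c x := fun t => by
          rw [← nv_H, h, nv_degen]
          simp
        have h3 := (h2 (J'.end' (!D.ε))).trans (h2 (J'.end' D.ε)).symm
        rwa [HF_snoc, HF_snoc, D.τ_end, D.τ_end_not, if_pos rfl, if_neg (by simp)] at h3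
      obtain ⟨i, hi, hip⟩ := D.exists_bad_lt (isMap_nv f) hbad
      refine hi fun x => ?_
      have := D.good_clamp (nv f) hip x
      simp only [h1] at this
      exact this
    | cast i => exact hcyl (Nat.lt_succ_self n) (Box.degen i) c (by rw [Box.cylMap_degen]; exact h)
  · induction i using Fin.lastCases with
    | last =>
      by_cases hδ : δ = D.ε
      · subst hδ
        exact hH (D.eq_H_of_conn h)
      · obtain rfl : δ = !D.ε := by
          revert hδ; cases δ <;> cases D.ε <;> simp
        apply hf
        have h0 := Box.face_conn_absorb (Fin.last n) (!D.ε) (Fin.last (n + 1))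
          (Or.inr (Fin.succ_last _).symm)
        rw [Bool.not_not] at h0
        rw [← hb, h, bd, act_act, h0, ← act_act]
        exact isDegen_act (Nat.lt_succ_self n) _ _
    | cast i =>
      obtain ⟨m, rfl⟩ : ∃ m, n = m + 1 := ⟨n - 1, by have := i.isLt; omega⟩
      exact hcyl (Nat.lt_succ_self _) (Box.conn i δ) c (by rw [Box.cylMap_conn]; exact h)

/-! ### The faces of the homotopy -/

open Classical in
/-- The coordinates in which a function is not constant along the collapsed arrow. -/
def badSet {V : Type*} (F : (Fin n → J'.Pt) → V) : Finset (Fin n) :=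
  Finset.univ.filter fun i => ¬ D.Good F i

theorem mem_badSet {V : Type*} {F : (Fin n → J'.Pt) → V} {i : Fin n} :
    i ∈ D.badSet F ↔ ¬ D.Good F i := by simp [badSet]

/-- The number of bad coordinates and the number of those beyond the largest movable prefix,
ordered lexicographically. -/
def wt (f : Cell (nerveObj J' G) n) : ℕ ×ₗ ℕ :=
  toLex ((D.badSet (nv f)).card,
    ((D.badSet (nv f)).filter fun i => D.pf G (nv f) ≤ i.val).card)

theorem wt_lt_of_card {f g : Cell (nerveObj J' G) n}
    (h : (D.badSet (nv g)).card < (D.badSet (nv f)).card) : D.wt g < D.wt f :=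
  Prod.Lex.toLex_lt_toLex.2 (Or.inl h)

theorem wt_lt_of_le {f g : Cell (nerveObj J' G) n}
    (h : (D.badSet (nv g)).card ≤ (D.badSet (nv f)).card)
    (h' : ((D.badSet (nv g)).filter fun i => D.pf G (nv g) ≤ i.val).card <
      ((D.badSet (nv f)).filter fun i => D.pf G (nv f) ≤ i.val).card) : D.wt g < D.wt f := by
  refine Prod.Lex.toLex_lt_toLex.2 ?_
  rcases h.lt_or_eq with h | h
  · exact Or.inl h
  · exact Or.inr ⟨h, h'⟩

/-- The face of `H f` opposite to `f` has fewer bad coordinates. -/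
theorem wt_bd_last_H_lt {f : Cell (nerveObj J' G) n} (hbad : ∃ i, ¬ D.Good (nv f) i) :
    D.wt (bd (nerveObj J' G) (Fin.last n) (!D.ε) (D.H f)) < D.wt f := by
  have h : nv (bd (nerveObj J' G) (Fin.last n) (!D.ε) (D.H f)) =
      fun x => nv f (D.clamp (D.pf G (nv f)) x) := by
    funext x
    rw [nv_bd, nv_H, insertNth_last_eq_snoc, HF_snoc, D.τ_end_not, if_pos rfl]
  refine D.wt_lt_of_card (Finset.card_lt_card ?_)
  rw [h]
  obtain ⟨i, hi, hip⟩ := D.exists_bad_lt (isMap_nv f) hbad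
  refine Finset.ssubset_iff_of_subset (fun j hj => ?_) |>.2 ⟨i, D.mem_badSet.2 hi, fun hi' => ?_⟩
  · rw [mem_badSet] at hj ⊢
    exact fun h => hj (Good.clamp D h _)
  · exact D.mem_badSet.1 hi' (D.good_clamp (nv f) hip)

theorem init_insertNth_castSucc {V : Type*} (j : Fin (n + 1)) (a : V) (y : Fin (n + 1) → V) :
    (Fin.init (j.castSucc.insertNth (α := fun _ => V) a y) : Fin (n + 1) → V) =
      j.insertNth (α := fun _ => V) a (Fin.init y) := by
  rw [Fin.eq_insertNth_iff]
  refine ⟨by simp [Fin.init], ?_⟩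
  funext i
  simp [Fin.removeNth, Fin.init, ← Fin.castSucc_succAbove_castSucc]

theorem insertNth_castSucc_last {V : Type*} (j : Fin (n + 1)) (a : V) (y : Fin (n + 1) → V) :
    j.castSucc.insertNth (α := fun _ => V) a y (Fin.last (n + 1)) = y (Fin.last n) := by
  have : Fin.last (n + 1) = j.castSucc.succAbove (Fin.last n) := by
    rw [Fin.succAbove_castSucc_of_le _ _ (Fin.le_last j), Fin.succ_last]
  rw [this, Fin.insertNth_apply_succAbove]

theorem nv_bd_H (f : Cell (nerveObj J' G) (n + 1)) (j : Fin (n + 1)) (δ : Bool)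
    (y : Fin (n + 1) → J'.Pt) :
    nv (bd (nerveObj J' G) j.castSucc δ (D.H f)) y =
      if D.τ (y (Fin.last n)) then
        nv f (D.clamp (D.pf G (nv f))
          (j.insertNth (α := fun _ => J'.Pt) (J'.end' δ) (Fin.init y)))
      else nv f (j.insertNth (α := fun _ => J'.Pt) (J'.end' δ) (Fin.init y)) := by
  rw [nv_bd, nv_H, HF, init_insertNth_castSucc, insertNth_castSucc_last]

theorem good_bd_H {f : Cell (nerveObj J' G) (n + 1)} {j : Fin (n + 1)} {i : Fin n}
    (h : D.Good (nv f) (j.succAbove i)) (δ : Bool) :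
    D.Good (nv (bd (nerveObj J' G) j.castSucc δ (D.H f))) i.castSucc := by
  have hu : ∀ x : Fin n → J'.Pt, j.insertNth (α := fun _ => J'.Pt) (J'.end' δ)
      (Function.update x i (D.ρ (x i))) =
      Function.update (j.insertNth (α := fun _ => J'.Pt) (J'.end' δ) x) (j.succAbove i)
        (D.ρ (j.insertNth (α := fun _ => J'.Pt) (J'.end' δ) x (j.succAbove i))) := by
    intro x
    rw [Fin.insertNth_apply_succAbove]
    symm
    rw [Fin.eq_insertNth_iff]
    refine ⟨?_, ?_⟩
    · rw [Function.update_of_ne (Fin.succAbove_ne j i).symm, Fin.insertNth_apply_same]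
    · funext l
      by_cases hl : l = i
      · subst hl; simp [Fin.removeNth]
      · have : j.succAbove l ≠ j.succAbove i := fun e => hl (Fin.succAbove_right_injective e)
        simp [Fin.removeNth, hl, this]
  intro y
  have hl : Function.update y i.castSucc (D.ρ (y i.castSucc)) (Fin.last n) = y (Fin.last n) :=
    Function.update_of_ne (Fin.castSucc_lt_last i).ne' _ _
  rw [nv_bd_H, nv_bd_H, hl, init_update_castSucc]
  have e := hu (Fin.init y)
  have h1 := h (j.insertNth (α := fun _ => J'.Pt) (J'.end' δ) (Fin.init y))
  have h2 := Good.clamp D h (D.pf G (nv f))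
    (j.insertNth (α := fun _ => J'.Pt) (J'.end' δ) (Fin.init y))
  simp only at h2
  rw [← e] at h1 h2
  exact congrArg₂ (fun a b => if D.τ (y (Fin.last n)) then a else b) h2 h1

theorem badSet_bd_H_subset (f : Cell (nerveObj J' G) (n + 1)) (j : Fin (n + 1)) (δ : Bool)
    {k : Fin (n + 1)} (hk : k ∈ D.badSet (nv (bd (nerveObj J' G) j.castSucc δ (D.H f)))) :
    ∃ i : Fin n, k = i.castSucc ∧ ¬ D.Good (nv f) (j.succAbove i) := by
  rw [mem_badSet] at hk
  induction k using Fin.lastCases with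
  | last =>
    refine absurd (fun y => ?_) hk
    rw [nv_bd_H, nv_bd_H, init_update_last, Function.update_self,
      show D.τ (D.ρ (y (Fin.last n))) = _ from D.τ_s_r _]
  | cast i => exact ⟨i, rfl, fun h => hk (D.good_bd_H h δ)⟩

open Classical in
/-- The bad coordinates other than `j`. -/
def badAway {V : Type*} (F : (Fin (n + 1) → J'.Pt) → V) (j : Fin (n + 1)) : Finset (Fin n) :=
  Finset.univ.filter fun i => ¬ D.Good F (j.succAbove i)

theorem mem_badAway {V : Type*} {F : (Fin (n + 1) → J'.Pt) → V} {j : Fin (n + 1)} {i : Fin n} :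
    i ∈ D.badAway F j ↔ ¬ D.Good F (j.succAbove i) := by simp [badAway]

theorem badSet_bd_H_subset' (f : Cell (nerveObj J' G) (n + 1)) (j : Fin (n + 1)) (δ : Bool) :
    D.badSet (nv (bd (nerveObj J' G) j.castSucc δ (D.H f))) ⊆
      (D.badAway (nv f) j).map Fin.castSuccEmb := by
  intro k hk
  obtain ⟨i, rfl, hi⟩ := D.badSet_bd_H_subset f j δ hk
  exact Finset.mem_map.2 ⟨i, D.mem_badAway.2 hi, rfl⟩

theorem map_badAway_subset {V : Type*} (F : (Fin (n + 1) → J'.Pt) → V) (j : Fin (n + 1)) :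
    (D.badAway F j).map j.succAboveEmb ⊆ D.badSet F := by
  intro k hk
  obtain ⟨i, hi, rfl⟩ := Finset.mem_map.1 hk
  exact D.mem_badSet.2 (D.mem_badAway.1 hi)

/-- A face of `H f` in the direction of a bad coordinate of `f` has fewer bad coordinates, since its
own are among those of `f` other than `j`. -/
theorem wt_bd_H_lt_of_bad {f : Cell (nerveObj J' G) (n + 1)} {j : Fin (n + 1)}
    (hj : ¬ D.Good (nv f) j) (δ : Bool) :
    D.wt (bd (nerveObj J' G) j.castSucc δ (D.H f)) < D.wt f := by
  refine D.wt_lt_of_card ?_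
  refine (Finset.card_le_card (D.badSet_bd_H_subset' f j δ)).trans_lt ?_
  rw [Finset.card_map, ← Finset.card_map j.succAboveEmb]
  refine Finset.card_lt_card (Finset.ssubset_iff_of_subset (D.map_badAway_subset _ j) |>.2
    ⟨j, D.mem_badSet.2 hj, fun h => ?_⟩)
  obtain ⟨i, -, hi⟩ := Finset.mem_map.1 h
  exact Fin.succAbove_ne j i hi

/-- A face of the homotopy in a good coordinate is a homotopy of a face, or has smaller
weight. -/
theorem bd_H_eq_or_wt_lt {f : Cell (nerveObj J' G) (n + 1)} {j : Fin (n + 1)}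
    (hj : D.Good (nv f) j) (δ : Bool) :
    bd (nerveObj J' G) j.castSucc δ (D.H f) = D.H (bd (nerveObj J' G) j δ f) ∨
      D.wt (bd (nerveObj J' G) j.castSucc δ (D.H f)) < D.wt f := by
  set p := D.pf G (nv f) with hp
  set q := if j.val < p then p - 1 else p with hq
  set e := nv (bd (nerveObj J' G) j δ f) with he
  have hpn := D.pf_le (nv f)
  have hqn : q ≤ n := by have := j.isLt; rw [hq]; split_ifs <;> omega
  have he' : ∀ x, e x = nv f (j.insertNth (α := fun _ => J'.Pt) (J'.end' δ) x) := fun x =>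
    nv_bd j δ f x
  have hcl : ∀ x, nv f (D.clamp p (j.insertNth (α := fun _ => J'.Pt) (J'.end' δ) x)) =
      e (D.clamp q x) := by
    intro x
    rw [clamp_insertNth, he', ← hq]
    split_ifs with h
    · have := hj (j.insertNth (α := fun _ => J'.Pt) (J'.end' δ) (D.clamp q x))
      rw [Fin.insertNth_apply_same] at this
      rw [← this]
      congr 1
      symm
      rw [Fin.eq_insertNth_iff]
      refine ⟨by simp, ?_⟩
      funext i
      simp [Fin.removeNth, Fin.succAbove_ne]
    · rfl
  have hF : nv (bd (nerveObj J' G) j.castSucc δ (D.H f)) = D.HF e q := by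
    funext y
    rw [nv_bd_H, HF, hcl, ← he']
  have hmov : D.Movable G e q := fun x => by
    rw [← hcl, he']
    exact D.movable_pf (nv f) _
  have hqe : q ≤ D.pf G e := Movable.le_pf D hmov hqn
  by_cases hgood : ∀ i : Fin n, q ≤ i.val → i.val < D.pf G e → D.Good e i
  · left
    refine nv_ext fun y => ?_
    rw [hF, nv_H, HF, HF, ← he, D.clamp_eq_of_good hqe hgood]
  · right
    push Not at hgood
    obtain ⟨i₀, hi₀, hi₀', hbad⟩ := hgood
    have hpfF : D.pf G e ≤ D.pf G (nv (bd (nerveObj J' G) j.castSucc δ (D.H f))) := by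
      refine Movable.le_pf D (fun y => ?_) ((D.pf_le e).trans (Nat.le_succ n))
      rw [hF, HF, HF, τ_clamp_last, init_clamp, clamp_clamp, max_comm, ← clamp_clamp]
      split_ifs
      · exact D.movable_pf e _
      · exact D.movable_pf e _
    have hi₀b : ¬ D.Good (nv f) (j.succAbove i₀) := by
      intro h
      have h1 := D.good_bd_H h δ
      apply hbad
      intro x
      have h2 := h1 (Fin.snoc (α := fun _ => J'.Pt) x (J'.end' D.ε))
      rw [hF] at h2
      have h3 : Function.update (Fin.snoc (α := fun _ => J'.Pt) x (J'.end' D.ε)) i₀.castSucc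
          (D.ρ (Fin.snoc (α := fun _ => J'.Pt) x (J'.end' D.ε) i₀.castSucc)) =
          Fin.snoc (α := fun _ => J'.Pt) (Function.update x i₀ (D.ρ (x i₀))) (J'.end' D.ε) := by
        rw [Fin.snoc_castSucc, ← Fin.snoc_update]
      rw [h3, HF_snoc, HF_snoc, D.τ_end, if_neg (by simp), if_neg (by simp)] at h2
      exact h2
    have hval : ∀ i : Fin n, (j.succAbove i).val < p ↔ i.val < q := by
      intro i
      rcases lt_or_ge i.castSucc j with hi | hi
      · rw [Fin.succAbove_of_castSucc_lt _ _ hi]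
        have : i.val < j.val := hi
        simp only [Fin.val_castSucc, hq]
        split_ifs <;> omega
      · rw [Fin.succAbove_of_le_castSucc _ _ hi]
        have : j.val ≤ i.val := hi
        simp only [Fin.val_succ, hq]
        split_ifs <;> omega
    refine D.wt_lt_of_le ?_ ?_
    · refine (Finset.card_le_card (D.badSet_bd_H_subset' f j δ)).trans ?_
      rw [Finset.card_map, ← Finset.card_map j.succAboveEmb]
      exact Finset.card_le_card (D.map_badAway_subset _ j)
    · let B := (D.badAway (nv f) j).filter fun i => q ≤ i.val
      have hB : i₀ ∈ B := Finset.mem_filter.2 ⟨D.mem_badAway.2 hi₀b, hi₀⟩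
      calc _ ≤ ((B.erase i₀).map Fin.castSuccEmb).card := by
            refine Finset.card_le_card fun k hk => ?_
            obtain ⟨hk, hk'⟩ := Finset.mem_filter.1 hk
            obtain ⟨i, rfl, hi⟩ := D.badSet_bd_H_subset f j δ hk
            rw [Fin.val_castSucc] at hk'
            refine Finset.mem_map.2 ⟨i, Finset.mem_erase.2 ⟨?_, Finset.mem_filter.2
              ⟨D.mem_badAway.2 hi, by omega⟩⟩, rfl⟩
            rintro rfl
            omega
        _ < B.card := by
            rw [Finset.card_map]
            exact Finset.card_erase_lt_of_mem hB
        _ = (B.map j.succAboveEmb).card := (Finset.card_map _).symm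
        _ ≤ _ := by
            refine Finset.card_le_card fun k hk => ?_
            obtain ⟨i, hi, rfl⟩ := Finset.mem_map.1 hk
            obtain ⟨hi, hi'⟩ := Finset.mem_filter.1 hi
            refine Finset.mem_filter.2 ⟨D.mem_badSet.2 (D.mem_badAway.1 hi), ?_⟩
            by_contra hlt
            exact absurd ((hval i).1 (not_le.1 hlt)) (not_lt.2 hi')

end Collapse

/-! ### The lifting property of a collapse -/

theorem Box.IsFace.forall_of_face {n : ℕ} {P : ∀ k, (Box.mk k ⟶ Box.mk (n + 1)) → Prop}
    (h : ∀ i δ, P n (Box.face i δ)) : ∀ {k} (f : Box.mk k ⟶ Box.mk (n + 1)), Box.IsFace f → P k f := by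
  rintro _ _ ⟨i, δ⟩
  exact h i δ

namespace Collapse

variable {J' J : Interval} (D : Collapse J' J) {G : DGra.{u}} {n : ℕ}

/-- The cubes of `N_{J'} G` that come from `N_J G`. -/
theorem exists_shrMap_eq_iff (f : Cell (nerveObj J' G) n) :
    (∃ g, (shrMap D.r G).app (op (Box.mk n)) g = f) ↔ ∀ i, D.Good (nv f) i := by
  constructor
  · rintro ⟨g, rfl⟩ i x
    rw [nv_shrMap, nv_shrMap]
    congr 1
    funext k
    by_cases hk : k = i
    · subst hk
      rw [Function.update_self]
      exact D.r_s _
    · rw [Function.update_of_ne hk]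
  · intro h
    have hρ : ∀ x : Fin n → J'.Pt, nv f (fun i => D.ρ (x i)) = nv f x := by
      intro x
      have h1 := D.clamp_eq_of_good (F := nv f) (Nat.zero_le n) (fun i _ _ => h i) x
      rw [clamp_zero] at h1
      rw [← h1]
      congr 1
      funext i
      simp [clamp]
    refine ⟨ncell (fun z => nv f fun i => D.s (z i)) ?_, nv_ext fun x => ?_⟩
    · intro x i a hxa
      have e : (fun k => D.s (Function.update x i a k)) =
          Function.update (fun k => D.s (x k)) i (D.s a) := by
        funext k
        by_cases hk : k = i
        · subst hk; simp
        · simp [hk]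
      rw [e]
      exact nv_arrow f _ i _ (D.s_arrow hxa)
    · rw [nv_shrMap, nv_ncell]
      exact hρ x

theorem good_H {f : Cell (nerveObj J' G) n} (h : ∀ i, D.Good (nv f) i) :
    ∀ i, D.Good (nv (D.H f)) i := by
  intro i
  rw [nv_H]
  induction i using Fin.lastCases with
  | last => exact D.good_HF_last _ _
  | cast i => exact Good.HF D (h i) _

/-- The inclusion of nerves induced by a collapse has the left lifting property against all
fibrations. The cubes outside the image are adjoined in pairs `f`, `H f`, each pair filling the
open box of the faces of `H f` other than `f`; the order of adjunction is by dimension and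
weight. -/
theorem exists_lift {X Y : cSet.{u}} {p : X ⟶ Y} (hp : IsFib p) (a : nerveObj J G ⟶ X)
    (b : nerveObj J' G ⟶ Y) (hab : a ≫ p = shrMap D.r G ≫ b) :
    ∃ l : nerveObj J' G ⟶ X, shrMap D.r G ≫ l = a ∧ l ≫ p = b := by
  let R : ∀ n, Cell (nerveObj J' G) n → Cell X n → Prop := fun n f x =>
    p.app (op (Box.mk n)) x = b.app (op (Box.mk n)) f
  have hR : ∀ {m n f x} (c : Box.mk m ⟶ Box.mk n), R n f x →
      R m (act (nerveObj J' G) c f) (act X c x) := fun c h => by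
    change p.app _ _ = b.app _ _
    rw [app_act, app_act, show p.app _ _ = b.app _ _ from h]
  let L₀ : PartialMap (nerveObj J' G) X R :=
    { rel := fun n f x => ∃ g, f = (shrMap D.r G).app (op (Box.mk n)) g ∧
        x = a.app (op (Box.mk n)) g
      func := by
        rintro n f x x' ⟨g, rfl, rfl⟩ ⟨g', hg, rfl⟩
        rw [shrMap_injective D.r hg]
      act_mem := by
        rintro m n f x c ⟨g, rfl, rfl⟩
        exact ⟨act _ c g, (app_act _ _ _).symm, (app_act _ _ _).symm⟩
      sub := by
        rintro n f x ⟨g, rfl, rfl⟩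
        exact app_of_congr hab g }
  have hL₀ : ∀ {n} {f : Cell (nerveObj J' G) n}, L₀.Dom f ↔ ∀ i, D.Good (nv f) i := by
    intro n f
    rw [← D.exists_shrMap_eq_iff]
    exact ⟨fun ⟨_, g, hg, _⟩ => ⟨g, hg.symm⟩, fun ⟨g, hg⟩ => ⟨_, g, hg.symm, rfl⟩⟩
  obtain ⟨l, hl, hlR⟩ := PartialMap.exists_hom
    (fun n m f g => ∃ h : n + 1 = m, g = h ▸ D.H f) L₀ (by
      rintro n _ f _ hf ⟨rfl, rfl⟩
      exact hL₀.2 (D.good_H (hL₀.1 hf))) (by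
    intro L hL hle hne
    have hLH : ∀ {n} {f : Cell (nerveObj J' G) n}, L.Dom f → L.Dom (D.H f) :=
      fun h => hL _ _ _ _ h ⟨rfl, rfl⟩
    classical
    -- an undefined cube of minimal dimension and minimal weight
    have hne' := Nat.find_spec hne
    have hmin : ∀ m < Nat.find hne, ∀ c : Cell (nerveObj J' G) m, L.Dom c := by
      intro m hm c
      by_contra hc
      exact Nat.find_min hne hm ⟨c, hc⟩
    generalize Nat.find hne = n at hne' hmin
    obtain ⟨f, hf, hwt⟩ := WellFounded.has_min
      (InvImage.wf (fun f : Cell (nerveObj J' G) n => D.wt f) wellFounded_lt)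
      {f | ¬ L.Dom f} hne'
    have hf : ¬ L.Dom f := hf
    have hwt : ∀ g : Cell (nerveObj J' G) n, D.wt g < D.wt f → L.Dom g := fun g hg => by
      by_contra hg'
      exact hwt g hg' hg
    have hbad : ∃ i, ¬ D.Good (nv f) i := by
      by_contra hcon
      push Not at hcon
      exact hf ((hL₀.2 hcon).mono hle)
    obtain ⟨n, rfl⟩ : ∃ m, n = m + 1 := ⟨n - 1, by
      obtain ⟨i, -⟩ := hbad
      have := i.isLt
      omega⟩
    have hnd : ¬ IsDegen _ f := by
      rintro ⟨k, hk, e, c, rfl⟩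
      exact hf ((hmin k hk c).act e)
    have hndH : ¬ IsDegen _ (D.H f) := D.not_isDegen_H hnd hbad fun h => hf (by
      rw [h]
      exact hLH (hmin n (Nat.lt_succ_self n) _))
    have hfaces : ∀ j δ, (j, δ) ≠ (Fin.last (n + 1), D.ε) →
        L.Dom (bd (nerveObj J' G) j δ (D.H f)) := by
      intro j δ hne
      induction j using Fin.lastCases with
      | last =>
        obtain rfl : δ = !D.ε := by
          have : δ ≠ D.ε := fun h => hne (by rw [h])
          revert this; cases δ <;> cases D.ε <;> simp
        exact hwt _ (D.wt_bd_last_H_lt hbad)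
      | cast j =>
        by_cases hj : D.Good (nv f) j
        · rcases D.bd_H_eq_or_wt_lt hj δ with h | h
          · rw [h]
            exact hLH (hmin n (Nat.lt_succ_self n) _)
          · exact hwt _ h
        · exact hwt _ (D.wt_bd_H_lt_of_bad hj δ)
    obtain ⟨x₀, -⟩ := hfaces (Fin.last (n + 1)) (!D.ε) (by simp)
    have hfaces' : ∀ j δ, ∃ x, (j, δ) ≠ (Fin.last (n + 1), D.ε) →
        L.rel _ (bd (nerveObj J' G) j δ (D.H f)) x := by
      intro j δ
      by_cases h : (j, δ) ≠ (Fin.last (n + 1), D.ε)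
      · exact (hfaces j δ h).imp fun x hx _ => hx
      · exact ⟨x₀, fun h' => absurd h' h⟩
    choose x hx using hfaces'
    obtain ⟨z, hz, hzf⟩ := hp (n + 1) (Fin.last (n + 1)) D.ε x
      (b.app (op (Box.mk (n + 2))) (D.H f)) (by
        intro m v v' j k δ δ' hj hk h
        have h1 := L.act_mem v (hx j δ hj)
        have h2 := L.act_mem v' (hx k δ' hk)
        rw [bd, act_act] at h1 h2
        rw [← h] at h2
        exact L.func h1 h2) (fun j δ h => by
        rw [← app_bd]
        exact L.sub (hx j δ h))
    have hzx : ∀ j δ, (j, δ) ≠ (Fin.last (n + 1), D.ε) →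
        L.rel _ (bd (nerveObj J' G) j δ (D.H f)) (bd X j δ z) := fun j δ h => by
      rw [hzf j δ h]
      exact hx j δ h
    have hbf := D.bd_last_H f
    let L₁ := L.adjoin hR f (bd X (Fin.last (n + 1)) D.ε z) (by
        change p.app _ _ = b.app _ _
        rw [app_bd, hz, ← app_bd, hbf]) hnd hf (by
        refine Box.IsFace.forall_of_face (P := fun k v => 
          L.rel k (act _ v f) (act _ v (bd X (Fin.last (n + 1)) D.ε z))) fun i δ => ?_
        have h1 := L.act_mem (Box.face (Fin.last n) D.ε)
          (hzx i.castSucc δ fun h => (Fin.castSucc_lt_last i).ne (congrArg Prod.fst h))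
        have h2 : act (nerveObj J' G) (Box.face i δ) f = bd (nerveObj J' G) (Fin.last n) D.ε
            (bd (nerveObj J' G) i.castSucc δ (D.H f)) := by
          conv_lhs => rw [← hbf]
          exact bd_bd (nerveObj J' G) (i := i) (j := Fin.last n) (Fin.le_last i) δ D.ε (D.H f)
        have h3 : act X (Box.face i δ) (bd X (Fin.last (n + 1)) D.ε z) =
            bd X (Fin.last n) D.ε (bd X i.castSucc δ z) :=
          bd_bd X (i := i) (j := Fin.last n) (Fin.le_last i) δ D.ε z
        rw [h2, h3]
        exact h1)
    have hL₁ : ∀ {m} {c : Cell (nerveObj J' G) m} {y}, L₁.rel m c y ↔ L.rel m c y ∨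
        ∃ v : Box.mk m ⟶ Box.mk (n + 1), c = act _ v f ∧
          y = act X v (bd X (Fin.last (n + 1)) D.ε z) := Iff.rfl
    have hdH : ¬ L₁.Dom (D.H f) := by
      rintro ⟨y, hy⟩
      rcases hL₁.1 hy with h | ⟨v, h, -⟩
      · refine hf ?_
        rw [← hbf]
        exact PartialMap.Dom.act ⟨y, h⟩ _
      · exact hndH ⟨n + 1, Nat.lt_succ_self _, v, f, h⟩
    let L₂ := L₁.adjoin hR (D.H f) z hz hndH hdH (by
        refine Box.IsFace.forall_of_face (P := fun k v => 
          L₁.rel k (act _ v (D.H f)) (act _ v z)) fun i δ => ?_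
        by_cases h : (i, δ) ≠ (Fin.last (n + 1), D.ε)
        · exact hL₁.2 (Or.inl (hzx i δ h))
        · rw [not_not, Prod.mk.injEq] at h
          obtain ⟨rfl, rfl⟩ := h
          exact hL₁.2 (Or.inr ⟨𝟙 _, by rw [act_id]; exact hbf, by rw [act_id]; rfl⟩))
    have hL₂ : ∀ {m} {c : Cell (nerveObj J' G) m}, L₂.Dom c ↔ L.Dom c ∨
        (∃ v : Box.mk m ⟶ Box.mk (n + 1), c = act _ v f) ∨
        ∃ v : Box.mk m ⟶ Box.mk (n + 2), c = act _ v (D.H f) := by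
      intro m c
      constructor
      · rintro ⟨y, (h | ⟨v, h, -⟩) | ⟨v, h, -⟩⟩
        · exact Or.inl ⟨y, h⟩
        · exact Or.inr (Or.inl ⟨v, h⟩)
        · exact Or.inr (Or.inr ⟨v, h⟩)
      · rintro (⟨y, h⟩ | ⟨v, h⟩ | ⟨v, h⟩)
        · exact ⟨y, Or.inl (Or.inl h)⟩
        · exact ⟨_, Or.inl (Or.inr ⟨v, h, rfl⟩)⟩
        · exact ⟨_, Or.inr ⟨v, h, rfl⟩⟩
    have hc1 : ∀ {m} (v : Box.mk m ⟶ Box.mk (n + 1)), L₂.Dom (D.H (act _ v f)) := by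
      intro m v
      rcases Box.surj_or_face v with hv | ⟨k, v, g, hg, rfl⟩
      · rw [D.H_surj hv]
        exact hL₂.2 (Or.inr (Or.inr ⟨_, rfl⟩))
      · rw [← act_act]
        have := hg.dim
        exact hL₂.2 (Or.inl (hLH ((hmin k (by omega) _).act v)))
    refine ⟨L₂, ?_, fun _ _ _ h => Or.inl (Or.inl h), n + 1, f, hf,
      hL₂.2 (Or.inr (Or.inl ⟨𝟙 _, by rw [act_id]⟩))⟩
    rintro m _ c _ hc ⟨rfl, rfl⟩
    rcases hL₂.1 hc with h | ⟨v, rfl⟩ | ⟨v, rfl⟩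
    · exact hL₂.2 (Or.inl (hLH h))
    · exact hc1 v
    · rcases Box.surj_or_face v with hv | ⟨k, v, g, hg, rfl⟩
      · refine hL₂.2 (Or.inr (Or.inr ⟨Box.cylMap v ≫ Box.conn (Fin.last (n + 1)) D.ε, ?_⟩))
        change D.H _ = _
        rw [D.H_surj hv, D.H_H, act_act]
      · change L₂.Dom (D.H _)
        rw [← act_act]
        clear hc
        revert v
        refine Box.IsFace.forall_of_face (P := fun k g => ∀ v : Box.mk m ⟶ Box.mk k,
          L₂.Dom (D.H (act _ v (act _ g (D.H f))))) (fun i δ v => ?_) g hg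
        by_cases h : (i, δ) ≠ (Fin.last (n + 1), D.ε)
        · exact hL₂.2 (Or.inl (hLH ((hfaces i δ h).act v)))
        · rw [not_not, Prod.mk.injEq] at h
          obtain ⟨rfl, rfl⟩ := h
          rw [show act (nerveObj J' G) (Box.face (Fin.last (n + 1)) D.ε) (D.H f) = f from hbf]
          exact hc1 v)
  refine ⟨l, ?_, ?_⟩
  · ext c g
    exact hl c.unop.dim _ _ ⟨g, rfl, rfl⟩
  · ext c f
    exact hlR c.unop.dim f

end Collapse

theorem stSection_stShrinking (k : ℕ) (a : (stInterval (k + 1)).Pt) :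
    (if Even k then ((stShrinking k).hom.toFun a).val else
      ((stShrinking k).hom.toFun a).val + 1) =
        if Even k then min a.val (k + 1) else a.val - 1 + 1 := by
  change (if Even k then (if Even k then min a.val (k + 1) else a.val - 1) else
    (if Even k then min a.val (k + 1) else a.val - 1) + 1) = _
  split_ifs <;> rfl

/-- The shrinkings of the sequence of standard intervals are collapses of an end arrow: of the
last one for even `k`, where `τ` consists of the vertices other than the first, and of the first one
for odd `k`, where `τ` consists of the first two vertices. -/
def stCollapse (k : ℕ) : Collapse (stInterval (k + 1)) (stInterval k) where
  r := stShrinking k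
  s a := ⟨if Even k then a.val else a.val + 1, by
    have : a.val < k + 2 := a.isLt
    change _ < k + 3
    split_ifs <;> omega⟩
  s_arrow {a b} h := by
    rw [stInterval_arrow_iff] at h ⊢
    by_cases hk : Even k
    · simp only [hk, if_true]
      rw [Nat.even_iff] at hk h ⊢
      omega
    · simp only [hk, if_false]
      rw [Nat.even_iff] at hk h ⊢
      omega
  r_s a := by
    have ha : a.val < k + 2 := a.isLt
    refine Fin.ext ?_
    change (if Even k then min (if Even k then a.val else a.val + 1) (k + 1) else
      (if Even k then a.val else a.val + 1) - 1) = a.val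
    split_ifs <;> omega
  fwd := decide (Even ((k + 1) / 2))
  arrow_s_r a := by
    have ha : a.val < k + 3 := a.isLt
    rw [stInterval_arrow_iff, stInterval_arrow_iff]
    simp only [stSection_stShrinking, decide_eq_true_eq]
    by_cases hk : Even k
    · simp only [hk, if_true]
      rw [Nat.even_iff] at hk
      split_ifs with hf <;> rw [Nat.even_iff] at hf ⊢ <;> omega
    · simp only [hk, if_false]
      rw [Nat.even_iff] at hk
      split_ifs with hf <;> rw [Nat.even_iff] at hf ⊢ <;> omega
  s_mono a b h := by
    have h : a.val ≤ b.val := h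
    rw [Fin.le_def]
    simp only
    split_ifs <;> omega
  τ a := if Even k then decide (1 ≤ a.val) else decide (a.val ≤ 1)
  ε := !decide (Even k)
  τ_arrow {a b} h hne := by
    rw [stInterval_arrow_iff] at h
    split_ifs at hne ⊢ with hk
    · have : ¬ (1 ≤ a.val ↔ 1 ≤ b.val) := fun e => hne (by simp only [e])
      rw [decide_eq_decide]
      rw [Nat.even_iff] at hk h ⊢
      omega
    · have : ¬ (a.val ≤ 1 ↔ b.val ≤ 1) := fun e => hne (by simp only [e])
      rw [decide_eq_decide]
      rw [Nat.even_iff] at hk h ⊢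
      omega
  τ_end := by
    by_cases hk : Even k
    · simp only [hk]
      rfl
    · simp only [hk]
      change decide (k + 2 ≤ 1) = false
      rw [decide_eq_false_iff_not]
      have : k ≠ 0 := fun h => hk (h ▸ ⟨0, rfl⟩)
      omega
  τ_end_not := by
    by_cases hk : Even k
    · simp only [hk]
      change decide (1 ≤ k + 2) = true
      rw [decide_eq_true_iff]
      omega
    · simp only [hk]
      rfl
  τ_s_r a := by
    simp only [stSection_stShrinking]
    split_ifs <;> rw [decide_eq_decide] <;> omega
  τ_op a b := by
    have hs : ((a ⊔ b : Fin (k + 3)) : ℕ) = max a.val b.val := rfl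
    have hi : ((a ⊓ b : Fin (k + 3)) : ℕ) = min a.val b.val := rfl
    by_cases hk : Even k
    · simp only [hk]
      change decide (1 ≤ ((a ⊔ b : Fin (k + 3)) : ℕ)) = _
      rw [hs, Bool.eq_iff_iff]
      simp
    · simp only [hk]
      change decide (((a ⊓ b : Fin (k + 3)) : ℕ) ≤ 1) = _
      rw [hi, Bool.eq_iff_iff]
      simp
  s_r_end := by
    refine Fin.ext ?_
    simp only [stSection_stShrinking]
    by_cases hk : Even k
    · simp only [hk]
      change min 0 (k + 1) = 0
      omega
    · simp only [hk]
      change (k + 2 - 1) + 1 = k + 2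
      omega

/-! ### Maps with the left lifting property against fibrations -/

/-- The left lifting property against all fibrations. -/
def IsAnodyne {A B : cSet.{u}} (i : A ⟶ B) : Prop :=
  ∀ ⦃X Y : cSet.{u}⦄ ⦃p : X ⟶ Y⦄, IsFib p → ∀ (a : A ⟶ X) (b : B ⟶ Y), a ≫ p = i ≫ b →
    ∃ l : B ⟶ X, i ≫ l = a ∧ l ≫ p = b

/-- The product `X × X`. -/
def square (X : cSet.{u}) : cSet.{u} where
  obj a := X.obj a × X.obj a
  map g := ↾fun z => (X.map g z.1, X.map g z.2)
  map_id a := by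
    refine ConcreteCategory.hom_ext _ _ fun z => ?_
    change (_, _) = (_, _)
    exact congrArg₂ Prod.mk (act_id X z.1) (act_id X z.2)
  map_comp g h := by
    refine ConcreteCategory.hom_ext _ _ fun z => ?_
    change (_, _) = (_, _)
    exact congrArg₂ Prod.mk (act_act X h.unop g.unop z.1).symm (act_act X h.unop g.unop z.2).symm

/-- The map to the product with given components. -/
def squareLift {A X : cSet.{u}} (f g : A ⟶ X) : A ⟶ square X where
  app a := ↾fun x => (f.app a x, g.app a x)
  naturality a b h := by
    refine ConcreteCategory.hom_ext _ _ fun x => ?_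
    change (_, _) = (_, _)
    exact congrArg₂ Prod.mk (app_act f h.unop x) (app_act g h.unop x)

/-- The projection of the product to the first or second factor. -/
def squareProj (X : cSet.{u}) (ε : Bool) : square X ⟶ X where
  app a := ↾fun z => if ε then z.2 else z.1
  naturality a b h := by
    cases ε <;> rfl

theorem squareLift_proj {A X : cSet.{u}} (f g : A ⟶ X) (ε : Bool) :
    squareLift f g ≫ squareProj X ε = if ε then g else f := by
  cases ε <;> rfl

theorem squareLift_ext {A X : cSet.{u}} {f g : A ⟶ square X}
    (h : ∀ ε, f ≫ squareProj X ε = g ≫ squareProj X ε) : f = g := by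
  ext a x
  exact Prod.ext (app_of_congr (h false) (n := a.unop.dim) x)
    (app_of_congr (h true) (n := a.unop.dim) x)

/-- The two ends of a path. -/
def pathEnds (X : cSet.{u}) : pathObj X ⟶ square X :=
  squareLift (pathEnd false X) (pathEnd true X)

theorem isFib_pathEnds {X : cSet.{u}} (hX : IsKan X) : IsFib (pathEnds X) := by
  intro n i ε x y hx hy
  let α : Bool → Cell X (n + 1) := fun δ => (squareProj X δ).app (op (Box.mk (n + 1))) y
  have hne : ∀ {j : Fin (n + 1)} {δ}, (j, δ) ≠ (i, ε) ↔ (j.castSucc, δ) ≠ (i.castSucc, ε) := by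
    intro j δ
    simp [Prod.ext_iff]
  have hne' : ∀ {δ}, (Fin.last (n + 1), δ) ≠ (i.castSucc, ε) := fun h =>
    (Fin.castSucc_lt_last i).ne' (congrArg Prod.fst h)
  obtain ⟨z, hz⟩ := hX.fill i.castSucc ε (pathFamily x α)
    (compat_pathFamily _ x (hx.mono fun _ _ h => hne.2 h) α (by
      intro j δ δ' hj _
      refine (app_bd (squareProj X δ') j δ y).symm.trans ?_
      rw [← hy j δ (hne.2 hj)]
      cases δ' <;> rfl))
  refine ⟨z, ?_, fun j δ h => ?_⟩
  · exact Prod.ext ((hz _ false hne').trans (pathFamily_last _ α _))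
      ((hz _ true hne').trans (pathFamily_last _ α _))
  · exact (bd_pathObj X j δ z).trans ((hz _ _ (hne.1 h)).trans (pathFamily_castSucc _ α j δ))

/-- Extensions along `i` of maps to Kan complexes exist since Kan complexes are fibrant, and they
are unique up to homotopy since the path object is fibrant over the square. -/
theorem IsAnodyne.isWeakEquiv {A B : cSet.{u}} {i : A ⟶ B} (hi : IsAnodyne i) :
    IsWeakEquiv i := by
  intro K hK
  have hext : ∀ a : A ⟶ K, ∃ g : B ⟶ K, i ≫ g = a := fun a =>
    (hi hK.isFib a (toPt B) rfl).imp fun _ h => h.1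
  have hrel : ∀ g g' : B ⟶ K, Nonempty (Htpy (i ≫ g) (i ≫ g')) → Nonempty (Htpy g g') := by
    rintro g g' ⟨H⟩
    obtain ⟨l, -, hl⟩ := hi (isFib_pathEnds hK) H.hom (squareLift g g') (by
      refine squareLift_ext fun ε => ?_
      rw [Category.assoc, Category.assoc, pathEnds, squareLift_proj, squareLift_proj]
      cases ε
      · exact H.left
      · exact H.right)
    have h := fun ε => congrArg (fun f => f ≫ squareProj K ε) hl
    simp only [Category.assoc, pathEnds, squareLift_proj] at h
    exact ⟨⟨l, h false, h true⟩⟩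
  constructor
  · rintro ⟨g⟩ ⟨g'⟩ hgg
    have h : Relation.EqvGen (fun f g : A ⟶ K => Nonempty (Htpy f g)) (i ≫ g) (i ≫ g') :=
      Quot.eqvGen_exact hgg
    clear hgg
    refine Quot.eqvGen_sound ?_
    generalize ha : i ≫ g = a at h
    generalize ha' : i ≫ g' = a' at h
    induction h generalizing g g' with
    | rel a a' h =>
      subst ha ha'
      exact Relation.EqvGen.rel _ _ (hrel g g' h)
    | refl a =>
      refine Relation.EqvGen.rel _ _ (hrel g g' ⟨⟨a ≫ constPath K, ?_, ?_⟩⟩)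
      · rw [ha]
        ext b x
        exact pathEnd_constPath K (n := b.unop.dim) false _
      · rw [ha']
        ext b x
        exact pathEnd_constPath K (n := b.unop.dim) true _
    | symm a a' _ ih => exact (ih _ _ ha' ha).symm
    | trans a b c _ _ ih ih' =>
      obtain ⟨g'', hg⟩ := hext b
      exact (ih _ _ ha hg).trans _ _ _ (ih' _ _ hg ha')
  · rintro ⟨a⟩
    obtain ⟨g, rfl⟩ := hext a
    exact ⟨Quot.mk _ g, rfl⟩

theorem stShr_self_succ (k : ℕ) : stShr (Nat.le_succ k) = stShrinking k := by
  rw [show stShr (Nat.le_succ k) = _ from stShr_succ (le_refl k), stShr_refl, Category.comp_id]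

/-- The inclusion of the first nerve in the infinite nerve is a sequential composite of the maps
of nerves that are induced by collapses. -/
theorem isAnodyne_inc_zero (G : DGra.{u}) : IsAnodyne (inc G 0) := by
  intro X Y p hp a b hab
  let S : ℕ → Type u := fun k =>
    {l : nerveObj (stInterval k) G ⟶ X // l ≫ p = inc G k ≫ b}
  have step : ∀ k (l : S k), ∃ l' : S (k + 1), shrMap (stShrinking k) G ≫ l'.1 = l.1 := by
    intro k l
    obtain ⟨l', h, h'⟩ := (stCollapse k).exists_lift hp l.1 (inc G (k + 1) ≫ b) (by
      rw [l.2, ← inc_trans (Nat.le_succ k), stShr_self_succ, Category.assoc]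
      rfl)
    exact ⟨⟨l', h'⟩, h⟩
  choose next hnext using step
  let l : ∀ k, S k := fun k => Nat.rec ⟨a, hab⟩ (fun k l => next k l) k
  have hl : ∀ k, shrMap (stShrinking k) G ≫ (l (k + 1)).1 = (l k).1 := fun k => hnext k (l k)
  let c : Cocone (nerveSequence.flip.obj G) :=
    ⟨X, NatTrans.ofSequence (fun k => (l k).1) fun k => by
      refine Eq.trans ?_ (Category.comp_id _).symm
      rw [← hl k, ← stShr_self_succ]
      rfl⟩
  have hc : ∀ k, inc G k ≫ colimit.desc (nerveSequence.flip.obj G) c = (l k).1 := fun k =>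
    colimit.ι_desc c k
  refine ⟨colimit.desc _ c, hc 0, colimit.hom_ext fun k => ?_⟩
  refine Eq.trans ?_ (l k).2
  exact (Category.assoc (inc G k) (colimit.desc (nerveSequence.flip.obj G) c : _ ⟶ X) p).symm.trans
    (congrArg (fun f => f ≫ p) (hc k))

theorem isWeakEquiv_nerveInf_map_iff {G H : DGra.{u}} (φ : G ⟶ H) :
    IsWeakEquiv (nerveInf.map φ) ↔ IsWeakEquiv ((nerve (stdInterval 1 false)).map φ) := by
  rw [← (isAnodyne_inc_zero G).isWeakEquiv.comp_iff_right, nerveInf_map_inc]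
  exact (isAnodyne_inc_zero H).isWeakEquiv.comp_iff_left ((nerve (stInterval 0)).map φ)

/-! ### The infinite nerve is a Kan complex -/

section lattice

variable {J : Interval} {ι : Type*}

theorem Interval.arrow_latOp (ε : Bool) (c : J.Pt) {x y : J.Pt} (h : J.toDGra.Arrow x y) :
    J.toDGra.Arrow (latOp ε x c) (latOp ε y c) := by
  cases ε
  · exact Interval.arrow_sup c h
  · exact Interval.arrow_inf c h

/-- The iterated lattice operation. -/
def latFold (ε : Bool) (S : Finset ι) (z : ι → J.Pt) : J.Pt := if ε then S.inf z else S.sup z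

theorem latFold_congr (ε : Bool) {S : Finset ι} {z z' : ι → J.Pt} (h : ∀ i ∈ S, z i = z' i) :
    latFold ε S z = latFold ε S z' := by
  cases ε
  · exact Finset.sup_congr rfl h
  · exact Finset.inf_congr rfl h

theorem latFold_insert [DecidableEq ι] (ε : Bool) (S : Finset ι) (i : ι) (z : ι → J.Pt) :
    latFold ε (insert i S) z = latOp ε (z i) (latFold ε S z) := by
  cases ε
  · exact Finset.sup_insert
  · exact Finset.inf_insert

theorem arrow_latFold [DecidableEq ι] (ε : Bool) (S : Finset ι) {z z' : ι → J.Pt} {i : ι}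
    (h : J.toDGra.Arrow (z i) (z' i)) (h' : ∀ j, j ≠ i → z j = z' j) :
    J.toDGra.Arrow (latFold ε S z) (latFold ε S z') := by
  by_cases hi : i ∈ S
  · rw [← Finset.insert_erase hi, latFold_insert, latFold_insert,
      latFold_congr ε fun j hj => h' j (Finset.ne_of_mem_erase hj)]
    exact Interval.arrow_latOp ε _ h
  · rw [latFold_congr ε fun j hj => h' j fun e => hi (e ▸ hj)]
    exact J.toDGra.refl _

theorem latFold_eq_end [DecidableEq ι] (ε : Bool) {S : Finset ι} {z : ι → J.Pt} {i : ι} (hi : i ∈ S)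
    (h : z i = J.end' (!ε)) : latFold ε S z = J.end' (!ε) := by
  rw [← Finset.insert_erase hi, latFold_insert, latOp_comm, h, latOp_end_not]

theorem latFold_eq_end_of_forall (ε : Bool) {S : Finset ι} {z : ι → J.Pt}
    (h : ∀ i ∈ S, z i = J.end' ε) : latFold ε S z = J.end' ε := by
  rw [latFold_congr ε h]
  cases ε
  · exact Finset.sup_bot S
  · exact Finset.inf_top S

end lattice

section openBox

variable {J : Interval} {G : DGra.{u}} {n : ℕ} {P : Fin (n + 1) → Bool → Prop}
  {f : Family (nerveObj J G) n}

theorem succ_succAbove_succAbove {n : ℕ} {i j : Fin (n + 1)} (h : i ≤ j) (t : Fin n) :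
    j.succ.succAbove (i.succAbove t) = i.castSucc.succAbove (j.succAbove t) := by
  have h : i.val ≤ j.val := h
  simp only [Fin.succAbove, Fin.lt_def, Fin.val_castSucc, Fin.val_succ]
  refine Fin.ext ?_
  split_ifs <;> simp only [Fin.val_castSucc, Fin.val_succ] at * <;> omega

theorem end'_injective (hJ : 0 < J.len) {ε δ : Bool} (h : J.end' ε = J.end' δ) : ε = δ := by
  have h := congrArg Fin.val h
  have h0 : (J.end' false).val = 0 := rfl
  have h1 : (J.end' true).val = J.len := rfl
  cases ε <;> cases δ <;> simp only [h0, h1] at h <;> first | rfl | omega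

/-- Compatible faces agree as functions on the points of the cube. -/
theorem Compat.nv_eq (hJ : 0 < J.len) (hf : Compat (nerveObj J G) P f) (y : Fin (n + 1) → J.Pt)
    {j k : Fin (n + 1)} {δ δ' : Bool} (hj : P j δ) (hk : P k δ') (hyj : y j = J.end' δ)
    (hyk : y k = J.end' δ') :
    nv (f j δ) (j.removeNth y) = nv (f k δ') (k.removeNth y) := by
  have key : ∀ (j k : Fin (n + 1)) (δ δ' : Bool), j < k → P j δ → P k δ' → y j = J.end' δ →
      y k = J.end' δ' → nv (f j δ) (j.removeNth y) = nv (f k δ') (k.removeNth y) := by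
    intro j k δ δ' hjk hj hk hyj hyk
    obtain ⟨n, rfl⟩ : ∃ m, n = m + 1 := ⟨n - 1, by
      have := Fin.lt_def.1 hjk
      have := k.isLt
      omega⟩
    obtain ⟨k, rfl⟩ := Fin.eq_succ_of_ne_zero (Fin.ne_zero_of_lt hjk)
    obtain ⟨j, rfl⟩ : ∃ j' : Fin (n + 1), j'.castSucc = j :=
      ⟨⟨j.val, by have := Fin.lt_def.1 hjk; rw [Fin.val_succ] at this; omega⟩, rfl⟩
    have hle : j ≤ k := by
      have := Fin.lt_def.1 hjk
      rw [Fin.val_succ, Fin.val_castSucc] at this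
      rw [Fin.le_def]; omega
    have h1 : (k.succ.removeNth y : Fin (n + 1) → J.Pt) = j.insertNth (α := fun _ => J.Pt)
        (J.end' δ) (j.removeNth (k.succ.removeNth y)) := by
      rw [Fin.eq_insertNth_iff]
      refine ⟨?_, rfl⟩
      rw [← hyj]
      exact congrArg y (Fin.succAbove_of_castSucc_lt _ _ (by
        rw [Fin.lt_def, Fin.val_castSucc, Fin.val_succ]
        exact Nat.lt_succ_of_le hle))
    have h2 : (j.castSucc.removeNth y : Fin (n + 1) → J.Pt) = k.insertNth (α := fun _ => J.Pt)
        (J.end' δ') (k.removeNth (j.castSucc.removeNth y)) := by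
      rw [Fin.eq_insertNth_iff]
      refine ⟨?_, rfl⟩
      rw [← hyk]
      exact congrArg y (Fin.succAbove_castSucc_of_le _ _ hle)
    have h3 : (j.removeNth (k.succ.removeNth y) : Fin n → J.Pt) =
        k.removeNth (j.castSucc.removeNth y) :=
      funext fun t => congrArg y (succ_succAbove_succAbove hle t)
    rw [h1, h2, ← nv_bd, ← nv_bd, hf.bd_eq hle hj hk, h3]
  rcases lt_trichotomy j k with hjk | rfl | hjk
  · exact key j k δ δ' hjk hj hk hyj hyk
  · obtain rfl := end'_injective hJ (hyj.symm.trans hyk)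
    rfl
  · exact (key k j δ' δ hjk hk hj hyk hyj).symm

theorem removeNth_update_self (j : Fin (n + 1)) (y : Fin (n + 1) → J.Pt) (a : J.Pt) :
    (j.removeNth (Function.update y j a) : Fin n → J.Pt) = j.removeNth y :=
  funext fun t => Function.update_of_ne (Fin.succAbove_ne j t) _ _

theorem removeNth_update_succAbove (j : Fin (n + 1)) (y : Fin (n + 1) → J.Pt) (t : Fin n)
    (a : J.Pt) : (j.removeNth (Function.update y (j.succAbove t) a) : Fin n → J.Pt) =
      Function.update (j.removeNth y) t a :=
  funext fun s => by
    by_cases h : s = t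
    · subst h; simp [Fin.removeNth]
    · rw [Function.update_of_ne h]
      exact Function.update_of_ne (fun e => h (Fin.succAbove_right_injective e)) _ _

/-- A digraph map on the union of the faces selected by `P`. -/
theorem Compat.exists_fun (hJ : 2 ≤ J.len) (hf : Compat (nerveObj J G) P f) :
    ∃ l : (Fin (n + 1) → J.Pt) → G.V,
      (∀ y j δ, P j δ → y j = J.end' δ → l y = nv (f j δ) (j.removeNth y)) ∧
      ∀ y c a, (∃ j δ, P j δ ∧ y j = J.end' δ) →
        (∃ j δ, P j δ ∧ Function.update y c a j = J.end' δ) → J.toDGra.Arrow (y c) a →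
        G.Arrow (l y) (l (Function.update y c a)) := by
  classical
  let l : (Fin (n + 1) → J.Pt) → G.V := fun y =>
    if h : ∃ p : Fin (n + 1) × Bool, P p.1 p.2 ∧ y p.1 = J.end' p.2 then
      nv (f h.choose.1 h.choose.2) (h.choose.1.removeNth y) else nv (f 0 false) fun _ => ⊥
  have hl : ∀ y j δ, P j δ → y j = J.end' δ → l y = nv (f j δ) (j.removeNth y) := by
    intro y j δ hj hy
    have h : ∃ p : Fin (n + 1) × Bool, P p.1 p.2 ∧ y p.1 = J.end' p.2 := ⟨(j, δ), hj, hy⟩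
    exact (dif_pos h).trans
      (hf.nv_eq (by omega) y h.choose_spec.1 hj h.choose_spec.2 hy)
  refine ⟨l, hl, ?_⟩
  rintro y c a ⟨j, δ, hj, hy⟩ ⟨k, δ', hk, hy'⟩ ha
  have main : ∀ (j) (δ), P j δ → y j = J.end' δ → Function.update y c a j = J.end' δ →
      G.Arrow (l y) (l (Function.update y c a)) := by
    intro j δ hj hy hy'
    rw [hl y j δ hj hy, hl _ j δ hj hy']
    rcases Fin.eq_self_or_eq_succAbove j c with rfl | ⟨t, rfl⟩
    · rw [removeNth_update_self]
      exact G.refl _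
    · rw [removeNth_update_succAbove]
      exact nv_arrow _ _ _ _ ha
  by_cases hjc : j = c
  · by_cases hkc : k = c
    · subst hjc
      subst hkc
      rw [Function.update_self] at hy'
      have : δ = δ' := by
        rw [hy, hy'] at ha
        have h0 : (J.end' false).val = 0 := rfl
        have h1 : (J.end' true).val = J.len := rfl
        rcases ha with ha | ⟨i, ⟨-, ha, ha'⟩ | ⟨-, ha, ha'⟩⟩
        · exact end'_injective (by omega) ha
        all_goals
          have ha := congrArg Fin.val ha
          have ha' := congrArg Fin.val ha'
          rw [Fin.val_castSucc] at *
          rw [Fin.val_succ] at *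
          cases δ <;> cases δ' <;> simp only [h0, h1] at ha ha' <;> first | rfl | omega
      subst this
      exact main _ δ hj hy (by rw [Function.update_self, hy'])
    · exact main k δ' hk (by rw [Function.update_of_ne hkc] at hy'; exact hy') hy'
  · exact main j δ hj hy (by rw [Function.update_of_ne hjc, hy])

end openBox

/-- Filling of open boxes in nerves after expansion of the interval. The cube of `J'` is mapped to
the open box by applying `s` to all coordinates other than `i`, and pushing the coordinate `i` towards
the face opposite to the missing one according to the values of `o`. -/
theorem exists_filler {J J' : Interval} {G : DGra.{u}} {n : ℕ} (s : J' ⟶ J) (o : J'.Pt → J.Pt)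
    (i : Fin (n + 1)) (ε : Bool) (ho : ∀ {a b}, J'.toDGra.Arrow a b → J.toDGra.Arrow (o a) (o b))
    (hend : ∀ δ, o (J'.end' δ) = J.end' ε)
    (hos : ∀ a, o a = J.end' (!ε) ∨ ∃ δ, s.hom.toFun a = J.end' δ)
    (hso : ∀ {a b}, J'.toDGra.Arrow a b → s.hom.toFun a = s.hom.toFun b ∨ o a = o b)
    (hJ : 2 ≤ J.len) (f : Family (nerveObj J G) n)
    (hf : Compat (nerveObj J G) (fun j δ => (j, δ) ≠ (i, ε)) f) :
    ∃ z : Cell (nerveObj J' G) (n + 1), ∀ j δ, (j, δ) ≠ (i, ε) →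
      bd (nerveObj J' G) j δ z = (shrMap s G).app (op (Box.mk n)) (f j δ) := by
  obtain ⟨l, hl, hla⟩ := hf.exists_fun hJ
  have hsend : ∀ δ, s.hom.toFun (J'.end' δ) = J.end' δ := by
    rintro (_ | _)
    · exact Interval.Shrinking.map_zero s
    · exact Interval.Shrinking.map_last s
  let S : Finset (Fin (n + 1)) := Finset.univ.erase i
  let d : (Fin (n + 1) → J'.Pt) → J.Pt := fun x => latFold (!ε) S fun j => o (x j)
  let Φ : (Fin (n + 1) → J'.Pt) → Fin (n + 1) → J.Pt := fun x =>
    Function.update (fun j => s.hom.toFun (x j)) i (latOp ε (s.hom.toFun (x i)) (d x))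
  have hΦi : ∀ x, Φ x i = latOp ε (s.hom.toFun (x i)) (d x) := fun x => Function.update_self _ _ _
  have hΦj : ∀ x j, j ≠ i → Φ x j = s.hom.toFun (x j) := fun x j h => Function.update_of_ne h _ _
  have hΦ : ∀ x, ∃ j δ, (j, δ) ≠ (i, ε) ∧ Φ x j = J.end' δ := by
    intro x
    by_cases h : ∀ j ∈ S, o (x j) = J.end' (!ε)
    · refine ⟨i, !ε, by simp, ?_⟩
      have hd : d x = J.end' (!ε) := latFold_eq_end_of_forall (!ε) h
      rw [hΦi, hd, latOp_end_not]
    · push Not at h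
      obtain ⟨j, hj, h⟩ := h
      have hji := Finset.ne_of_mem_erase hj
      obtain ⟨δ, hδ⟩ := (hos (x j)).resolve_left h
      exact ⟨j, δ, fun e => hji (congrArg Prod.fst e), (hΦj x j hji).trans hδ⟩
  refine ⟨ncell (fun x => l (Φ x)) ?_, ?_⟩
  · intro x c a ha
    obtain ⟨c', b, hb, e⟩ : ∃ c' b, J.toDGra.Arrow (Φ x c') b ∧
        Φ (Function.update x c a) = Function.update (Φ x) c' b := by
      have hx : ∀ j, j ≠ c → Function.update x c a j = x j := fun j h => Function.update_of_ne h _ _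
      have hxc : Function.update x c a c = a := Function.update_self _ _ _
      have hd : J.toDGra.Arrow (d x) (d (Function.update x c a)) := by
        refine arrow_latFold (!ε) S (i := c) ?_ fun j hj => ?_
        · simp only [hxc]
          exact ho ha
        · simp only [hx j hj]
      by_cases hci : c = i
      · subst hci
        have hd' : d (Function.update x c a) = d x :=
          latFold_congr _ fun j hj => by rw [hx j (Finset.ne_of_mem_erase hj)]
        refine ⟨c, latOp ε (s.hom.toFun a) (d x), ?_, ?_⟩
        · rw [hΦi]
          exact Interval.arrow_latOp ε _ (s.hom.map_arrow ha)
        · funext j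
          by_cases hj : j = c
          · subst hj
            rw [hΦi, hxc, hd', Function.update_self]
          · rw [hΦj _ _ hj, hx j hj, Function.update_of_ne hj, hΦj _ _ hj]
      · rcases hso ha with h | h
        · refine ⟨i, Φ (Function.update x c a) i, ?_, ?_⟩
          · rw [hΦi, hΦi, hx i (Ne.symm hci), latOp_comm, latOp_comm ε _ (d (Function.update x c a))]
            exact Interval.arrow_latOp ε _ hd
          · funext j
            by_cases hj : j = i
            · subst hj
              rw [Function.update_self]
            · rw [hΦj _ _ hj, Function.update_of_ne hj, hΦj _ _ hj]
              by_cases hjc : j = c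
              · subst hjc
                rw [hxc, h]
              · rw [hx j hjc]
        · have hd' : d (Function.update x c a) = d x :=
            latFold_congr _ fun j _ => by
              by_cases hjc : j = c
              · subst hjc
                rw [hxc, h]
              · rw [hx j hjc]
          refine ⟨c, s.hom.toFun a, ?_, ?_⟩
          · rw [hΦj _ _ hci]
            exact s.hom.map_arrow ha
          · funext j
            by_cases hj : j = i
            · subst hj
              rw [hΦi, hx j (Ne.symm hci), hd', Function.update_of_ne (Ne.symm hci), hΦi]
            · rw [hΦj _ _ hj]
              by_cases hjc : j = c
              · subst hjc
                rw [hxc, Function.update_self]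
              · rw [hx j hjc, Function.update_of_ne hjc, hΦj _ _ hj]
    rw [e]
    exact hla (Φ x) c' b (hΦ x) (e ▸ hΦ _) hb
  · intro j δ hne
    refine nv_ext fun x => ?_
    rw [nv_bd, nv_ncell, nv_shrMap]
    have hy : ∀ t, (j.insertNth (α := fun _ => J'.Pt) (J'.end' δ) x : Fin (n + 1) → J'.Pt)
        (j.succAbove t) = x t := fun t => Fin.insertNth_apply_succAbove _ _ _ _
    have hyj : (j.insertNth (α := fun _ => J'.Pt) (J'.end' δ) x : Fin (n + 1) → J'.Pt) j =
        J'.end' δ := Fin.insertNth_apply_same _ _ _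
    generalize (j.insertNth (α := fun _ => J'.Pt) (J'.end' δ) x : Fin (n + 1) → J'.Pt) = y at hy hyj
    by_cases hji : j = i
    · subst hji
      obtain rfl : δ = !ε := by
        have : δ ≠ ε := fun h => hne (by rw [h])
        revert this; cases δ <;> cases ε <;> simp
      rw [hl (Φ y) j (!ε) hne (by rw [hΦi, hyj, hsend, latOp_comm, latOp_end_not])]
      congr 1
      funext t
      exact (hΦj y _ (Fin.succAbove_ne j t)).trans (congrArg _ (hy t))
    · have hd : d y = J.end' ε := by
        have := latFold_eq_end (J := J) (!ε) (S := S) (z := fun j => o (y j)) (i := j)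
          (Finset.mem_erase.2 ⟨hji, Finset.mem_univ j⟩) (by
            rw [Bool.not_not, hyj]; exact hend δ)
        rwa [Bool.not_not] at this
      rw [hl (Φ y) j δ hne (by rw [hΦj y j hji, hyj, hsend])]
      congr 1
      funext t
      refine Eq.trans ?_ (congrArg _ (hy t))
      by_cases h : j.succAbove t = i
      · change Φ y (j.succAbove t) = _
        rw [h, hΦi, hd, latOp_end]
      · exact hΦj y _ h

/-! ### Expansion of the standard intervals -/

/-- The distance of a vertex of the interval of length `5 (k + 1)` from the middle part
of length `k + 1`. -/
def outer (k x : ℕ) : ℕ := max (2 * (k + 1) - x) (x - 3 * (k + 1))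

theorem outer_step {k a b : ℕ} (hk : k % 2 = 1) (h : a = b + 1 ∨ b = a + 1) :
    outer k a = outer k b ∨ ((outer k a = outer k b + 1 ∨ outer k b = outer k a + 1) ∧
      (outer k a + a) % 2 = 0) := by
  rw [outer, outer]
  omega

/-- The distance from the middle part, as a map to the interval of length `k + 1`, reversed
if `ε` is `false`. -/
def outerPt (k : ℕ) (ε : Bool) (x : (stInterval (k + 4 * (k + 1))).Pt) : (stInterval k).Pt :=
  (⟨if ε then min (outer k x.val) (k + 1) else k + 1 - outer k x.val, by split_ifs <;> omega⟩ :
    Fin (k + 2))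

theorem outerPt_val (k : ℕ) (ε : Bool) (x : (stInterval (k + 4 * (k + 1))).Pt) :
    (outerPt k ε x).val = if ε then min (outer k x.val) (k + 1) else k + 1 - outer k x.val := rfl

theorem end'_val (k : ℕ) (ε : Bool) : ((stInterval k).end' ε).val = if ε then k + 1 else 0 := by
  cases ε <;> rfl

/-- Open boxes in a nerve of the sequence can be filled further on in the sequence. -/
theorem exists_filler_stInterval {G : DGra.{u}} {n k : ℕ} (hk : Odd k) (i : Fin (n + 1)) (ε : Bool)
    (f : Family (nerveObj (stInterval k) G) n)
    (hf : Compat (nerveObj (stInterval k) G) (fun j δ => (j, δ) ≠ (i, ε)) f) :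
    ∃ z : Cell (nerveObj (stInterval (k + 4 * (k + 1))) G) (n + 1), ∀ j δ, (j, δ) ≠ (i, ε) →
      bd _ j δ z = (shrMap (stShr (Nat.le_add_right k (4 * (k + 1)))) G).app (op (Box.mk n))
        (f j δ) := by
  have hk2 : k % 2 = 1 := Nat.odd_iff.1 hk
  have hs : ∀ x : (stInterval (k + 4 * (k + 1))).Pt,
      ((stShr (Nat.le_add_right k (4 * (k + 1)))).hom.toFun x).val =
        min (x.val - 2 * (k + 1)) (k + 1) := by
    intro x
    refine (stShr_val _ x).trans ?_
    have : (k + 4 * (k + 1)) / 2 - k / 2 = 2 * (k + 1) := by omega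
    rw [this]
  refine exists_filler _ (outerPt k ε) i ε ?_ ?_ ?_ ?_ (by change 2 ≤ k + 1; omega) f hf
  · intro a b h
    rw [stInterval_arrow_iff] at h ⊢
    rw [outerPt_val, outerPt_val]
    have hkk : (k + 4 * (k + 1)) / 2 = k / 2 + 2 * (k + 1) := by omega
    rw [Nat.even_iff, hkk] at h
    rw [Nat.even_iff]
    rcases h with h | ⟨h, he⟩
    · rw [h]
      exact Or.inl rfl
    · have h' := outer_step hk2 h
      generalize outer k a.val = p at h' ⊢
      generalize outer k b.val = q at h' ⊢
      generalize k / 2 = c at he ⊢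
      clear hs hf f
      cases ε <;> simp only [if_true, Bool.false_eq_true, if_false] <;> omega
  · intro δ
    refine Fin.ext ?_
    rw [outerPt_val, end'_val, end'_val, outer]
    cases ε <;> cases δ <;> simp only [if_true, Bool.false_eq_true, if_false] <;> omega
  · intro a
    have hd : ∀ δ, (stShr (Nat.le_add_right k (4 * (k + 1)))).hom.toFun a =
        (stInterval k).end' δ ↔ min (a.val - 2 * (k + 1)) (k + 1) = if δ then k + 1 else 0 := by
      intro δ
      rw [← hs, ← end'_val]
      exact Fin.ext_iff
    simp only [hd, Bool.exists_bool]
    rw [Fin.ext_iff, outerPt_val, end'_val, outer]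
    cases ε <;> simp only [if_true, Bool.false_eq_true, if_false, Bool.not_true, Bool.not_false] <;>
      omega
  · intro a b h
    rw [stInterval_arrow_iff] at h
    have h1 : ∀ a b : (stInterval (k + 4 * (k + 1))).Pt,
        (stShr (Nat.le_add_right k (4 * (k + 1)))).hom.toFun a =
        (stShr (Nat.le_add_right k (4 * (k + 1)))).hom.toFun b ↔
        min (a.val - 2 * (k + 1)) (k + 1) = min (b.val - 2 * (k + 1)) (k + 1) := by
      intro a b
      rw [← hs, ← hs]
      exact Fin.ext_iff
    rw [h1, Fin.ext_iff, outerPt_val, outerPt_val]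
    have h : a.val = b.val ∨ a.val = b.val + 1 ∨ b.val = a.val + 1 := h.imp_right And.left
    have h2 : min (a.val - 2 * (k + 1)) (k + 1) = min (b.val - 2 * (k + 1)) (k + 1) ∨
        outer k a.val = outer k b.val := by
      rw [outer, outer]
      clear h1 hs
      omega
    refine h2.imp_right fun h2 => ?_
    rw [h2]

/-- Finitely many cubes of the infinite nerve lie in a common nerve of the sequence. -/
theorem exists_inc_family {G : DGra.{u}} {n : ℕ} {ι : Type*} [Fintype ι]
    (x : ι → Cell (nerveInf.obj G) n) :
    ∃ k₀, ∀ k, k₀ ≤ k → ∃ f : ι → Cell (nerveObj (stInterval k) G) n,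
      ∀ j, (inc G k).app (op (Box.mk n)) (f j) = x j := by
  choose k₀ hk₀ using fun j => exists_inc_ge (x j)
  refine ⟨Finset.univ.sup k₀, fun k hk => ?_⟩
  have := fun j => hk₀ j k ((Finset.le_sup (Finset.mem_univ j)).trans hk)
  choose f hf using this
  exact ⟨f, hf⟩

theorem isKan_nerveInf (G : DGra.{u}) : IsKan (nerveInf.obj G) := by
  refine isKan_of_fill fun n i ε x hx => ?_
  obtain ⟨k₀, hk₀⟩ := exists_inc_family fun p : Fin (n + 1) × Bool => x p.1 p.2
  obtain ⟨f, hf⟩ := hk₀ (2 * k₀ + 1) (by omega)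
  obtain ⟨z, hz⟩ := exists_filler_stInterval (k := 2 * k₀ + 1) ⟨k₀, rfl⟩ i ε
    (fun j δ => f (j, δ)) (by
      intro m v v' j k δ δ' hj hk h
      refine inc_injective ?_
      rw [app_act, app_act, hf, hf]
      exact hx v v' j k δ δ' hj hk h)
  refine ⟨(inc G _).app (op (Box.mk (n + 1))) z, fun j δ h => ?_⟩
  rw [← app_bd, hz j δ h, inc_trans_app]
  exact hf (j, δ)

/-! ### Loops and homotopies in nerves -/

section loop

variable {J : Interval} {G : DGra.{u}} {n : ℕ} {g : G.V}

theorem nv_cst_nerveVertex (J : Interval) (G : DGra.{u}) (g : G.V) (n : ℕ) (x : Fin n → J.Pt) :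
    nv (cst (nerveObj J G) n (nerveVertex J G g)) x = g := rfl

theorem isLoop_nerve_iff {f : Cell (nerveObj J G) n} :
    IsLoop (nerveObj J G) (nerveVertex J G g) f ↔ ∀ x i ε, x i = J.end' ε → nv f x = g := by
  cases n with
  | zero => exact ⟨fun _ x i => i.elim0, fun _ => sameBd_zero _ _⟩
  | succ n =>
    rw [IsLoop, sameBd_succ]
    constructor
    · intro h x i ε hx
      have := congrArg (fun c => nv c (i.removeNth x)) (h i ε)
      simp only [nv_bd, nv_cst_nerveVertex] at this
      rwa [← hx, Fin.insertNth_self_removeNth] at this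
    · intro h i ε
      refine nv_ext fun x => ?_
      rw [nv_bd, nv_bd, nv_cst_nerveVertex]
      exact h _ i ε (Fin.insertNth_apply_same _ _ _)

theorem htpyRel_iff_bd {X : cSet.{u}} {n : ℕ} {x : Cell X 0} {α β : Cell X n} :
    HtpyRel X x α β ↔ ∃ z : Cell X (n + 1), (∀ (i : Fin n) ε,
      bd X i.castSucc ε z = bd X i.castSucc ε (cst X (n + 1) x)) ∧
      bd X (Fin.last n) false z = α ∧ bd X (Fin.last n) true z = β :=
  htpyRel_iff.trans (exists_congr fun _ => and_congr_left' sameBd_path)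

theorem htpyRel_nerve_iff {f f' : Cell (nerveObj J G) n} :
    HtpyRel (nerveObj J G) (nerveVertex J G g) f f' ↔
      ∃ F : Cell (nerveObj J G) (n + 1), (∀ x (i : Fin n) ε, x i.castSucc = J.end' ε → nv F x = g) ∧
        (∀ x, nv F (Fin.snoc (α := fun _ => J.Pt) x (J.end' false)) = nv f x) ∧
        ∀ x, nv F (Fin.snoc (α := fun _ => J.Pt) x (J.end' true)) = nv f' x := by
  refine htpyRel_iff_bd.trans (exists_congr fun F => and_congr ?_ (and_congr ?_ ?_))
  · constructor
    · intro h x i ε hx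
      have := congrArg (fun c => nv c (i.castSucc.removeNth x)) (h i ε)
      simp only [nv_bd, nv_cst_nerveVertex] at this
      rwa [← hx, Fin.insertNth_self_removeNth] at this
    · intro h i ε
      refine nv_ext fun x => ?_
      rw [nv_bd, nv_bd, nv_cst_nerveVertex]
      exact h _ i ε (Fin.insertNth_apply_same _ _ _)
  · constructor
    · rintro rfl x
      rw [nv_bd, Fin.insertNth_last']
    · intro h
      refine nv_ext fun x => ?_
      rw [nv_bd, Fin.insertNth_last', h]
  · constructor
    · rintro rfl x
      rw [nv_bd, Fin.insertNth_last']
    · intro h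
      refine nv_ext fun x => ?_
      rw [nv_bd, Fin.insertNth_last', h]

theorem isLoop_inc_iff {k : ℕ} {v : Cell (nerveObj (stInterval k) G) 0}
    {f : Cell (nerveObj (stInterval k) G) n} :
    IsLoop (nerveInf.obj G) ((inc G k).app (op (Box.mk 0)) v) ((inc G k).app (op (Box.mk n)) f) ↔
      IsLoop (nerveObj (stInterval k) G) v f := by
  refine ⟨fun h m c hc => inc_injective ?_, fun h => h.app _⟩
  rw [app_act, app_act, app_cst]
  exact h c hc

theorem inc_nerveVertex (G : DGra.{u}) (g : G.V) (k : ℕ) :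
    (inc G k).app (op (Box.mk 0)) (nerveVertex (stInterval k) G g) = nerveInfVertex G g :=
  inc_trans_app (Nat.zero_le k) (nerveVertex (stInterval 0) G g) ▸ rfl

theorem exists_nerveInfVertex (x : Cell (nerveInf.obj G) 0) : ∃ g, nerveInfVertex G g = x := by
  obtain ⟨k, f, rfl⟩ := exists_inc x
  refine ⟨nv f fun i => i.elim0, ?_⟩
  rw [← inc_nerveVertex G _ k]
  congr 1
  refine nv_ext fun x => ?_
  exact congrArg (nv f) (Subsingleton.elim _ _)

/-- A homotopy of loops in the infinite nerve lies in a nerve of the sequence. -/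
theorem exists_htpyRel_of_inc {k : ℕ} {f f' : Cell (nerveObj (stInterval k) G) n}
    (h : HtpyRel (nerveInf.obj G) (nerveInfVertex G g) ((inc G k).app (op (Box.mk n)) f)
      ((inc G k).app (op (Box.mk n)) f')) :
    ∃ k', ∃ hk : k ≤ k', HtpyRel (nerveObj (stInterval k') G) (nerveVertex (stInterval k') G g)
      ((shrMap (stShr hk) G).app (op (Box.mk n)) f)
      ((shrMap (stShr hk) G).app (op (Box.mk n)) f') := by
  obtain ⟨z, hz, h0, h1⟩ := htpyRel_iff_bd.1 h
  obtain ⟨k₀, hk₀⟩ := exists_inc_ge z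
  obtain ⟨F, rfl⟩ := hk₀ (max k k₀) (le_max_right _ _)
  refine ⟨max k k₀, le_max_left _ _, htpyRel_iff_bd.2 ⟨F, fun i ε => ?_, ?_, ?_⟩⟩
  · refine inc_injective ?_
    rw [app_bd, app_bd, app_cst, inc_nerveVertex]
    exact hz i ε
  · refine inc_injective ?_
    rw [inc_trans_app, app_bd]
    exact h0
  · refine inc_injective ?_
    rw [inc_trans_app, app_bd]
    exact h1

end loop

/-! ### Homotopy classes of maps of pairs -/

section chain

variable {J : Interval}

/-- Classes of a family of maps of pairs that is indexed by the vertices of an interval. -/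
theorem classes_eq_of_chain {P : DPair.{v}} {Q : DPair.{u}} (F : J.Pt → DPair.Hom P Q)
    (h : ∀ a b, J.toDGra.Arrow a b → DPair.HomArrow (F a) (F b)) (a b : J.Pt) :
    (Quot.mk _ (F a) : DPair.Classes P Q) = Quot.mk _ (F b) := by
  have key : ∀ t : J.Pt, (Quot.mk _ (F t) : DPair.Classes P Q) = Quot.mk _ (F 0) := by
    intro t
    induction t using Fin.induction with
    | zero => rfl
    | succ i ih =>
      rw [← ih]
      by_cases hi : J.fwd i = true
      · exact (Quot.sound (h _ _ (Or.inr ⟨i, Or.inl ⟨hi, rfl, rfl⟩⟩))).symm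
      · exact Quot.sound (h _ _ (Or.inr ⟨i, Or.inr ⟨Bool.eq_false_of_not_eq_true hi, rfl, rfl⟩⟩))
  rw [key a, key b]

theorem arrow_le_or_le {a a' b b' : J.Pt} (h : J.toDGra.Arrow a a') (h' : J.toDGra.Arrow b b') :
    (a ≤ b ∧ a' ≤ b') ∨ (b ≤ a ∧ b' ≤ a') := by
  have key : ∀ {a a' : J.Pt}, J.toDGra.Arrow a a' → a = a' ∨ ∃ i : Fin J.len,
      (J.fwd i = true ∧ a.val = i.val ∧ a'.val = i.val + 1) ∨
      (J.fwd i = false ∧ a.val = i.val + 1 ∧ a'.val = i.val) := by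
    rintro a a' (h | ⟨i, ⟨h, rfl, rfl⟩ | ⟨h, rfl, rfl⟩⟩)
    · exact Or.inl h
    · exact Or.inr ⟨i, Or.inl ⟨h, rfl, rfl⟩⟩
    · exact Or.inr ⟨i, Or.inr ⟨h, rfl, rfl⟩⟩
  simp only [Fin.le_def]
  have h1 := key h
  have h2 := key h'
  clear key h h'
  rcases h1 with rfl | ⟨i, hi⟩ <;> rcases h2 with rfl | ⟨j, hj⟩
  · omega
  · omega
  · omega
  · by_cases hij : i = j
    · subst hij
      rcases hi with hi | hi <;> rcases hj with hj | hj
      · omega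
      · exact absurd (hi.1.symm.trans hj.1) (by simp)
      · exact absurd (hi.1.symm.trans hj.1) (by simp)
      · omega
    · have := fun e => hij (Fin.ext e)
      omega

theorem arrow_inf_inf {a a' b b' : J.Pt} (h : J.toDGra.Arrow a a') (h' : J.toDGra.Arrow b b') :
    J.toDGra.Arrow (a ⊓ b) (a' ⊓ b') := by
  rcases arrow_le_or_le h h' with ⟨h1, h2⟩ | ⟨h1, h2⟩
  · rwa [inf_eq_left.2 h1, inf_eq_left.2 h2]
  · rwa [inf_eq_right.2 h1, inf_eq_right.2 h2]

end chain

/-- A digraph map of intervals that preserves the end-points. -/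
structure EndMap (K J : Interval) where
  hom : DGra.Hom K.toDGra J.toDGra
  map_end : ∀ ε, hom.toFun (K.end' ε) = J.end' ε

namespace EndMap

variable {K J : Interval}

/-- Shrinkings preserve the end-points. -/
def ofShrinking (s : K ⟶ J) : EndMap K J where
  hom := s.hom
  map_end := by
    rintro (_ | _)
    · exact Interval.Shrinking.map_zero s
    · exact Interval.Shrinking.map_last s

/-- The pointwise minimum of two end-preserving maps. -/
def inf (s s' : EndMap K J) : EndMap K J where
  hom := ⟨fun x => (s.hom.toFun x ⊓ s'.hom.toFun x : J.Pt), fun h =>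
    arrow_inf_inf (s.hom.map_arrow h) (s'.hom.map_arrow h)⟩
  map_end ε := by
    change (s.hom.toFun (K.end' ε) ⊓ s'.hom.toFun (K.end' ε) : J.Pt) = _
    rw [s.map_end, s'.map_end]
    exact inf_idem _

/-- The map `s ⊓ (s' ⊔ c)`, which interpolates between `s ⊓ s'` and `s`. -/
def interp (s s' : EndMap K J) (c : J.Pt) : EndMap K J where
  hom := ⟨fun x => (s.hom.toFun x ⊓ (s'.hom.toFun x ⊔ c : J.Pt) : J.Pt), fun h =>
    arrow_inf_inf (s.hom.map_arrow h) (Interval.arrow_sup c (s'.hom.map_arrow h))⟩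
  map_end ε := by
    change (s.hom.toFun (K.end' ε) ⊓ (s'.hom.toFun (K.end' ε) ⊔ c : J.Pt) : J.Pt) = _
    rw [s.map_end, s'.map_end]
    exact inf_sup_self

/-- An end-preserving map as a map of pairs. -/
def toPairHom (s : EndMap K J) : DPair.Hom K.toPair J.toPair where
  hom := s.hom
  map_sub := by
    rintro x (rfl | rfl)
    · exact Or.inl (s.map_end false)
    · exact Or.inr (s.map_end true)

variable {n : ℕ} {G : PDGra.{u}} {J : Fin n → Interval}

/-- The class of the composite of a map of pairs with end-preserving maps of intervals. -/
def pull (f : DPair.Hom (DPair.boxProd fun i => (J i).toPair) G.toPair)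
    (σ : ∀ i, EndMap K (J i)) :
    DPair.Classes (DPair.boxProd fun _ : Fin n => K.toPair) G.toPair :=
  Quot.mk _ ((DPair.boxProdMap fun i => (σ i).toPairHom).comp f)

theorem pull_update_inf (f : DPair.Hom (DPair.boxProd fun i => (J i).toPair) G.toPair)
    (σ : ∀ i, EndMap K (J i)) (i : Fin n) (s s' : EndMap K (J i)) :
    pull f (Function.update σ i (s.inf s')) = pull f (Function.update σ i s) := by
  have h0 : s.interp s' ⊥ = s.inf s' := by
    have : ∀ x, (s.hom.toFun x ⊓ (s'.hom.toFun x ⊔ ⊥ : (J i).Pt) : (J i).Pt) =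
        s.hom.toFun x ⊓ s'.hom.toFun x := fun x => by rw [sup_bot_eq]
    rw [interp, inf]
    congr 2
    exact funext this
  have h1 : s.interp s' ⊤ = s := by
    obtain ⟨s, hs⟩ := s
    rw [interp]
    congr 1
    refine DGra.Hom.ext (funext fun x => ?_)
    change (s.toFun x ⊓ (s'.hom.toFun x ⊔ ⊤ : (J i).Pt) : (J i).Pt) = s.toFun x
    rw [sup_top_eq, inf_top_eq]
  rw [← h0]
  conv_rhs => rw [← h1]
  refine classes_eq_of_chain (J := J i) (fun c => (DPair.boxProdMap fun j =>
    (Function.update σ i (s.interp s' c) j).toPairHom).comp f) (fun a b h => ⟨fun x => ?_,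
      fun x hx => ?_⟩) ⊥ ⊤
  · refine f.hom.map_arrow (Or.inr ⟨i, ?_, fun j hj => ?_⟩)
    · change (J i).toDGra.Arrow ((Function.update σ i (s.interp s' a) i).hom.toFun (x i))
        ((Function.update σ i (s.interp s' b) i).hom.toFun (x i))
      rw [Function.update_self, Function.update_self]
      refine arrow_inf_inf ((J i).toDGra.refl _) ?_
      have := Interval.arrow_sup (J := J i) (s'.hom.toFun (x i)) h
      rw [sup_comm a, sup_comm b] at this
      exact this
    · change (Function.update σ i (s.interp s' a) j).hom.toFun (x j) =
        (Function.update σ i (s.interp s' b) j).hom.toFun (x j)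
      rw [Function.update_of_ne hj, Function.update_of_ne hj]
  · exact (((DPair.boxProdMap fun j =>
      (Function.update σ i (s.interp s' a) j).toPairHom).comp f).map_sub x hx).trans
      (((DPair.boxProdMap fun j =>
      (Function.update σ i (s.interp s' b) j).toPairHom).comp f).map_sub x hx).symm

theorem eq_of_update {n : ℕ} {α : Fin n → Type*} {β : Type*} (Φ : (∀ i, α i) → β)
    (h : ∀ σ i a b, Φ (Function.update σ i a) = Φ (Function.update σ i b)) (σ τ : ∀ i, α i) :
    Φ σ = Φ τ := by
  classical
  have key : ∀ S : Finset (Fin n), Φ (S.piecewise σ τ) = Φ τ := by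
    intro S
    induction S using Finset.induction_on with
    | empty => rw [Finset.piecewise_empty]
    | insert i S hi ih =>
      rw [Finset.piecewise_insert, h _ i _ (τ i), ← ih]
      congr 1
      rw [Function.update_eq_self_iff, Finset.piecewise_eq_of_notMem _ _ _ hi]
  have := key Finset.univ
  rwa [Finset.piecewise_univ] at this

/-- The class of a composite does not depend on the end-preserving maps. -/
theorem pull_eq (f : DPair.Hom (DPair.boxProd fun i => (J i).toPair) G.toPair)
    (σ τ : ∀ i, EndMap K (J i)) : pull f σ = pull f τ := by
  refine eq_of_update (pull f) (fun σ i a b => ?_) σ τ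
  have hc : a.inf b = b.inf a := by
    rw [inf, inf]
    congr 2
    exact funext fun x => inf_comm _ _
  rw [← pull_update_inf f σ i a b, hc, pull_update_inf]

end EndMap

/-! ### Shrinkings of the standard intervals onto a given interval -/

theorem interval_arrow_of {J : Interval} {a b : J.Pt} {p q : ℕ} (ha : a.val = p) (hb : b.val = q)
    (h : p = q ∨ (∃ h : p < J.len, q = p + 1 ∧ J.fwd ⟨p, h⟩ = true) ∨
      (∃ h : q < J.len, p = q + 1 ∧ J.fwd ⟨q, h⟩ = false)) : J.toDGra.Arrow a b := by
  subst ha hb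
  rcases h with h | ⟨h, h', hf⟩ | ⟨h, h', hf⟩
  · exact Or.inl (Fin.ext h)
  · exact Or.inr ⟨⟨a.val, h⟩, Or.inl ⟨hf, rfl, Fin.ext h'⟩⟩
  · exact Or.inr ⟨⟨b.val, h⟩, Or.inr ⟨hf, Fin.ext h', rfl⟩⟩

/-- Even vertices of the standard interval are sent to half their value; the odd vertex `2 i + 1`
is sent to the target of the arrow between `i` and `i + 1`. -/
def halfFun (J : Interval) (x : ℕ) : ℕ :=
  min J.len (x / 2 + if h : x / 2 < J.len then (if x % 2 = 1 ∧ J.fwd ⟨x / 2, h⟩ = true then 1 else 0)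
    else 0)

theorem halfFun_eq {J : Interval} {i : ℕ} (h : i < J.len) : halfFun J (2 * i) = i ∧
    halfFun J (2 * i + 2) = i + 1 ∧
    halfFun J (2 * i + 1) = if J.fwd ⟨i, h⟩ = true then i + 1 else i := by
  have e1 : 2 * i / 2 = i := by omega
  have e2 : (2 * i + 2) / 2 = i + 1 := by omega
  have e3 : (2 * i + 1) / 2 = i := by omega
  have m1 : 2 * i % 2 = 0 := by omega
  have m2 : (2 * i + 2) % 2 = 0 := by omega
  have m3 : (2 * i + 1) % 2 = 1 := by omega
  simp only [halfFun, e1, e2, e3, m1, m2, m3, h]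
  refine ⟨?_, ?_, ?_⟩
  · simp; omega
  · simp; omega
  · simp; split_ifs <;> omega

theorem halfFun_of_le {J : Interval} {x : ℕ} (hx : 2 * J.len ≤ x) : halfFun J x = J.len := by
  rw [halfFun]
  omega

theorem halfFun_le_succ (J : Interval) (x : ℕ) : halfFun J x ≤ halfFun J (x + 1) := by
  by_cases h : x / 2 < J.len
  · obtain ⟨h1, h2, h3⟩ := halfFun_eq h
    rcases Nat.mod_two_eq_zero_or_one x with hx | hx
    · have e : 2 * (x / 2) = x := by omega
      rw [e] at h1 h3
      rw [h1, h3]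
      split_ifs <;> omega
    · have e : 2 * (x / 2) + 1 = x := by omega
      have e' : 2 * (x / 2) + 2 = x + 1 := by omega
      rw [e] at h3
      rw [e'] at h2
      rw [h2, h3]
      split_ifs <;> omega
  · rw [halfFun_of_le (by omega), halfFun_of_le (by omega)]

/-- A shrinking of a standard interval onto `J`. -/
def halfShrinking (J : Interval) : stInterval (4 * J.len) ⟶ J where
  hom :=
    { toFun := fun x => (⟨halfFun J x.val, by rw [halfFun]; omega⟩ : J.Pt)
      map_arrow := fun {x y} h => by
        rw [stInterval_arrow_iff, Nat.even_iff] at h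
        refine interval_arrow_of (p := halfFun J x.val) (q := halfFun J y.val) rfl rfl ?_
        rcases h with h | ⟨h | h, he⟩
        · exact Or.inl (by rw [h])
        · obtain ⟨d, hd⟩ : ∃ d, y.val = 2 * d + 1 := ⟨y.val / 2, by omega⟩
          have hx : x.val = 2 * d + 2 := by omega
          rw [hd, hx]
          by_cases hdl : d < J.len
          · obtain ⟨-, h2, h3⟩ := halfFun_eq hdl
            by_cases hf : J.fwd ⟨d, hdl⟩ = true
            · rw [if_pos hf] at h3
              exact Or.inl (h2.trans h3.symm)
            · rw [if_neg hf] at h3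
              simp only [h2, h3]
              exact Or.inr (Or.inr ⟨hdl, trivial, Bool.eq_false_of_not_eq_true hf⟩)
          · exact Or.inl (by rw [halfFun_of_le (by omega), halfFun_of_le (by omega)])
        · obtain ⟨d, hd⟩ : ∃ d, x.val = 2 * d := ⟨x.val / 2, by omega⟩
          have hy : y.val = 2 * d + 1 := by omega
          rw [hd, hy]
          by_cases hdl : d < J.len
          · obtain ⟨h1, -, h3⟩ := halfFun_eq hdl
            by_cases hf : J.fwd ⟨d, hdl⟩ = true
            · rw [if_pos hf] at h3
              simp only [h1, h3]
              exact Or.inr (Or.inl ⟨hdl, trivial, hf⟩)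
            · rw [if_neg hf] at h3
              exact Or.inl (h1.trans h3.symm)
          · exact Or.inl (by rw [halfFun_of_le (by omega), halfFun_of_le (by omega)]) }
  surj := by
    intro y
    have hy : y.val < J.len + 1 := y.isLt
    refine ⟨(⟨2 * y.val, by omega⟩ : Fin (4 * J.len + 2)), Fin.ext ?_⟩
    change halfFun J (2 * y.val) = y.val
    by_cases h : y.val < J.len
    · exact (halfFun_eq h).1
    · rw [halfFun_of_le (by omega)]
      omega
  mono := fun x y h => monotone_nat_of_le_succ (halfFun_le_succ J) (show x.val ≤ y.val from h)

/-- Finitely many intervals are shrinkings of a common standard interval. -/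
theorem exists_shrinkings {n : ℕ} (J : Fin n → Interval) :
    ∃ k, Nonempty (∀ i, stInterval k ⟶ J i) :=
  ⟨Finset.univ.sup fun i => 4 * (J i).len, ⟨fun i => stShr (Finset.le_sup
    (f := fun i => 4 * (J i).len) (Finset.mem_univ i)) ≫ halfShrinking (J i)⟩⟩

/-! ### From classes of maps of pairs to homotopy groups of the infinite nerve -/

section classPi

variable {n : ℕ} {G : PDGra.{u}}

/-- Maps of pairs from the cube `K^{⊗ n}` with its boundary to a pointed digraph. -/
abbrev CubeHom (K : Interval) (n : ℕ) (G : PDGra.{u}) : Type u :=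
  DPair.Hom (DPair.boxProd fun _ : Fin n => K.toPair) G.toPair

/-- The cube of the nerve that underlies a map of pairs. -/
def CubeHom.cell {K : Interval} (f : CubeHom K n G) : Cell (nerveObj K G.G) n := f.hom

theorem CubeHom.isLoop {K : Interval} (f : CubeHom K n G) :
    IsLoop (nerveObj K G.G) (nerveVertex K G.G G.pt) f.cell :=
  isLoop_nerve_iff.2 fun x i ε hx => f.map_sub x ⟨i, by
    cases ε
    · exact Or.inl hx
    · exact Or.inr hx⟩

theorem exists_cubeHom {K : Interval} {f : Cell (nerveObj K G.G) n}
    (hf : IsLoop (nerveObj K G.G) (nerveVertex K G.G G.pt) f) : ∃ h : CubeHom K n G, h.cell = f :=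
  ⟨⟨f, by
    rintro x ⟨i, hx | hx⟩
    · exact isLoop_nerve_iff.1 hf x i false hx
    · exact isLoop_nerve_iff.1 hf x i true hx⟩, rfl⟩

/-- Homotopic loops in a nerve define the same class. -/
theorem classes_eq_of_htpyRel {K : Interval} {f f' : CubeHom K n G}
    (h : HtpyRel (nerveObj K G.G) (nerveVertex K G.G G.pt) f.cell f'.cell) :
    (Quot.mk _ f : DPair.Classes _ G.toPair) = Quot.mk _ f' := by
  obtain ⟨F, hF, h0, h1⟩ := htpyRel_nerve_iff.1 h
  let c : K.Pt → CubeHom K n G := fun t =>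
    { hom :=
      { toFun := fun x => nv F (Fin.snoc (α := fun _ => K.Pt) x t)
        map_arrow := by
          rintro x y (rfl | ⟨i, hi, hj⟩)
          · exact G.G.refl _
          · have : (Fin.snoc (α := fun _ => K.Pt) y t : Fin (n + 1) → K.Pt) =
                Function.update (Fin.snoc (α := fun _ => K.Pt) x t) i.castSucc (y i) := by
              rw [← Fin.snoc_update]
              congr 1
              funext j
              by_cases hji : j = i
              · subst hji
                rw [Function.update_self]
              · rw [Function.update_of_ne hji, hj j hji]
            rw [this]
            refine nv_arrow F _ _ _ ?_
            rw [Fin.snoc_castSucc]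
            exact hi }
      map_sub := by
        rintro x ⟨i, hx | hx⟩
        · exact hF _ i false ((Fin.snoc_castSucc (α := fun _ => K.Pt) t x i).trans hx)
        · exact hF _ i true ((Fin.snoc_castSucc (α := fun _ => K.Pt) t x i).trans hx) }
  have hc0 : c (K.end' false) = f := DPair.Hom.ext (DGra.Hom.ext (funext h0))
  have hc1 : c (K.end' true) = f' := DPair.Hom.ext (DGra.Hom.ext (funext h1))
  rw [← hc0, ← hc1]
  refine classes_eq_of_chain c (fun a b hab => ⟨fun x => ?_, fun x hx => ?_⟩) _ _
  · have : (Fin.snoc (α := fun _ => K.Pt) x b : Fin (n + 1) → K.Pt) =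
        Function.update (Fin.snoc (α := fun _ => K.Pt) x a) (Fin.last n) b := by
      rw [Fin.update_snoc_last]
    change G.G.Arrow (nv F _) (nv F _)
    rw [this]
    refine nv_arrow F _ _ _ ?_
    rw [Fin.snoc_last]
    exact hab
  · exact ((c a).map_sub x hx).trans ((c b).map_sub x hx).symm

/-- Two loops that are related by arrows are homotopic: the homotopy jumps from one to the other
between the first two vertices of the interval. -/
theorem htpyRel_of_homArrow {K : Interval} {f f' : CubeHom K n G} (hK : 0 < K.len)
    (h : ∀ t : K.Pt, t ≠ ⊥ → K.toDGra.Arrow ⊥ t → ∀ x, G.G.Arrow (nv f.cell x) (nv f'.cell x))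
    (h' : ∀ t : K.Pt, t ≠ ⊥ → K.toDGra.Arrow t ⊥ → ∀ x, G.G.Arrow (nv f'.cell x) (nv f.cell x)) :
    HtpyRel (nerveObj K G.G) (nerveVertex K G.G G.pt) f.cell f'.cell := by
  refine htpyRel_nerve_iff.2 ⟨ncell (fun x => if x (Fin.last n) = ⊥ then nv f.cell (Fin.init x)
    else nv f'.cell (Fin.init x)) ?_, ?_, ?_, ?_⟩
  · intro x i a hxa
    induction i using Fin.lastCases with
    | last =>
      have e : (Fin.init (Function.update x (Fin.last n) a) : Fin n → K.Pt) = Fin.init x :=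
        Fin.init_update_last (α := fun _ => K.Pt) x a
      rw [Function.update_self, e]
      split_ifs with h1 h2 h2
      · exact G.G.refl _
      · rw [h1] at hxa
        exact h a h2 hxa _
      · rw [h2] at hxa
        exact h' _ h1 hxa _
      · exact G.G.refl _
    | cast i =>
      have e : (Fin.init (Function.update x i.castSucc a) : Fin n → K.Pt) =
          Function.update (Fin.init x) i a := Fin.init_update_castSucc (α := fun _ => K.Pt) x i a
      rw [Function.update_of_ne (Fin.castSucc_lt_last i).ne', e]
      split_ifs
      · exact nv_arrow _ _ _ _ hxa
      · exact nv_arrow _ _ _ _ hxa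
  · intro x i ε hx
    rw [nv_ncell]
    split_ifs
    · exact isLoop_nerve_iff.1 f.isLoop (Fin.init x) i ε hx
    · exact isLoop_nerve_iff.1 f'.isLoop (Fin.init x) i ε hx
  · intro x
    rw [nv_ncell, Fin.snoc_last, if_pos (show K.end' false = ⊥ from rfl), Fin.init_snoc]
  · intro x
    have : K.end' true ≠ ⊥ := fun e => by
      have := congrArg Fin.val e
      change K.len = 0 at this
      omega
    rw [nv_ncell, Fin.snoc_last, if_neg this, Fin.init_snoc]

/-- The element of the homotopy group that is represented by a map of pairs. -/
def homPi (k : ℕ) (f : CubeHom (stInterval k) n G) : (cubicalPi n).obj (nerveInfPt.obj G) :=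
  piMk (nerveInfPt.obj G) ((inc G.G k).app (op (Box.mk n)) f.cell) (by
    have := f.isLoop.app (inc G.G k)
    rwa [inc_nerveVertex] at this)

theorem homPi_eq_of_htpyRel {k : ℕ} {f f' : CubeHom (stInterval k) n G}
    (h : HtpyRel (nerveObj (stInterval k) G.G) (nerveVertex (stInterval k) G.G G.pt)
      f.cell f'.cell) : homPi k f = homPi k f' :=
  piMk_eq_of_htpyRel _ _ (by
    have := h.app (inc G.G k)
    rwa [inc_nerveVertex] at this)

theorem homPi_eq_of_homArrow {k : ℕ} {f f' : CubeHom (stInterval k) n G}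
    (h : DPair.HomArrow f f') : homPi k f = homPi k f' := by
  have hbot : ∀ t : (stInterval k).Pt, t ≠ ⊥ → 0 < t.val := fun t ht =>
    Nat.pos_of_ne_zero fun e => ht (Fin.ext e)
  have h0 : ((⊥ : (stInterval k).Pt) : ℕ) = 0 := rfl
  have hk : 0 < (stInterval k).len := Nat.succ_pos k
  by_cases he : Even (k / 2)
  · refine homPi_eq_of_htpyRel (htpyRel_of_homArrow hk (fun _ _ _ => h.1) fun t ht hat => ?_)
    have := hbot t ht
    rw [stInterval_arrow_iff, Nat.even_iff] at hat
    rw [Nat.even_iff] at he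
    omega
  · refine (homPi_eq_of_htpyRel
      (htpyRel_of_homArrow hk (fun t ht hat => ?_) fun _ _ _ => h.1)).symm
    have := hbot t ht
    rw [stInterval_arrow_iff, Nat.even_iff] at hat
    rw [Nat.even_iff] at he
    omega

/-- The map from homotopy classes of maps of pairs to the homotopy group. -/
def classPi (k : ℕ) : DPair.Classes (DPair.boxProd fun _ : Fin n => (stInterval k).toPair) G.toPair →
    (cubicalPi n).obj (nerveInfPt.obj G) :=
  Quot.lift (homPi k) fun _ _ h => homPi_eq_of_homArrow h

theorem classPi_precomp_stShr {k k' : ℕ} (h : k ≤ k')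
    (c : DPair.Classes (DPair.boxProd fun _ : Fin n => (stInterval k).toPair) G.toPair) :
    classPi k' (DPair.Classes.precomp
      (DPair.boxProdMap fun _ => Interval.toPairMap (stShr h)) c) = classPi k c := by
  obtain ⟨f⟩ := c
  change piMk _ _ _ = piMk _ _ _
  congr 1
  exact inc_trans_app h (CubeHom.cell f)

/-- Pulling back along shrinkings from a standard interval gives a class that does not depend on
their choice. -/
theorem classPi_precomp_eq {J : Fin n → Interval} {k k' : ℕ} (s : ∀ i, stInterval k ⟶ J i)
    (s' : ∀ i, stInterval k' ⟶ J i)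
    (c : DPair.Classes (DPair.boxProd fun i => (J i).toPair) G.toPair) :
    classPi k (DPair.Classes.precomp (DPair.boxProdMap fun i => Interval.toPairMap (s i)) c) =
      classPi k' (DPair.Classes.precomp
        (DPair.boxProdMap fun i => Interval.toPairMap (s' i)) c) := by
  rw [← classPi_precomp_stShr (le_max_left k k'), ← classPi_precomp_stShr (le_max_right k k')]
  obtain ⟨f⟩ := c
  refine congrArg (classPi _) ?_
  exact EndMap.pull_eq f (fun i => EndMap.ofShrinking (stShr (le_max_left k k') ≫ s i))
    fun i => EndMap.ofShrinking (stShr (le_max_right k k') ≫ s' i)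

end classPi

/-! ### The comparison of homotopy groups -/

section comparison

variable (n : ℕ) (G : PDGra.{u})

/-- A shrinking of a standard interval onto each member of a finite family of intervals. -/
def someShrinkings {n : ℕ} (J : Fin n → Interval) :
    ∀ i, stInterval (exists_shrinkings J).choose ⟶ J i :=
  (exists_shrinkings J).choose_spec.some

/-- The maps from the classes `[⨂ (Jᵢ, ∂Jᵢ), (G, g)]` to the homotopy group, as a cocone. -/
def comparisonCocone : Cocone (loopClasses n G) where
  pt := (cubicalPi n).obj (nerveInfPt.obj G)
  ι :=
    { app J := ↾fun c => classPi _ (DPair.Classes.precomp (DPair.boxProdMap fun i =>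
        Interval.toPairMap (someShrinkings (fun i => (J i).unop) i)) c)
      naturality J J' r := by
        refine ConcreteCategory.hom_ext _ _ fun c => ?_
        obtain ⟨f⟩ := c
        exact classPi_precomp_eq
          (fun i => someShrinkings (fun i => (J' i).unop) i ≫ (r i).unop)
          (someShrinkings fun i => (J i).unop) (Quot.mk _ f) }

/-- The map from the cubical homotopy group of a pointed digraph to the homotopy group of its
infinite nerve. -/
def comparison : (A n).obj G ⟶ (cubicalPi n).obj (nerveInfPt.obj G) :=
  colimit.desc (loopClasses n G) (comparisonCocone n G)

/-- The comparison map can be computed with any shrinkings. -/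
theorem comparison_ι {J : Fin n → Intervalᵒᵖ} {k : ℕ} (s : ∀ i, stInterval k ⟶ (J i).unop)
    (c : (loopClasses n G).obj J) :
    comparison n G (colimit.ι (loopClasses n G) J c) = classPi k
      (DPair.Classes.precomp (DPair.boxProdMap fun i => Interval.toPairMap (s i)) c) := by
  refine (ConcreteCategory.congr_hom (colimit.ι_desc (comparisonCocone n G) J) c).trans ?_
  exact classPi_precomp_eq (someShrinkings fun i => (J i).unop) s c

/-- The element of the cubical homotopy group represented by a map of pairs on a power of a standard
interval. -/
def homA (k : ℕ) (f : CubeHom (stInterval k) n G) : (A n).obj G :=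
  colimit.ι (loopClasses n G) (fun _ => op (stInterval k)) (Quot.mk _ f)

variable {n G}

theorem comparison_homA (k : ℕ) (f : CubeHom (stInterval k) n G) :
    comparison n G (homA n G k f) = homPi k f :=
  (comparison_ι n G (fun _ => 𝟙 (stInterval k)) (Quot.mk _ f)).trans rfl

theorem exists_homA (c : (A n).obj G) : ∃ k₀, ∀ k, k₀ ≤ k → ∃ f, homA n G k f = c := by
  obtain ⟨J, c, rfl⟩ := Types.jointly_surjective' (F := loopClasses n G) c
  obtain ⟨f⟩ := c
  obtain ⟨k₀, ⟨s⟩⟩ := exists_shrinkings fun i => (J i).unop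
  refine ⟨k₀, fun k hk => ⟨(DPair.boxProdMap fun i =>
    Interval.toPairMap (stShr hk ≫ s i)).comp f, ?_⟩⟩
  exact ConcreteCategory.congr_hom (colimit.w (loopClasses n G) (j' := J)
    (j := fun _ => op (stInterval k)) fun i => (stShr hk ≫ s i).op) (Quot.mk _ f)

theorem homA_stShr {k k' : ℕ} (h : k ≤ k') (f : CubeHom (stInterval k) n G)
    (f' : CubeHom (stInterval k') n G) (hf : f'.cell = (shrMap (stShr h) G.G).app _ f.cell) :
    homA n G k' f' = homA n G k f := by
  have e : f' = (DPair.boxProdMap fun _ => Interval.toPairMap (stShr h)).comp f :=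
    DPair.Hom.ext hf
  rw [e]
  exact ConcreteCategory.congr_hom (colimit.w (loopClasses n G) (j' := fun _ => op (stInterval k))
    (j := fun _ => op (stInterval k')) fun i => (stShr h).op) (Quot.mk _ f)

theorem comparison_bijective (n : ℕ) (G : PDGra.{u}) : Function.Bijective (comparison n G) := by
  constructor
  · intro c d hcd
    obtain ⟨k₀, hk₀⟩ := exists_homA c
    obtain ⟨k₁, hk₁⟩ := exists_homA d
    obtain ⟨f, rfl⟩ := hk₀ (max k₀ k₁) (le_max_left _ _)
    obtain ⟨f', rfl⟩ := hk₁ (max k₀ k₁) (le_max_right _ _)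
    rw [comparison_homA, comparison_homA] at hcd
    obtain ⟨k, hk, h⟩ := exists_htpyRel_of_inc ((piMk_eq_iff (isKan_nerveInf G.G) _ _).1 hcd)
    obtain ⟨g, hg⟩ := exists_cubeHom h.isLoop_left
    obtain ⟨g', hg'⟩ := exists_cubeHom h.isLoop_right
    rw [← homA_stShr hk f g hg, ← homA_stShr hk f' g' hg']
    rw [← hg, ← hg'] at h
    exact congrArg (colimit.ι (loopClasses n G) fun _ => op (stInterval k)) (classes_eq_of_htpyRel h)
  · intro c
    obtain ⟨α, hα, rfl⟩ := piMk_surjective c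
    obtain ⟨k, f, rfl⟩ := exists_inc α
    have hf : IsLoop (nerveInf.obj G.G) (nerveInfVertex G.G G.pt)
      ((inc G.G k).app (op (Box.mk n)) f) := hα
    rw [← inc_nerveVertex G.G G.pt k, isLoop_inc_iff] at hf
    obtain ⟨h, rfl⟩ := exists_cubeHom hf
    exact ⟨homA n G k h, comparison_homA k h⟩

theorem comparison_naturality (n : ℕ) {G H : PDGra.{u}} (φ : G ⟶ H) :
    (A n).map φ ≫ comparison n H = comparison n G ≫ (cubicalPi n).map (nerveInfPt.map φ) := by
  refine ConcreteCategory.hom_ext _ _ fun c => ?_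
  obtain ⟨k, hk⟩ := exists_homA c
  obtain ⟨f, rfl⟩ := hk k le_rfl
  have h1 : (A n).map φ (homA n G k f) = homA n H k (f.comp (PDGra.toPairMap φ)) :=
    ConcreteCategory.congr_hom (ι_colimMap (loopClassesMap n φ) fun _ => op (stInterval k))
      (Quot.mk _ f)
  change comparison n H ((A n).map φ (homA n G k f)) =
    (cubicalPi n).map (nerveInfPt.map φ) (comparison n G (homA n G k f))
  rw [h1, comparison_homA, comparison_homA, homPi, homPi]
  have h2 : (nerveInf.map φ.hom).app (op (Box.mk n)) ((inc G.G k).app (op (Box.mk n)) f.cell) =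
      (inc H.G k).app (op (Box.mk n)) (CubeHom.cell (f.comp (PDGra.toPairMap φ))) :=
    app_of_congr (nerveInf_map_inc φ.hom k) f.cell
  have h3 : IsLoop (nerveInf.obj H.G) (nerveInfVertex H.G H.pt)
      ((nerveInf.map φ.hom).app (op (Box.mk n)) ((inc G.G k).app (op (Box.mk n)) f.cell)) := by
    have := (CubeHom.isLoop (f.comp (PDGra.toPairMap φ))).app (inc H.G k)
    rw [inc_nerveVertex] at this
    rw [h2]
    exact this
  refine Eq.trans ?_ (cubicalPi_map_piMk (nerveInfPt.map φ) _ h3).symm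
  congr 1
  exact h2.symm

/-- The cubical homotopy groups of a pointed digraph are the homotopy groups of its infinite
nerve. -/
def comparisonIso (n : ℕ) : A.{u} n ≅ nerveInfPt.{u} ⋙ cubicalPi.{u} n :=
  NatIso.ofComponents (fun G => (Equiv.ofBijective _ (comparison_bijective n G)).toIso)
    fun φ => comparison_naturality n φ

end comparison

theorem isCubicalWeakEquiv_iff {G H : DGra.{u}} (φ : G ⟶ H) (hne : Nonempty H.V → Nonempty G.V) :
    IsCubicalWeakEquiv φ ↔ IsWeakEquiv (nerveInf.map φ) := by
  rw [isWeakEquiv_iff_piBij (isKan_nerveInf G) (isKan_nerveInf H) _ (by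
    rintro ⟨y⟩
    obtain ⟨h, -⟩ := exists_nerveInfVertex y
    exact (hne ⟨h⟩).map (nerveInfVertex G))]
  refine forall_congr' fun n => ?_
  have key : ∀ g : G.V, IsIso ((A n).map (⟨φ, rfl⟩ : (⟨G, g⟩ : PDGra.{u}) ⟶ ⟨H, φ.toFun g⟩)) ↔
      PiBij (nerveInf.map φ) n (nerveInfVertex G g) := fun g => by
    rw [NatIso.isIso_map_iff (comparisonIso n)]
    exact isIso_cubicalPi_map_iff (X := nerveInfPt.obj ⟨G, g⟩)
      (Y := nerveInfPt.obj ⟨H, φ.toFun g⟩) (isKan_nerveInf G) (isKan_nerveInf H)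
      (nerveInfPt.map (⟨φ, rfl⟩ : (⟨G, g⟩ : PDGra.{u}) ⟶ ⟨H, φ.toFun g⟩)) n
  constructor
  · intro h x
    obtain ⟨g, rfl⟩ := exists_nerveInfVertex x
    exact (key g).1 (h g)
  · intro h g
    exact (key g).2 (h _)

end CubDG

end

theorem mainTheorem7 :
    -- `N_∞ G` is a Kan complex, so that its homotopy groups are defined
    (∀ G : CubDG.DGra.{u}, CubDG.IsKan (CubDG.nerveInf.obj G)) ∧
    -- `Aₙ(G, g) ≅ πₙ(N_∞ G, g)`, naturally in the pointed digraph `(G, g)`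
    (∀ n : ℕ, Nonempty (CubDG.A.{u} n ≅ CubDG.nerveInfPt.{u} ⋙ CubDG.cubicalPi.{u} n)) ∧
    -- `φ` is a cubical weak equivalence iff `N_∞ φ` is a weak equivalence
    (∀ (G H : CubDG.DGra.{u}) (φ : G ⟶ H), (Nonempty H.V → Nonempty G.V) →
      (CubDG.IsCubicalWeakEquiv φ ↔ CubDG.IsWeakEquiv (CubDG.nerveInf.map φ))) ∧
    -- `N_∞ φ` is a weak equivalence iff `N₁ φ` is a weak equivalence
    (∀ (G H : CubDG.DGra.{u}) (φ : G ⟶ H),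
      CubDG.IsWeakEquiv (CubDG.nerveInf.map φ) ↔
        CubDG.IsWeakEquiv ((CubDG.nerve (CubDG.stdInterval 1 false)).map φ)) :=
  ⟨CubDG.isKan_nerveInf, fun n => ⟨CubDG.comparisonIso n⟩,
    fun _ _ φ hne => CubDG.isCubicalWeakEquiv_iff φ hne,
    fun _ _ φ => CubDG.isWeakEquiv_nerveInf_map_iff φ⟩
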